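/- Let $\mathcal S$ be a pivotal symmetric monoidal category (that is, a ribbon category whose braiding $s_{A,B}\colon A\otimes B\to B\otimes A$ is symmetric), and let $H$ be a Hopf algebra in $\mathcal S$ with product $\mu$, unit $\eta$, coproduct $\Delta$, counit $\varepsilon$ and invertible antipode $S$. Let $\mathcal C=\mathcal C_0+\mathcal C_1$ (disjoint union of categories) with $\mathcal C_0=\mathrm{Rep}_{\mathcal S}(H)$, the left $H$-modules in $\mathcal S$, and $\mathcal C_1=\mathcal S$, with the $\mathbb Z/2$-graded tensor product functor - $A\ast B=A\otimes B\in\mathcal C_0$ with the diagonal action through $\Delta$, for $A,B\in\mathcal C_0$; - $A\ast B=A\otimes B\in\mathcal C_1$ (the underlying objects), if exactly one of $A,B$ lies in $\mathcal C_0$; - $A\ast B=H\otimes A\otimes B\in\mathcal C_0$ with action by multiplication on $H$, for $A,B\in\mathcal C_1$. The tensor unit is $\mathbf 1$ with the trivial action, in degree $0$, and the unit isomorphisms are those of $\mathcal S$. For points $x\colon\mathbf 1\to H$ write ${}_xM$, $M_x$ for left and right multiplication by $x$ and, for invertible $x$, $\mathrm{Ad}_x=x(-)x^{-1}$. Below,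 $\gamma=\gamma'\otimes\gamma''$ and $\Delta(h)=h_1\otimes h_2$, and element formulas stand for the corresponding morphisms of $\mathcal S$, all permutations of factors being made with $s$. Let $\gamma\colon\mathbf 1\to H\otimes H$, $\lambda\colon H\to\mathbf 1$ and an invertible $g\colon\mathbf 1\to H$ be such that 1. $\gamma$ is a Hopf copairing, i.e. $(\Delta\otimes\mathrm{id})\gamma=\gamma_{13}\gamma_{23}$, $(\mathrm{id}\otimes\Delta)\gamma=\gamma_{12}\gamma_{13}$, $(\varepsilon\otimes\mathrm{id})\gamma=\eta=(\mathrm{id}\otimes\varepsilon)\gamma$, and it is non-degenerate, i.e. it is the coevaluation of a duality of $H$ with itself; 2. $\lambda$ is a right cointegral, $(\lambda\otimes\mathrm{id})\Delta=\eta\lambda$, with $(\mathrm{id}\otimes\lambda)\Delta=g\lambda$ and $(\lambda\otimes\lambda)(\mathrm{id}\otimes S)\gamma=\mathrm{id}_{\mathbf 1}$; 3. $s_{H,H}\circ\gamma=(\mathrm{id}\otimes(S^2\circ\mathrm{Ad}_g^{-1}))\circ\gamma$. Let further $\sigma\colon\mathbf 1\to H$ and $\beta\colon\mathbf 1\to\mathbf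 1$ be invertible, and let $\omega$ be an involutive monoidal automorphism of the identity functor of $\mathcal S$, such that 1. $\gamma=({}_{\sigma^{-1}}M\otimes M_{\sigma^{-1}})\circ\Delta\circ\sigma$; 2. $\lambda\circ S=\lambda\circ\mathrm{Ad}_\sigma$ and $\lambda\circ\sigma=\beta\circ\beta$; 3. $\mathrm{Ad}_\sigma$ is an isomorphism of Hopf algebras $H\to H_{\mathrm{cop}}$ (opposite coproduct); 4. $S\circ\sigma={}_gM\circ\sigma=M_{g^{-1}}\circ\sigma$; 5. $(\mathrm{id}\otimes\omega_H)\circ\gamma=(\mathrm{Ad}_\sigma\otimes(\mathrm{Ad}_\sigma^{-1}\circ S))\circ\gamma$. Then the following morphisms $\alpha_{A,B,C}\colon A\ast(B\ast C)\to(A\ast B)\ast C$ are natural isomorphisms in $\mathcal C$ which make $\mathcal C$ a monoidal category (the label $abc$ means $A\in\mathcal C_a$, $B\in\mathcal C_b$, $C\in\mathcal C_c$): - $000$, $001$, $100$: the associator of $\mathcal S$; - $010$: $a\otimes b\otimes c\mapsto\gamma'a\otimes b\otimes\gamma''c$; - $011$: $a\otimes h\otimes b\otimes c\mapsto h_2\otimes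 S^{-1}(h_1)a\otimes b\otimes c$; - $101$: $h\otimes a\otimes b\otimes c\mapsto h\gamma''\otimes a\otimes g\gamma'b\otimes c$; - $110$: $h\otimes a\otimes b\otimes c\mapsto h_1\otimes a\otimes b\otimes h_2c$; - $111$: $a\otimes h\otimes b\otimes c\mapsto S(\gamma')\,\lambda(\gamma''h)\otimes a\otimes b\otimes c$; and the following morphisms $c_{A,B}\colon A\ast B\to B\ast A$ are natural isomorphisms in $\mathcal C$ which define a braiding on this monoidal category: - $00$: the action of $(\mathrm{Ad}_\sigma\otimes S)\gamma$ on $A\otimes B$, followed by $s_{A,B}$; - $01$: $s_{A,B}\circ((\sigma\cdot)\otimes\mathrm{id}_B)$; - $10$: $s_{A,B}\circ(\mathrm{id}_A\otimes(\sigma\cdot)\omega_B)$; - $11$: $\beta\cdot\big(M_{\sigma^{-1}}\otimes s_{A,B}\circ(\mathrm{id}_A\otimes\omega_B)\big)$ on $H\otimes A\otimes B$. -/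

import Mathlib

open CategoryTheory MonoidalCategory BraidedCategory
open scoped MonObj ComonObj HopfObj

universe v u

namespace HopfExt

variable {S : Type u} [Category.{v} S] [MonoidalCategory S] [SymmetricCategory S]

/-! ### Points of a monoid object, and scalars -/

section Points

variable {H : S} [MonObj H]

/-- The product `x y` of two points `x y : 𝟙 ⟶ H`. -/
def pmul (x y : 𝟙_ S ⟶ H) : 𝟙_ S ⟶ H := (λ_ (𝟙_ S)).inv ≫ (x ⊗ₘ y) ≫ μ[H]

/-- `x'` is a two-sided inverse of the point `x`. -/
structure IsInvPt (x x' : 𝟙_ S ⟶ H) : Prop where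
  mul_inv : pmul x x' = η[H]
  inv_mul : pmul x' x = η[H]

/-- Left multiplication `ₓM : h ↦ x h`. -/
def lmul (x : 𝟙_ S ⟶ H) : H ⟶ H := (λ_ H).inv ≫ x ▷ H ≫ μ[H]

/-- Right multiplication `Mₓ : h ↦ h x`. -/
def rmul (x : 𝟙_ S ⟶ H) : H ⟶ H := (ρ_ H).inv ≫ H ◁ x ≫ μ[H]

/-- `h ↦ x h x'`. This is `Ad_x` when `x'` is the inverse of `x`,
and then `conjPt x' x` is the inverse of `Ad_x`. -/
def conjPt (x x' : 𝟙_ S ⟶ H) : H ⟶ H := lmul x ≫ rmul x'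

end Points

/-- Multiplication of a morphism by a scalar `b : 𝟙 ⟶ 𝟙`. -/
def scal (b : 𝟙_ S ⟶ 𝟙_ S) {X Y : S} (f : X ⟶ Y) : X ⟶ Y :=
  (λ_ X).inv ≫ (b ⊗ₘ f) ≫ (λ_ Y).hom

/-! ### Copairings and cointegrals -/

/-- Hopf copairings:
`(Δ ⊗ id) γ = γ₁₃ γ₂₃`, `(id ⊗ Δ) γ = γ₁₂ γ₁₃`, `(ε ⊗ id) γ = η = (id ⊗ ε) γ`. -/
structure IsHopfCopairing {H : S} [HopfObj H] (c : 𝟙_ S ⟶ H ⊗ H) : Prop where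
  comul_left : c ≫ Δ[H] ▷ H =
    (λ_ (𝟙_ S)).inv ≫ (c ⊗ₘ c) ≫ tensorμ H H H H ≫ (H ⊗ H) ◁ μ[H]
  comul_right : c ≫ H ◁ Δ[H] =
    (λ_ (𝟙_ S)).inv ≫ (c ⊗ₘ c) ≫ tensorμ H H H H ≫ μ[H] ▷ (H ⊗ H)
  counit_left : c ≫ ε[H] ▷ H ≫ (λ_ H).hom = η[H]
  counit_right : c ≫ H ◁ ε[H] ≫ (ρ_ H).hom = η[H]

/-- `c` is non-degenerate: it is the copairing of a duality of `H` with itself. -/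
def Nondeg {H : S} (c : 𝟙_ S ⟶ H ⊗ H) : Prop :=
  ∃ P : ExactPairing H H, P.coevaluation' = c

/-- Right cointegrals: `(l ⊗ id) ∘ Δ = η ∘ l`. -/
def IsRightCointegral {H : S} [HopfObj H] (l : H ⟶ 𝟙_ S) : Prop :=
  Δ[H] ≫ l ▷ H ≫ (λ_ H).hom = l ≫ η[H]

/-- `f : H ⟶ H` is an isomorphism of Hopf algebras `H → H_cop`, where `H_cop` has the same
algebra structure and the opposite coproduct. -/
structure IsHopfIsoToCop {H : S} [HopfObj H] (f : H ⟶ H) : Prop where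
  isIso : IsIso f
  isMonHom : IsMonHom f
  counit : f ≫ ε[H] = ε[H]
  comul : f ≫ Δ[H] ≫ (β_ H H).hom = Δ[H] ≫ (f ⊗ₘ f)

/-! ### The tensor product of `Rep_S(H)` and the free modules -/

section Modules

variable (H : S) [HopfObj H]

variable {H} in
/-- The action `H ⊗ A ⟶ A` of a module. -/
abbrev act (A : Mod S H) : H ⊗ A.X ⟶ A.X := ModObj.smul (M := H) (X := A.X)

variable {H} in
/-- The diagonal action on `A ⊗ B`. -/
def diagAct (A B : Mod S H) : H ⊗ (A.X ⊗ B.X) ⟶ A.X ⊗ B.X :=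
  Δ[H] ▷ (A.X ⊗ B.X) ≫ tensorμ H H A.X B.X ≫ (act A ⊗ₘ act B)

variable {H} in
/-- The tensor product of two modules, with action through the coproduct. -/
def tensorMod (A B : Mod S H) : Mod S H where
  X := A.X ⊗ B.X
  mod :=
    { smul := diagAct A B
      one_smul := by
        change η[H] ▷ (A.X ⊗ B.X) ≫ diagAct A B = (λ_ (A.X ⊗ B.X)).hom
        rw [diagAct, ← comp_whiskerRight_assoc, BimonObj.one_comul, MonObj.tensorObj.one_def,
          comp_whiskerRight_assoc, tensorμ_natural_left_assoc, tensorHom_comp_tensorHom,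
          ModObj.one_smul_self, ModObj.one_smul_self, ← tensor_left_unitality]
      mul_smul := by
        change μ[H] ▷ (A.X ⊗ B.X) ≫ diagAct A B =
          (α_ H H (A.X ⊗ B.X)).hom ≫ H ◁ diagAct A B ≫ diagAct A B
        have h := tensor_associativity H H H H A.X B.X
        rw [diagAct, ← comp_whiskerRight_assoc, BimonObj.mul_comul]
        simp only [comp_whiskerRight, Category.assoc, whiskerLeft_comp]
        rw [tensorμ_natural_left_assoc, tensorHom_comp_tensorHom, ModObj.mul_smul_self,
          ModObj.mul_smul_self, ← tensorHom_comp_tensorHom, reassoc_of% h,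
          whisker_exchange_assoc, whisker_exchange_assoc, tensorμ_natural_right_assoc,
          tensorHom_comp_tensorHom, tensorHom_def' (Δ[H]) (Δ[H]), comp_whiskerRight_assoc]
        simp }

variable {H} in
/-- The tensor product of two module morphisms. -/
def tensorModMap {A A' B B' : Mod S H} (f : A ⟶ A') (g : B ⟶ B') :
    tensorMod A B ⟶ tensorMod A' B' :=
  Mod.Hom.mk' (M := tensorMod A B) (N := tensorMod A' B') (f.hom ⊗ₘ g.hom) (by
    change diagAct A B ≫ (f.hom ⊗ₘ g.hom) = H ◁ (f.hom ⊗ₘ g.hom) ≫ diagAct A' B'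
    rw [diagAct, diagAct, whisker_exchange_assoc, tensorμ_natural_right_assoc]
    have hf : act A ≫ f.hom = H ◁ f.hom ≫ act A' := IsModHom.smul_hom
    have hg : act B ≫ g.hom = H ◁ g.hom ≫ act B' := IsModHom.smul_hom
    simp only [Category.assoc, tensorHom_comp_tensorHom, hf, hg])

/-- The tensor unit of `S` with the trivial action through the counit. -/
def trivMod : Mod S H where
  X := 𝟙_ S
  mod :=
    { smul := (ρ_ H).hom ≫ ε[H]
      one_smul := by
        change η[H] ▷ 𝟙_ S ≫ (ρ_ H).hom ≫ ε[H] = (λ_ (𝟙_ S)).hom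
        rw [rightUnitor_naturality_assoc, BimonObj.one_counit]
        simp [unitors_equal]
      mul_smul := by
        change μ[H] ▷ 𝟙_ S ≫ (ρ_ H).hom ≫ ε[H] =
          (α_ H H (𝟙_ S)).hom ≫ H ◁ ((ρ_ H).hom ≫ ε[H]) ≫ (ρ_ H).hom ≫ ε[H]
        rw [rightUnitor_naturality_assoc, BimonObj.mul_counit, Comon.tensorObj_counit, tensorHom_def',
          unitors_equal, Category.assoc, rightUnitor_naturality]
        simp }

/-- The module `H ⊗ X`, with action by multiplication on `H`. -/
def freeMod (X : S) : Mod S H where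
  X := H ⊗ X
  mod :=
    { smul := (α_ H H X).inv ≫ μ[H] ▷ X
      one_smul := by
        change η[H] ▷ (H ⊗ X) ≫ (α_ H H X).inv ≫ μ[H] ▷ X = (λ_ (H ⊗ X)).hom
        rw [associator_inv_naturality_left_assoc, ← comp_whiskerRight, MonObj.one_mul]
        simp
      mul_smul := by
        change μ[H] ▷ (H ⊗ X) ≫ (α_ H H X).inv ≫ μ[H] ▷ X =
          (α_ H H (H ⊗ X)).hom ≫ H ◁ ((α_ H H X).inv ≫ μ[H] ▷ X) ≫ (α_ H H X).inv ≫ μ[H] ▷ X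
        simp only [whiskerLeft_comp, Category.assoc]
        rw [associator_inv_naturality_left_assoc, ← comp_whiskerRight, MonObj.mul_assoc]
        simp }

/-- The module morphism `id ⊗ f`. -/
def freeModMap {X Y : S} (f : X ⟶ Y) : freeMod H X ⟶ freeMod H Y :=
  Mod.Hom.mk' (M := freeMod H X) (N := freeMod H Y) (H ◁ f) (by
    change ((α_ H H X).inv ≫ μ[H] ▷ X) ≫ H ◁ f = H ◁ (H ◁ f) ≫ (α_ H H Y).inv ≫ μ[H] ▷ Y
    simp only [Category.assoc]
    rw [← whisker_exchange]
    simp)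

/-- A morphism of `S` that commutes with the actions and is invertible in `S` is invertible
as a module morphism. -/
def modIso {A B : Mod S H} (e : A.X ≅ B.X) (h : act A ≫ e.hom = H ◁ e.hom ≫ act B) : A ≅ B where
  hom := Mod.Hom.mk' e.hom h
  inv := Mod.Hom.mk' e.inv (by
    change act B ≫ e.inv = H ◁ e.inv ≫ act A
    rw [Iso.comp_inv_eq, Category.assoc, h, ← whiskerLeft_comp_assoc]
    simp)
  hom_inv_id := by ext; exact e.hom_inv_id
  inv_hom_id := by ext; exact e.inv_hom_id

variable {H} in
/-- The left unitor of modules is that of `S`. -/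
def leftUnitorMod (A : Mod S H) : tensorMod (trivMod H) A ≅ A :=
  modIso H (λ_ A.X) (by
    change diagAct (trivMod H) A ≫ (λ_ A.X).hom = H ◁ (λ_ A.X).hom ≫ act A
    change (Δ[H] ▷ (𝟙_ S ⊗ A.X) ≫ tensorμ H H (𝟙_ S) A.X ≫
      (((ρ_ H).hom ≫ ε[H]) ⊗ₘ act A)) ≫ (λ_ A.X).hom = _
    have e : (((ρ_ H).hom ≫ ε[H]) ⊗ₘ act A) =
        (ε[H] ▷ 𝟙_ S ⊗ₘ 𝟙 H ▷ A.X) ≫ ((λ_ (𝟙_ S)).hom ⊗ₘ act A) := by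
      rw [tensorHom_comp_tensorHom, unitors_equal, rightUnitor_naturality, id_whiskerRight,
        Category.id_comp]
    rw [e, ← tensorμ_natural_left_assoc, ← comp_whiskerRight_assoc, tensorHom_id,
      ComonObj.counit_comul]
    simp [tensorμ, tensorHom_def'])

variable {H} in
/-- The right unitor of modules is that of `S`. -/
def rightUnitorMod (A : Mod S H) : tensorMod A (trivMod H) ≅ A :=
  modIso H (ρ_ A.X) (by
    change diagAct A (trivMod H) ≫ (ρ_ A.X).hom = H ◁ (ρ_ A.X).hom ≫ act A
    change (Δ[H] ▷ (A.X ⊗ 𝟙_ S) ≫ tensorμ H H A.X (𝟙_ S) ≫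
      (act A ⊗ₘ ((ρ_ H).hom ≫ ε[H]))) ≫ (ρ_ A.X).hom = _
    have e : (act A ⊗ₘ ((ρ_ H).hom ≫ ε[H])) =
        (𝟙 H ▷ A.X ⊗ₘ ε[H] ▷ 𝟙_ S) ≫ (act A ⊗ₘ (λ_ (𝟙_ S)).hom) := by
      rw [tensorHom_comp_tensorHom, unitors_equal, rightUnitor_naturality, id_whiskerRight,
        Category.id_comp]
    rw [e, ← tensorμ_natural_left_assoc, ← comp_whiskerRight_assoc, id_tensorHom,
      ComonObj.comul_counit]
    simp [tensorμ, MonoidalCategory.tensorHom_def, unitors_equal])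

end Modules

/-! ### The category `C = C₀ + C₁` and its tensor product -/

/-- `C = C₀ + C₁` with `C₀ = Rep_S(H)` (left summand) and `C₁ = S` (right summand): the disjoint
union of the two categories. -/
abbrev Ext (H : S) [HopfObj H] := Mod S H ⊕ S

variable {H : S} [HopfObj H]

/-- The functor `C ⥤ S` that forgets the degree and the action of `H`. -/
abbrev und (H : S) [HopfObj H] : Ext H ⥤ S := (Mod.forget H).sum' (𝟭 S)

/-- The tensor product `X ∗ Y` on objects. -/
def tObj : Ext H → Ext H → Ext H
  | .inl A, .inl B => .inl (tensorMod A B)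
  | .inl A, .inr V => .inr (A.X ⊗ V)
  | .inr U, .inl B => .inr (U ⊗ B.X)
  | .inr U, .inr V => .inl (freeMod H (U ⊗ V))

/-- The tensor product `f ∗ g` on morphisms. -/
def tHom : {X X' Y Y' : Ext H} → (X ⟶ X') → (Y ⟶ Y') → (tObj X Y ⟶ tObj X' Y')
  | .inl _, .inl _, .inl _, .inl _, f, g => ULift.up (tensorModMap f.down g.down)
  | .inl _, .inl _, .inr _, .inr _, f, g => ULift.up (f.down.hom ⊗ₘ g.down)
  | .inr _, .inr _, .inl _, .inl _, f, g => ULift.up (f.down ⊗ₘ g.down.hom)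
  | .inr _, .inr _, .inr _, .inr _, f, g => ULift.up (freeModMap H (f.down ⊗ₘ g.down))

/-- The tensor unit: the trivial module on the unit of `S`, in degree 0. -/
def tUnit (H : S) [HopfObj H] : Ext H := .inl (trivMod H)

/-- The left unitor, given by that of `S`. -/
def tLeft : (X : Ext H) → (tObj (tUnit H) X ≅ X)
  | .inl A => (Sum.inl_ (Mod S H) S).mapIso (leftUnitorMod A)
  | .inr U => (Sum.inr_ (Mod S H) S).mapIso (λ_ U)

/-- The right unitor, given by that of `S`. -/
def tRight : (X : Ext H) → (tObj X (tUnit H) ≅ X)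
  | .inl A => (Sum.inl_ (Mod S H) S).mapIso (rightUnitorMod A)
  | .inr U => (Sum.inr_ (Mod S H) S).mapIso (ρ_ U)

/-- The data of a monoidal structure on `C` with tensor product `∗`, the unit and the unitors
above, and a given family of isomorphisms as associator. -/
abbrev extStruct (a : ∀ X Y Z : Ext H, tObj (tObj X Y) Z ≅ tObj X (tObj Y Z)) :
    MonoidalCategoryStruct (Ext H) where
  tensorObj := tObj
  whiskerLeft X _ _ f := tHom (𝟙 X) f
  whiskerRight f Y := tHom f (𝟙 Y)
  tensorHom f g := tHom f g
  tensorUnit := tUnit H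
  associator := a
  leftUnitor := tLeft
  rightUnitor := tRight

/-- The axioms of a monoidal category, for given data. -/
structure MonoidalAxioms {C : Type*} [Category C] (D : MonoidalCategoryStruct C) : Prop where
  tensorHom_def {X₁ Y₁ X₂ Y₂ : C} (f : X₁ ⟶ Y₁) (g : X₂ ⟶ Y₂) :
    f ⊗ₘ g = (f ▷ X₂) ≫ (Y₁ ◁ g)
  id_tensorHom_id (X₁ X₂ : C) : 𝟙 X₁ ⊗ₘ 𝟙 X₂ = 𝟙 (X₁ ⊗ X₂)
  tensorHom_comp_tensorHom {X₁ Y₁ Z₁ X₂ Y₂ Z₂ : C}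
    (f₁ : X₁ ⟶ Y₁) (f₂ : X₂ ⟶ Y₂) (g₁ : Y₁ ⟶ Z₁) (g₂ : Y₂ ⟶ Z₂) :
    (f₁ ⊗ₘ f₂) ≫ (g₁ ⊗ₘ g₂) = (f₁ ≫ g₁) ⊗ₘ (f₂ ≫ g₂)
  whiskerLeft_id (X Y : C) : X ◁ 𝟙 Y = 𝟙 (X ⊗ Y)
  id_whiskerRight (X Y : C) : 𝟙 X ▷ Y = 𝟙 (X ⊗ Y)
  associator_naturality {X₁ X₂ X₃ Y₁ Y₂ Y₃ : C}
    (f₁ : X₁ ⟶ Y₁) (f₂ : X₂ ⟶ Y₂) (f₃ : X₃ ⟶ Y₃) :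
    ((f₁ ⊗ₘ f₂) ⊗ₘ f₃) ≫ (α_ Y₁ Y₂ Y₃).hom = (α_ X₁ X₂ X₃).hom ≫ (f₁ ⊗ₘ (f₂ ⊗ₘ f₃))
  leftUnitor_naturality {X Y : C} (f : X ⟶ Y) : 𝟙_ C ◁ f ≫ (λ_ Y).hom = (λ_ X).hom ≫ f
  rightUnitor_naturality {X Y : C} (f : X ⟶ Y) : f ▷ 𝟙_ C ≫ (ρ_ Y).hom = (ρ_ X).hom ≫ f
  pentagon (W X Y Z : C) :
    (α_ W X Y).hom ▷ Z ≫ (α_ W (X ⊗ Y) Z).hom ≫ W ◁ (α_ X Y Z).hom =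
      (α_ (W ⊗ X) Y Z).hom ≫ (α_ W X (Y ⊗ Z)).hom
  triangle (X Y : C) : (α_ X (𝟙_ C) Y).hom ≫ X ◁ (λ_ Y).hom = (ρ_ X).hom ▷ Y

/-- The monoidal category with given data that satisfy the axioms. -/
abbrev MonoidalAxioms.toMonoidalCategory {C : Type*} [Category C] {D : MonoidalCategoryStruct C}
    (h : MonoidalAxioms D) : MonoidalCategory C where
  __ := D
  tensorHom_def := h.tensorHom_def
  id_tensorHom_id := h.id_tensorHom_id
  tensorHom_comp_tensorHom := h.tensorHom_comp_tensorHom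
  whiskerLeft_id := h.whiskerLeft_id
  id_whiskerRight := h.id_whiskerRight
  associator_naturality := h.associator_naturality
  leftUnitor_naturality := h.leftUnitor_naturality
  rightUnitor_naturality := h.rightUnitor_naturality
  pentagon := h.pentagon
  triangle := h.triangle

/-! ### The associativity isomorphisms

All of them are given as morphisms of `S`, in the direction `X ∗ (Y ∗ Z) ⟶ (X ∗ Y) ∗ Z`.
In the comments `γ = γ' ⊗ γ''` and `Δ h = h₁ ⊗ h₂`. -/

/-- The endomorphism `a ⊗ b ↦ c' a ⊗ c'' b` of `A ⊗ B`. -/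
def actTwo (c : 𝟙_ S ⟶ H ⊗ H) (A B : Mod S H) : A.X ⊗ B.X ⟶ A.X ⊗ B.X :=
  (λ_ (A.X ⊗ B.X)).inv ≫ c ▷ (A.X ⊗ B.X) ≫ tensorμ H H A.X B.X ≫ (act A ⊗ₘ act B)

/-- Degrees 0,1,0: `a ⊗ v ⊗ b ↦ γ' a ⊗ v ⊗ γ'' b`. -/
def assoc010 (c : 𝟙_ S ⟶ H ⊗ H) (A : Mod S H) (V : S) (B : Mod S H) :
    A.X ⊗ (V ⊗ B.X) ⟶ (A.X ⊗ V) ⊗ B.X :=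
  A.X ◁ (β_ V B.X).hom ≫ (α_ A.X B.X V).inv ≫ actTwo c A B ▷ V ≫ (α_ A.X B.X V).hom ≫
    A.X ◁ (β_ B.X V).hom ≫ (α_ A.X V B.X).inv

/-- `A ⊗ H ⟶ H ⊗ A`, `a ⊗ h ↦ h₂ ⊗ S⁻¹(h₁) a`. -/
noncomputable def swapAct [IsIso 𝒮[H]] (A : Mod S H) : A.X ⊗ H ⟶ H ⊗ A.X :=
  A.X ◁ Δ[H] ≫ (β_ A.X (H ⊗ H)).hom ≫ (β_ H H).hom ▷ A.X ≫ (α_ H H A.X).hom ≫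
    H ◁ (inv 𝒮[H] ▷ A.X ≫ act A)

/-- Degrees 0,1,1: `a ⊗ h ⊗ u ⊗ v ↦ h₂ ⊗ S⁻¹(h₁) a ⊗ u ⊗ v`. -/
noncomputable def assoc011 [IsIso 𝒮[H]] (A : Mod S H) (U V : S) :
    A.X ⊗ (H ⊗ (U ⊗ V)) ⟶ H ⊗ ((A.X ⊗ U) ⊗ V) :=
  (α_ A.X H (U ⊗ V)).inv ≫ swapAct A ▷ (U ⊗ V) ≫ (α_ H A.X (U ⊗ V)).hom ≫
    H ◁ (α_ A.X U V).inv

/-- `H ⊗ A ⟶ H ⊗ A`, `h ⊗ a ↦ h γ'' ⊗ g γ' a`. -/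
def twistAct (c : 𝟙_ S ⟶ H ⊗ H) (g : 𝟙_ S ⟶ H) (A : Mod S H) : H ⊗ A.X ⟶ H ⊗ A.X :=
  H ◁ ((λ_ A.X).inv ≫ (c ≫ (β_ H H).hom ≫ H ◁ lmul g) ▷ A.X ≫ (α_ H H A.X).hom) ≫
    (α_ H H (H ⊗ A.X)).inv ≫ (μ[H] ⊗ₘ act A)

/-- Degrees 1,0,1: `h ⊗ u ⊗ a ⊗ v ↦ h γ'' ⊗ u ⊗ g γ' a ⊗ v`. -/
def assoc101 (c : 𝟙_ S ⟶ H ⊗ H) (g : 𝟙_ S ⟶ H) (U : S) (A : Mod S H) (V : S) :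
    H ⊗ (U ⊗ (A.X ⊗ V)) ⟶ H ⊗ ((U ⊗ A.X) ⊗ V) :=
  H ◁ ((α_ U A.X V).inv ≫ (β_ U A.X).hom ▷ V ≫ (α_ A.X U V).hom) ≫
    (α_ H A.X (U ⊗ V)).inv ≫ twistAct c g A ▷ (U ⊗ V) ≫ (α_ H A.X (U ⊗ V)).hom ≫
    H ◁ ((α_ A.X U V).inv ≫ (β_ A.X U).hom ▷ V)

/-- Degrees 1,1,0: `h ⊗ u ⊗ v ⊗ a ↦ h₁ ⊗ u ⊗ v ⊗ h₂ a`. -/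
def assoc110 (U V : S) (A : Mod S H) :
    H ⊗ (U ⊗ (V ⊗ A.X)) ⟶ (H ⊗ (U ⊗ V)) ⊗ A.X :=
  (Δ[H] ⊗ₘ (α_ U V A.X).inv) ≫ tensorμ H H (U ⊗ V) A.X ≫ (H ⊗ (U ⊗ V)) ◁ act A

/-- `H ⟶ H`, `h ↦ S(γ') λ(γ'' h)`. -/
def fourier (c : 𝟙_ S ⟶ H ⊗ H) (l : H ⟶ 𝟙_ S) : H ⟶ H :=
  (λ_ H).inv ≫ c ▷ H ≫ (α_ H H H).hom ≫ (𝒮[H] ⊗ₘ (μ[H] ≫ l)) ≫ (ρ_ H).hom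

/-- Degrees 1,1,1: `u ⊗ h ⊗ v ⊗ w ↦ S(γ') λ(γ'' h) ⊗ u ⊗ v ⊗ w`. -/
def assoc111 (c : 𝟙_ S ⟶ H ⊗ H) (l : H ⟶ 𝟙_ S) (U V W : S) :
    U ⊗ (H ⊗ (V ⊗ W)) ⟶ (H ⊗ (U ⊗ V)) ⊗ W :=
  (α_ U H (V ⊗ W)).inv ≫ ((β_ U H).hom ≫ fourier c l ▷ U) ▷ (V ⊗ W) ≫
    (α_ H U (V ⊗ W)).hom ≫ H ◁ (α_ U V W).inv ≫ (α_ H (U ⊗ V) W).inv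

/-- The associativity isomorphism `X ∗ (Y ∗ Z) ⟶ (X ∗ Y) ∗ Z`, as a morphism of `S`. -/
noncomputable def assocMap [IsIso 𝒮[H]] (c : 𝟙_ S ⟶ H ⊗ H) (l : H ⟶ 𝟙_ S) (g : 𝟙_ S ⟶ H) :
    (X Y Z : Ext H) → ((und H).obj (tObj X (tObj Y Z)) ⟶ (und H).obj (tObj (tObj X Y) Z))
  | .inl A, .inl B, .inl D => (α_ A.X B.X D.X).inv
  | .inl A, .inl B, .inr W => (α_ A.X B.X W).inv
  | .inl A, .inr V, .inl D => assoc010 c A V D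
  | .inl A, .inr V, .inr W => assoc011 A V W
  | .inr U, .inl B, .inl D => (α_ U B.X D.X).inv
  | .inr U, .inl B, .inr W => assoc101 c g U B W
  | .inr U, .inr V, .inl D => assoc110 U V D
  | .inr U, .inr V, .inr W => assoc111 c l U V W

/-! ### The braiding isomorphisms -/

/-- The endomorphism `a ↦ x a` of a module. -/
def actPt (x : 𝟙_ S ⟶ H) (A : Mod S H) : A.X ⟶ A.X := (λ_ A.X).inv ≫ x ▷ A.X ≫ act A

/-- The braiding isomorphism `X ∗ Y ⟶ Y ∗ X`, as a morphism of `S`; here `s'` is the inverse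
of `s` and `W` is the automorphism `ω` of the identity functor. In degrees
* 0,0: the action of `(Ad_σ ⊗ S) γ`, followed by the symmetry;
* 0,1: the action of `σ` on the first factor, followed by the symmetry;
* 1,0: `ω` and the action of `σ` on the second factor, followed by the symmetry;
* 1,1: `β` times `h ⊗ u ⊗ v ↦ h σ⁻¹ ⊗ ω(v) ⊗ u`. -/
def braidMap (c : 𝟙_ S ⟶ H ⊗ H) (s s' : 𝟙_ S ⟶ H) (b : 𝟙_ S ⟶ 𝟙_ S) (W : 𝟭 S ⟶ 𝟭 S) :
    (X Y : Ext H) → ((und H).obj (tObj X Y) ⟶ (und H).obj (tObj Y X))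
  | .inl A, .inl B => actTwo (c ≫ (conjPt s s' ⊗ₘ 𝒮[H])) A B ≫ (β_ A.X B.X).hom
  | .inl A, .inr V => actPt s A ▷ V ≫ (β_ A.X V).hom
  | .inr U, .inl B => U ◁ (W.app B.X ≫ actPt s B) ≫ (β_ U B.X).hom
  | .inr U, .inr V => scal b (rmul s' ⊗ₘ (U ◁ W.app V ≫ (β_ U V).hom))

end HopfExt

/-! The forgetful functor from `Ext H` to `S` is faithful. So the theorem amounts to equations in
`S` between morphisms built from the structure maps of `H`, the actions, `γ`, `λ`, `g`, `σ`, `β` and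
`ω`: linearity of the maps between objects of degree 0, invertibility, and one pentagon, triangle or
hexagon for each choice of degrees. Naturality holds because every building block is natural
(`Ex.sem_natural`).

The identities in `H` behind these equations are as follows. The element `g` is group-like and `γ`
has the inverse `(S ⊗ id)γ = (id ⊗ S)γ`. Solving condition 1 for the coproduct gives `Δσ = (σ ⊗
1)γ(1 ⊗ σ)`. Comparing `Δ(σh)` with `Δ(Ad_σ(h)σ)` then shows that `R = (Ad_σ ⊗ S)γ` intertwines `Δ`
with its opposite, which is linearity of the braiding in degrees 00 (`comulAntipodeGamConjCommute`).
Since `Ad_σ²` is `S²` followed by conjugation with `g⁻¹`, the symmetry condition reads `s γ = (id ⊗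
Ad_σ²)γ`; applying it twice and using non-degeneracy gives `Ad_σ⁴ = id` (`conjFour`).

The associator in degrees 111 is the Fourier transform `F(h) = S(γ')λ(γ''h)`. It converts
multiplication by legs of `γ` into coproducts and back (`fourierGamRight`, `fourierComul`,
`fourierMulGam`). As `γ` turns the cointegral `λ` into integrals, there is an inversion formula
`F(gF(h)) = S⁻¹(h)` (`fourierGFourier`). These facts give the pentagons with at least three objects
of degree 1. The hexagons in degrees 111 are `F(σF(h)) = β² F(hσ⁻¹)σ⁻¹` (`fourierSFourier`) and
`F(σ⁻¹ωF(h)) = β⁻² F(hσ)σ` (`fourierSiFourier`). The second is the inverse of the first, rewritten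
by means of the effect of `Ad_σ` on `F`, which is where `ω` enters.

The equations are verified as equations of string diagrams. A diagram is a list of boxes with named
wires (a net), evaluated by the relation `Den`. Coherence for symmetric monoidal categories
(`Can.unique`) makes the value of a net unique (`Den.unique`) and independent of the order of
unrelated boxes (`Den.swap`). Hence a valid equation may be substituted inside any net
(`Den.replaceNet`), and a derivation is a list of rewriting steps evaluated by the kernel
(`Valid.prove`). The procedures that search for occurrences and renamings need no proof of
correctness, because their proposals are tested before use. `Valid.of_sem` and `Ex.sem_eq` translate
between morphisms and nets. -/

set_option linter.unusedSectionVars false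
set_option linter.unusedSimpArgs false

namespace HopfExt

/-! ### Symmetric coherence for tensor products of lists of objects -/

section Coherence

variable {S : Type u} [Category.{v} S] [MonoidalCategory S] [SymmetricCategory S]

/-- The exchange of the first two factors. -/
def headSwap (X Y Z : S) : X ⊗ (Y ⊗ Z) ⟶ Y ⊗ (X ⊗ Z) :=
  (α_ X Y Z).inv ≫ (β_ X Y).hom ▷ Z ≫ (α_ Y X Z).hom

theorem headSwap_headSwap (X Y Z : S) : headSwap X Y Z ≫ headSwap Y X Z = 𝟙 _ := by
  simp [headSwap, ← comp_whiskerRight_assoc]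

theorem headSwap_naturality_right (X Y : S) {Z Z' : S} (h : Z ⟶ Z') :
    X ◁ Y ◁ h ≫ headSwap X Y Z' = headSwap X Y Z ≫ Y ◁ X ◁ h := by
  simp only [headSwap, Category.assoc, associator_inv_naturality_right_assoc,
    ← associator_naturality_right]
  rw [whisker_exchange_assoc]

theorem headSwap_naturality_mid (X : S) {Y Y' : S} (h : Y ⟶ Y') (Z : S) :
    X ◁ h ▷ Z ≫ headSwap X Y' Z = headSwap X Y Z ≫ h ▷ (X ⊗ Z) := by
  simp only [headSwap, Category.assoc, associator_inv_naturality_middle_assoc,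
    ← comp_whiskerRight_assoc, BraidedCategory.braiding_naturality_right]
  simp

/-- The Yang–Baxter equation with a spectator `W`. It lets a third factor be moved to the front past
two factors that are being exchanged. -/
theorem headSwap_yangBaxter (X Y Z W : S) :
    X ◁ headSwap Y Z W ≫ headSwap X Z (Y ⊗ W) ≫ Z ◁ headSwap X Y W =
      headSwap X Y (Z ⊗ W) ≫ Y ◁ headSwap X Z W ≫ headSwap Y Z (X ⊗ W) := by
  simp only [headSwap]
  calc
    _ = 𝟙 (X ⊗ (Y ⊗ (Z ⊗ W))) ⊗≫ (𝟙 ((X ⊗ Y) ⊗ Z) ⊗≫ (X ◁ (β_ Y Z).hom ⊗≫ (β_ X Z).hom ▷ Y ⊗≫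
          Z ◁ (β_ X Y).hom) ⊗≫ 𝟙 ((Z ⊗ Y) ⊗ X)) ▷ W ⊗≫ 𝟙 (Z ⊗ (Y ⊗ (X ⊗ W))) := by monoidal
    _ = 𝟙 _ ⊗≫ ((β_ X Y).hom ▷ Z ⊗≫ Y ◁ (β_ X Z).hom ⊗≫ (β_ Y Z).hom ▷ X) ▷ W ⊗≫
          𝟙 (Z ⊗ (Y ⊗ (X ⊗ W))) := by
      rw [yang_baxter']
    _ = _ := by monoidal

variable {J : Type*} (ob : J → S)

/-- The right-nested tensor product of a list of objects. -/
@[reducible] def listTensor : List J → S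
  | [] => 𝟙_ S
  | w :: L => ob w ⊗ listTensor L

/-- The structural isomorphisms that permute the factors of a tensor product. -/
inductive Can : ∀ L L' : List J, (listTensor ob L ⟶ listTensor ob L') → Prop
  | nil : Can [] [] (𝟙 (𝟙_ S))
  | cons (w : J) {L L' : List J} {f : listTensor ob L ⟶ listTensor ob L'} (h : Can L L' f) :
      Can (w :: L) (w :: L') (ob w ◁ f)
  | swap (w w' : J) (L : List J) :
      Can (w :: w' :: L) (w' :: w :: L) (headSwap (ob w) (ob w') (listTensor ob L))
  | trans {L L' L'' : List J} {f : listTensor ob L ⟶ listTensor ob L'}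
      {g : listTensor ob L' ⟶ listTensor ob L''} (h : Can L L' f) (h' : Can L' L'' g) :
      Can L L'' (f ≫ g)

/-- `Ins a M L` says that `L` arises from `M` by the insertion of `a`. -/
inductive Ins (a : J) : List J → List J → Type _
  | here (L : List J) : Ins a L (a :: L)
  | there (b : J) {L L' : List J} (i : Ins a L L') : Ins a (b :: L) (b :: L')

variable {ob}

/-- The inserted factor is moved to the front. -/
def Ins.out {a : J} : ∀ {M L : List J}, Ins a M L → (listTensor ob L ⟶ ob a ⊗ listTensor ob M)
  | _, _, .here _ => 𝟙 _
  | _, _, .there b (L := M) i => ob b ◁ i.out ≫ headSwap (ob b) (ob a) (listTensor ob M)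

theorem Ins.mem {a : J} {M L : List J} (i : Ins a M L) : a ∈ L := by
  induction i <;> simp_all

/-- A name occurs at one place only in a list without repetitions. This is how distinctness of the
factors enters the coherence theorem. -/
theorem Ins.unique {a : J} {L : List J} (hL : L.Nodup) :
    ∀ {M M' : List J} (i : Ins a M L) (j : Ins a M' L), ∃ h : M = M', h ▸ i = j := by
  induction L with
  | nil => intro M M' i; cases i
  | cons b L ih =>
    intro M M' i j
    rw [List.nodup_cons] at hL
    cases i with
    | here => cases j with
      | here => exact ⟨rfl, rfl⟩
      | there _ j => exact absurd j.mem hL.1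
    | there _ i => cases j with
      | here => exact absurd i.mem hL.1
      | there _ j =>
        obtain ⟨rfl, rfl⟩ := ih hL.2 i j
        exact ⟨rfl, rfl⟩

namespace Can

theorem refl : ∀ L : List J, Can ob L L (𝟙 _)
  | [] => nil
  | w :: L => by simpa only [whiskerLeft_id] using cons w (refl L)

theorem perm {L L' : List J} {f : listTensor ob L ⟶ listTensor ob L'} (h : Can ob L L' f) :
    L.Perm L' := by
  induction h with
  | nil => exact .refl _
  | cons w _ ih => exact ih.cons w
  | swap => exact .swap _ _ _
  | trans _ _ ih ih' => exact ih.trans ih'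

theorem exists_of_perm {L L' : List J} (h : L.Perm L') : ∃ f, Can ob L L' f := by
  induction h with
  | nil => exact ⟨_, nil⟩
  | cons w _ ih => exact ⟨_, ih.choose_spec.cons w⟩
  | swap => exact ⟨_, swap _ _ _⟩
  | trans _ _ ih ih' => exact ⟨_, ih.choose_spec.trans ih'.choose_spec⟩

/-- The inductive core of coherence: bringing `a` to the front after a structural isomorphism
amounts to bringing it to the front before, followed by a structural isomorphism of the other
factors. For an exchange this is trivial if `a` ends up first, the symmetry `s² = id` if it ends up
second, and Yang–Baxter if it lies further back. -/
theorem pull {L L' : List J} {f : listTensor ob L ⟶ listTensor ob L'} (h : Can ob L L' f) :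
    ∀ {a : J} {M' : List J} (i : Ins a M' L'), ∃ (M : List J) (j : Ins a M L)
      (f' : listTensor ob M ⟶ listTensor ob M'),
      Can ob M M' f' ∧ f ≫ i.out = j.out ≫ ob a ◁ f' := by
  induction h with
  | nil => intro a M' i; cases i
  | @cons w L L' f h ih =>
    intro a M' i
    cases i with
    | here => exact ⟨_, .here _, f, h, by simp [Ins.out]⟩
    | there _ i =>
      obtain ⟨M, j, f', hf, e⟩ := ih i
      refine ⟨_, .there w j, _, hf.cons w, ?_⟩
      rw [Ins.out, Ins.out, ← whiskerLeft_comp_assoc, e, whiskerLeft_comp_assoc, Category.assoc,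
        headSwap_naturality_right]
  | swap w w' L =>
    intro a M' i
    cases i with
    | here =>
      exact ⟨_, .there w (.here L), 𝟙 _, refl _, by simp [Ins.out, listTensor]⟩
    | there _ i =>
      cases i with
      | here =>
        exact ⟨_, .here _, 𝟙 _, refl _, by simp [Ins.out, headSwap_headSwap, listTensor]⟩
      | there _ i =>
        refine ⟨_, .there w (.there w' i), _, swap w w' _, ?_⟩
        have := headSwap_yangBaxter (ob w) (ob w') (ob a) (listTensor ob ‹List J›)
        simp only [Ins.out, whiskerLeft_comp, Category.assoc, listTensor] at this ⊢
        rw [this, reassoc_of% headSwap_naturality_right]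
  | trans _ _ ih ih' =>
    intro a M' i
    obtain ⟨M, j, f', hf, e⟩ := ih' i
    obtain ⟨M₁, j₁, f₁, hf₁, e₁⟩ := ih j
    exact ⟨_, j₁, _, hf₁.trans hf, by rw [Category.assoc, e, reassoc_of% e₁, whiskerLeft_comp]⟩

theorem eq_eqToHom {L L' : List J} {f : listTensor ob L ⟶ listTensor ob L'} (h : Can ob L L' f)
    (e' : L' = []) : ∃ e : L = L', f = eqToHom (by rw [e]) := by
  induction h with
  | nil => exact ⟨rfl, rfl⟩
  | cons => cases e'
  | swap => cases e'
  | trans _ _ ih ih' =>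
    obtain ⟨rfl, rfl⟩ := ih' e'
    obtain ⟨rfl, rfl⟩ := ih e'
    exact ⟨rfl, by simp⟩

/-- Coherence: there is only one structural isomorphism between two arrangements of distinct
factors. -/
theorem unique {L L' : List J} {f g : listTensor ob L ⟶ listTensor ob L'} (hf : Can ob L L' f)
    (hg : Can ob L L' g) (hL : L.Nodup) : f = g := by
  induction L' generalizing L with
  | nil =>
    obtain ⟨rfl, rfl⟩ := hf.eq_eqToHom rfl
    exact (hg.eq_eqToHom rfl).choose_spec.symm
  | cons a L' ih =>
    -- The first output factor is traced back through both isomorphisms. It starts from the same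
    -- place in both, so the claim reduces to the remaining factors.
    obtain ⟨M, i, f', hf', ef⟩ := hf.pull (.here L')
    obtain ⟨M₁, j, g', hg', eg⟩ := hg.pull (.here L')
    obtain ⟨rfl, rfl⟩ := i.unique hL j
    have hM : M.Nodup := by
      have := hf'.perm
      have h2 := (hf.perm.nodup_iff.1 hL).of_cons
      exact this.nodup_iff.2 h2
    obtain rfl := ih hf' hg' hM
    simpa [Ins.out] using ef.trans eg.symm

end Can

/-! ### Concatenation of lists -/

variable (ob)

/-- The tensor product of a concatenation. -/
def appendIso : ∀ L R : List J,
    listTensor ob (L ++ R) ≅ listTensor ob L ⊗ listTensor ob R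
  | [], R => (λ_ (listTensor ob R)).symm
  | w :: L, R => whiskerLeftIso (ob w) (appendIso L R) ≪≫
      (α_ (ob w) (listTensor ob L) (listTensor ob R)).symm

variable {ob}

/-- The morphism `f ⊗ id` on concatenations. -/
def frame {L L' : List J} (f : listTensor ob L ⟶ listTensor ob L') (R : List J) :
    listTensor ob (L ++ R) ⟶ listTensor ob (L' ++ R) :=
  (appendIso ob L R).hom ≫ f ▷ listTensor ob R ≫ (appendIso ob L' R).inv

/-- The morphism `id ⊗ f` on concatenations. -/
def coframe (A : List J) {L L' : List J} (f : listTensor ob L ⟶ listTensor ob L') :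
    listTensor ob (A ++ L) ⟶ listTensor ob (A ++ L') :=
  (appendIso ob A L).hom ≫ listTensor ob A ◁ f ≫ (appendIso ob A L').inv

theorem frame_id (L R : List J) : frame (𝟙 (listTensor ob L)) R = 𝟙 _ := by simp [frame]

theorem frame_comp {L L' L'' : List J} (f : listTensor ob L ⟶ listTensor ob L')
    (g : listTensor ob L' ⟶ listTensor ob L'') (R : List J) :
    frame (f ≫ g) R = frame f R ≫ frame g R := by simp [frame]

theorem frame_coframe {A A' L L' : List J} (f : listTensor ob A ⟶ listTensor ob A')
    (g : listTensor ob L ⟶ listTensor ob L') :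
    frame f L ≫ coframe A' g = coframe A g ≫ frame f L' := by
  simp [frame, coframe, whisker_exchange_assoc]

/-- Reassociation of concatenations. -/
def assocHom (ob : J → S) (A B Q : List J) :
    listTensor ob ((A ++ B) ++ Q) ⟶ listTensor ob (A ++ (B ++ Q)) :=
  (appendIso ob (A ++ B) Q).hom ≫ (appendIso ob A B).hom ▷ _ ≫ (α_ _ _ _).hom ≫
    _ ◁ (appendIso ob B Q).inv ≫ (appendIso ob A (B ++ Q)).inv

/-- The inverse of `assocHom`. -/
def assocInv (ob : J → S) (A B Q : List J) :
    listTensor ob (A ++ (B ++ Q)) ⟶ listTensor ob ((A ++ B) ++ Q) :=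
  (appendIso ob A (B ++ Q)).hom ≫ _ ◁ (appendIso ob B Q).hom ≫ (α_ _ _ _).inv ≫
    (appendIso ob A B).inv ▷ _ ≫ (appendIso ob (A ++ B) Q).inv

theorem assocHom_assocInv (A B Q : List J) : assocHom ob A B Q ≫ assocInv ob A B Q = 𝟙 _ := by
  simp [assocHom, assocInv]

/-- Exchange of two blocks in front of a list. -/
def blockSwap (ob : J → S) (A B Q : List J) :
    listTensor ob (A ++ (B ++ Q)) ⟶ listTensor ob (B ++ (A ++ Q)) :=
  (appendIso ob A (B ++ Q)).hom ≫ _ ◁ (appendIso ob B Q).hom ≫ headSwap _ _ _ ≫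
    _ ◁ (appendIso ob A Q).inv ≫ (appendIso ob B (A ++ Q)).inv

theorem coframe_frame_blockSwap (A : List J) {B B' : List J}
    (f : listTensor ob B ⟶ listTensor ob B') (Q : List J) :
    coframe A (frame f Q) ≫ blockSwap ob A B' Q = blockSwap ob A B Q ≫ frame f (A ++ Q) := by
  simp only [coframe, frame, blockSwap, whiskerLeft_comp, Category.assoc, Iso.inv_hom_id_assoc,
    whiskerLeft_inv_hom_assoc, reassoc_of% headSwap_naturality_mid, whisker_exchange_assoc]

theorem blockSwap_blockSwap (A B Q : List J) :
    blockSwap ob A B Q ≫ blockSwap ob B A Q = 𝟙 _ := by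
  simp only [blockSwap, Category.assoc, Iso.inv_hom_id_assoc, whiskerLeft_inv_hom_assoc,
    reassoc_of% headSwap_headSwap]
  simp

namespace Can

theorem of_eq {L L' : List J} {f g : listTensor ob L ⟶ listTensor ob L'} (h : Can ob L L' f)
    (e : g = f) : Can ob L L' g := e ▸ h

theorem coframe {L L' : List J} {f : listTensor ob L ⟶ listTensor ob L'} (h : Can ob L L' f) :
    ∀ A : List J, Can ob (A ++ L) (A ++ L') (coframe A f)
  | [] => h.of_eq (by
      change (λ_ _).inv ≫ 𝟙_ S ◁ f ≫ (λ_ _).hom = f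
      simp)
  | w :: A => ((h.coframe A).cons w).of_eq (by
      change (ob w ◁ (appendIso ob A L).hom ≫ (α_ _ _ _).inv) ≫ (ob w ⊗ listTensor ob A) ◁ f ≫
        (α_ _ _ _).hom ≫ ob w ◁ (appendIso ob A L').inv = ob w ◁ HopfExt.coframe A f
      simp [HopfExt.coframe])

theorem frame {L L' : List J} {f : listTensor ob L ⟶ listTensor ob L'} (h : Can ob L L' f)
    (R : List J) : Can ob (L ++ R) (L' ++ R) (frame f R) := by
  induction h with
  | nil => exact (refl R).of_eq (frame_id [] R)
  | @cons w L L' f h ih =>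
    refine (ih.cons w).of_eq ?_
    change (ob w ◁ (appendIso ob L R).hom ≫ (α_ _ _ _).inv) ≫ (ob w ◁ f) ▷ listTensor ob R ≫
        (α_ _ _ _).hom ≫ ob w ◁ (appendIso ob L' R).inv = ob w ◁ HopfExt.frame f R
    simp [HopfExt.frame]
  | swap w w' L =>
    refine (swap w w' (L ++ R)).of_eq ?_
    change (ob w ◁ (ob w' ◁ (appendIso ob L R).hom ≫ (α_ _ _ _).inv) ≫ (α_ _ _ _).inv) ≫
      headSwap (ob w) (ob w') (listTensor ob L) ▷ listTensor ob R ≫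
        (α_ _ _ _).hom ≫ ob w' ◁ ((α_ _ _ _).hom ≫ ob w ◁ (appendIso ob L R).inv) =
      headSwap (ob w) (ob w') (listTensor ob (L ++ R))
    generalize appendIso ob L R = e
    simp only [headSwap]
    calc
      _ = 𝟙 (ob w ⊗ ob w' ⊗ listTensor ob (L ++ R)) ⊗≫ ((ob w ⊗ ob w') ◁ e.hom ≫
            (β_ (ob w) (ob w')).hom ▷ (listTensor ob L ⊗ listTensor ob R) ≫
              (ob w' ⊗ ob w) ◁ e.inv) ⊗≫ 𝟙 (ob w' ⊗ ob w ⊗ listTensor ob (L ++ R)) := by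
        monoidal
      _ = _ := by
        rw [← whisker_exchange, whiskerLeft_hom_inv_assoc]
        monoidal
  | trans _ _ ih ih' => rw [frame_comp]; exact ih.trans ih'

theorem assocHom : ∀ A B Q : List J,
    Can ob ((A ++ B) ++ Q) (A ++ (B ++ Q)) (assocHom ob A B Q)
  | [], B, Q => (refl (B ++ Q)).of_eq (by
      change (appendIso ob B Q).hom ≫ (λ_ _).inv ▷ _ ≫ (α_ _ _ _).hom ≫
        𝟙_ S ◁ (appendIso ob B Q).inv ≫ (λ_ _).hom = _
      simp)
  | w :: A, B, Q => ((assocHom A B Q).cons w).of_eq (by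
      change (ob w ◁ (appendIso ob (A ++ B) Q).hom ≫ (α_ _ _ _).inv) ≫
        (ob w ◁ (appendIso ob A B).hom ≫ (α_ _ _ _).inv) ▷ _ ≫ (α_ _ _ _).hom ≫
        (ob w ⊗ listTensor ob A) ◁ (appendIso ob B Q).inv ≫ (α_ _ _ _).hom ≫
        ob w ◁ (appendIso ob A (B ++ Q)).inv = ob w ◁ HopfExt.assocHom ob A B Q
      simp [HopfExt.assocHom])

theorem blockSwap_single (w : J) : ∀ B Q : List J,
    Can ob (w :: (B ++ Q)) (B ++ w :: Q)
      (ob w ◁ (appendIso ob B Q).hom ≫ headSwap _ _ _ ≫ (appendIso ob B (w :: Q)).inv)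
  | [], Q => (refl (w :: Q)).of_eq (by
      change ob w ◁ (λ_ _).inv ≫ headSwap (ob w) (𝟙_ S) (listTensor ob Q) ≫ (λ_ _).hom = _
      simp [headSwap])
  | b :: B, Q => ((swap w b (B ++ Q)).trans ((blockSwap_single w B Q).cons b)).of_eq (by
      change ob w ◁ (ob b ◁ (appendIso ob B Q).hom ≫ (α_ _ _ _).inv) ≫
        headSwap (ob w) (ob b ⊗ listTensor ob B) (listTensor ob Q) ≫
        (α_ _ _ _).hom ≫ ob b ◁ (appendIso ob B (w :: Q)).inv =
        headSwap (ob w) (ob b) (listTensor ob (B ++ Q)) ≫ ob b ◁ (ob w ◁ (appendIso ob B Q).hom ≫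
          headSwap (ob w) (listTensor ob B) (listTensor ob Q) ≫ (appendIso ob B (w :: Q)).inv)
      rw [whiskerLeft_comp (ob b), ← reassoc_of% headSwap_naturality_right]
      simp only [whiskerLeft_comp, Category.assoc]
      congr 1
      simp only [headSwap, braiding_tensor_right_hom]
      monoidal)

/-- By the two hexagon identities, a block passes another one factor by factor: those of `A` one at
a time, each across the factors of `B` one at a time. -/
theorem blockSwap : ∀ A B Q : List J,
    Can ob (A ++ (B ++ Q)) (B ++ (A ++ Q)) (blockSwap ob A B Q)
  | [], B, Q => (refl (B ++ Q)).of_eq (by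
      change (λ_ _).inv ≫ 𝟙_ S ◁ (appendIso ob B Q).hom ≫ headSwap _ _ _ ≫
        _ ◁ (λ_ _).hom ≫ (appendIso ob B Q).inv = _
      simp [headSwap])
  | w :: A, B, Q => (((blockSwap A B Q).cons w).trans (blockSwap_single w B (A ++ Q))).of_eq (by
      change (ob w ◁ (appendIso ob A (B ++ Q)).hom ≫ (α_ _ _ _).inv) ≫
        (ob w ⊗ listTensor ob A) ◁ (appendIso ob B Q).hom ≫
        headSwap (ob w ⊗ listTensor ob A) (listTensor ob B) (listTensor ob Q) ≫
        listTensor ob B ◁ ((α_ _ _ _).hom ≫ ob w ◁ (appendIso ob A Q).inv) ≫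
        (appendIso ob B (w :: (A ++ Q))).inv = _
      simp only [HopfExt.blockSwap, whiskerLeft_comp, Category.assoc,
        whiskerLeft_inv_hom_assoc]
      rw [reassoc_of% headSwap_naturality_right]
      simp only [headSwap, braiding_tensor_left_hom]
      monoidal)

theorem exists_inv {L L' : List J} {f : listTensor ob L ⟶ listTensor ob L'} (h : Can ob L L' f) :
    ∃ g, Can ob L' L g ∧ f ≫ g = 𝟙 _ ∧ g ≫ f = 𝟙 _ := by
  induction h with
  | nil => exact ⟨_, nil, by simp, by simp⟩
  | cons w _ ih =>
    obtain ⟨g, h, e, e'⟩ := ih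
    exact ⟨_, h.cons w, by rw [← whiskerLeft_comp, e, whiskerLeft_id],
      by rw [← whiskerLeft_comp, e', whiskerLeft_id]⟩
  | swap w w' L => exact ⟨_, swap w' w L, headSwap_headSwap _ _ _, headSwap_headSwap _ _ _⟩
  | trans _ _ ih ih' =>
    obtain ⟨g, h, e, e'⟩ := ih
    obtain ⟨k, h', i, i'⟩ := ih'
    exact ⟨_, h'.trans h, by simp [reassoc_of% i, e], by simp [reassoc_of% e', i']⟩

theorem assocInv (A B Q : List J) :
    Can ob (A ++ (B ++ Q)) ((A ++ B) ++ Q) (assocInv ob A B Q) := by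
  -- A structural inverse of `assocHom` exists by `exists_inv`, and it must coincide with
  -- `assocInv`.
  obtain ⟨k, hk, -, e⟩ := (assocHom (ob := ob) A B Q).exists_inv
  refine hk.of_eq ?_
  rw [← Category.id_comp (HopfExt.assocInv ob A B Q), ← e, Category.assoc, assocHom_assocInv,
    Category.comp_id]

end Can

end Coherence
end HopfExt

namespace HopfExt

/-! ### Morphisms that agree up to equality of objects -/

section Same

variable {S : Type u} [Category.{v} S] [MonoidalCategory S] [SymmetricCategory S]

/-- Equality of morphisms up to equality of their sources and targets. -/
def Same {X Y X' Y' : S} (f : X ⟶ Y) (f' : X' ⟶ Y') : Prop :=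
  ∃ (hX : X = X') (hY : Y = Y'), f = eqToHom hX ≫ f' ≫ eqToHom hY.symm

namespace Same

theorem rfl' {X Y : S} (f : X ⟶ Y) : Same f f := ⟨rfl, rfl, by simp⟩

theorem of_eq {X Y : S} {f g : X ⟶ Y} (h : f = g) : Same f g := h ▸ rfl' f

theorem eq {X Y : S} {f g : X ⟶ Y} (h : Same f g) : f = g := by
  obtain ⟨_, _, rfl⟩ := h
  simp

theorem symm {X Y X' Y' : S} {f : X ⟶ Y} {f' : X' ⟶ Y'} (h : Same f f') : Same f' f := by
  obtain ⟨rfl, rfl, rfl⟩ := h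
  exact of_eq (by simp)

theorem trans {X Y X' Y' X'' Y'' : S} {f : X ⟶ Y} {f' : X' ⟶ Y'} {f'' : X'' ⟶ Y''}
    (h : Same f f') (h' : Same f' f'') : Same f f'' := by
  obtain ⟨rfl, rfl, rfl⟩ := h
  obtain ⟨rfl, rfl, rfl⟩ := h'
  exact of_eq (by simp)

theorem comp {X Y Z X' Y' Z' : S} {f : X ⟶ Y} {f' : X' ⟶ Y'} {g : Y ⟶ Z} {g' : Y' ⟶ Z'}
    (h : Same f f') (k : Same g g') : Same (f ≫ g) (f' ≫ g') := by
  obtain ⟨rfl, rfl, rfl⟩ := h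
  obtain ⟨_, rfl, rfl⟩ := k
  exact of_eq (by simp)

theorem whiskerLeft (W : S) {X Y X' Y' : S} {f : X ⟶ Y} {f' : X' ⟶ Y'} (h : Same f f') :
    Same (W ◁ f) (W ◁ f') := by
  obtain ⟨rfl, rfl, rfl⟩ := h
  exact of_eq (by simp)

theorem whiskerRight {X Y X' Y' W W' : S} {f : X ⟶ Y} {f' : X' ⟶ Y'} (h : Same f f')
    (hW : W = W') : Same (f ▷ W) (f' ▷ W') := by
  obtain ⟨rfl, rfl, rfl⟩ := h
  subst hW
  exact of_eq (by simp)

theorem headSwap_same (X Y : S) {Z Z' : S} (h : Z = Z') :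
    Same (headSwap X Y Z) (headSwap X Y Z') := by
  subst h; exact .rfl' _

end Same

variable {J J' : Type*} (ob : J → S) (r : J' → J)

theorem listTensor_map (L : List J') : listTensor ob (L.map r) = listTensor (ob ∘ r) L := by
  induction L with
  | nil => rfl
  | cons w L ih => simp only [List.map_cons, listTensor, ih, Function.comp]

theorem appendIso_same : ∀ A R : List J',
    Same (appendIso ob (A.map r) (R.map r)).hom (appendIso (ob ∘ r) A R).hom ∧
    Same (appendIso ob (A.map r) (R.map r)).inv (appendIso (ob ∘ r) A R).inv
  | [], R => by
    change Same (λ_ (listTensor ob (R.map r))).inv (λ_ (listTensor (ob ∘ r) R)).inv ∧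
      Same (λ_ (listTensor ob (R.map r))).hom (λ_ (listTensor (ob ∘ r) R)).hom
    rw [listTensor_map]
    exact ⟨.rfl' _, .rfl' _⟩
  | w :: A, R => by
    obtain ⟨h, h'⟩ := appendIso_same A R
    change Same (ob (r w) ◁ (appendIso ob (A.map r) (R.map r)).hom ≫ (α_ _ _ _).inv)
        (ob (r w) ◁ (appendIso (ob ∘ r) A R).hom ≫ (α_ _ _ _).inv) ∧
      Same ((α_ _ _ _).hom ≫ ob (r w) ◁ (appendIso ob (A.map r) (R.map r)).inv)
        ((α_ _ _ _).hom ≫ ob (r w) ◁ (appendIso (ob ∘ r) A R).inv)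
    refine ⟨(h.whiskerLeft _).comp ?_, .comp ?_ (h'.whiskerLeft _)⟩
    · rw [listTensor_map, listTensor_map]; exact .rfl' _
    · rw [listTensor_map, listTensor_map]; exact .rfl' _

variable {ob}

theorem frame_same {A A' : List J} {B B' : List J'} (hA : A = B.map r) (hA' : A' = B'.map r)
    {f : listTensor ob A ⟶ listTensor ob A'}
    {f' : listTensor (ob ∘ r) B ⟶ listTensor (ob ∘ r) B'} (h : Same f f') (R : List J') :
    Same (frame f (R.map r)) (frame f' R) := by
  subst hA hA'
  exact (appendIso_same ob r _ _).1.comp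
    ((h.whiskerRight (listTensor_map ob r R)).comp (appendIso_same ob r _ _).2)

/-- The tensor product over a renamed list equals the original one only propositionally, whence the
formulation through `Same`. -/
theorem Can.map {L L' : List J'} {f : listTensor (ob ∘ r) L ⟶ listTensor (ob ∘ r) L'}
    (h : Can (ob ∘ r) L L' f) :
    ∃ f', Can ob (L.map r) (L'.map r) f' ∧ Same f' f := by
  induction h with
  | nil => exact ⟨_, .nil, .rfl' _⟩
  | cons w _ ih =>
    obtain ⟨f', h, e⟩ := ih
    exact ⟨_, h.cons (r w), e.whiskerLeft _⟩
  | swap w w' L =>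
    refine ⟨_, .swap (r w) (r w') (L.map r), ?_⟩
    exact Same.headSwap_same _ _ (listTensor_map ob r L)
  | trans _ _ ih ih' =>
    obtain ⟨f', h, e⟩ := ih
    obtain ⟨g', h', e'⟩ := ih'
    exact ⟨_, h.trans h', e.comp e'⟩

end Same

/-! ### Boxes and nets -/

/-- Names of wires: `h n` carries the Hopf algebra, `x n` carries a module. -/
inductive Wire
  | h (n : ℕ)
  | x (n : ℕ)

/-- Boolean equality, in a form that evaluates quickly. -/
def Wire.beq : Wire → Wire → Bool
  | .h a, .h a' => Nat.beq a a'
  | .x a, .x a' => Nat.beq a a'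
  | _, _ => false

theorem Wire.beq_iff (a b : Wire) : a.beq b = true ↔ a = b := by
  cases a <;> cases b <;> simp [Wire.beq, and_assoc]

instance : DecidableEq Wire := fun a b => decidable_of_bool (a.beq b) (Wire.beq_iff a b)

/-- Names of points of the Hopf algebra. -/
inductive Pt
  | one | g | gi | s | si

/-- Boolean equality, in a form that evaluates quickly. -/
def Pt.beq : Pt → Pt → Bool
  | .one, .one => true
  | .g, .g => true
  | .gi, .gi => true
  | .s, .s => true
  | .si, .si => true
  | _, _ => false

theorem Pt.beq_iff (a b : Pt) : a.beq b = true ↔ a = b := by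
  cases a <;> cases b <;> simp [Pt.beq, and_assoc]

/-- Names of covectors of the Hopf algebra. -/
inductive Cov
  | eps | lam

/-- Boolean equality, in a form that evaluates quickly. -/
def Cov.beq : Cov → Cov → Bool
  | .eps, .eps => true
  | .lam, .lam => true
  | _, _ => false

theorem Cov.beq_iff (a b : Cov) : a.beq b = true ↔ a = b := by
  cases a <;> cases b <;> simp [Cov.beq, and_assoc]

/-- Names of endomorphisms of the Hopf algebra. -/
inductive En
  | id | S | Si | om | f | fi | F

/-- Boolean equality, in a form that evaluates quickly. -/
def En.beq : En → En → Bool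
  | .id, .id => true
  | .S, .S => true
  | .Si, .Si => true
  | .om, .om => true
  | .f, .f => true
  | .fi, .fi => true
  | .F, .F => true
  | _, _ => false

theorem En.beq_iff (a b : En) : a.beq b = true ↔ a = b := by
  cases a <;> cases b <;> simp [En.beq, and_assoc]

/-- Boxes of a string diagram, with the names of the wires attached to them. -/
inductive Box
  | mul (a b c : ℕ)
  | comul (a b c : ℕ)
  | pt (p : Pt) (a : ℕ)
  | cov (p : Cov) (a : ℕ)
  | en (p : En) (a b : ℕ)
  | gam (a b : ℕ)
  | ev (a b : ℕ)
  | sc (p : Bool)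
  | act (a i : ℕ)
  | omx (i : ℕ)

/-- Boolean equality, in a form that evaluates quickly. -/
def Box.beq : Box → Box → Bool
  | .mul a b c, .mul a' b' c' => Nat.beq a a' && Nat.beq b b' && Nat.beq c c'
  | .comul a b c, .comul a' b' c' => Nat.beq a a' && Nat.beq b b' && Nat.beq c c'
  | .pt p a, .pt p' a' => Pt.beq p p' && Nat.beq a a'
  | .cov p a, .cov p' a' => Cov.beq p p' && Nat.beq a a'
  | .en p a b, .en p' a' b' => En.beq p p' && Nat.beq a a' && Nat.beq b b'
  | .gam a b, .gam a' b' => Nat.beq a a' && Nat.beq b b'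
  | .ev a b, .ev a' b' => Nat.beq a a' && Nat.beq b b'
  | .sc p, .sc p' => p == p'
  | .act a i, .act a' i' => Nat.beq a a' && Nat.beq i i'
  | .omx i, .omx i' => Nat.beq i i'
  | _, _ => false

theorem Box.beq_iff (a b : Box) : a.beq b = true ↔ a = b := by
  cases a <;> cases b <;> simp [Box.beq, Pt.beq_iff, Cov.beq_iff, En.beq_iff, and_assoc]

instance : DecidableEq Box := fun a b => decidable_of_bool (a.beq b) (Box.beq_iff a b)

/-- Bracketings of wires. -/
inductive Tree
  | one
  | w (a : Wire)
  | t (l r : Tree)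

/-- The wires of a bracketing. -/
def Tree.flat : Tree → List Wire
  | .one => []
  | .w a => [a]
  | .t l r => l.flat ++ r.flat

/-- An `H`-wire as a bracketing. -/
abbrev Tree.h (n : ℕ) : Tree := .w (.h n)

/-- A module wire as a bracketing. -/
abbrev Tree.x (n : ℕ) : Tree := .w (.x n)

/-- The input wires of a box. -/
@[reducible] def Box.dom : Box → Tree
  | mul a b _ => .t (.h a) (.h b)
  | comul a _ _ => .h a
  | pt _ _ => .one
  | cov _ a => .h a
  | en _ a _ => .h a
  | gam _ _ => .one
  | ev a b => .t (.h a) (.h b)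
  | sc _ => .one
  | act a i => .t (.h a) (.x i)
  | omx i => .x i

/-- The output wires of a box. -/
@[reducible] def Box.cod : Box → Tree
  | mul _ _ c => .h c
  | comul _ b c => .t (.h b) (.h c)
  | pt _ a => .h a
  | cov _ _ => .one
  | en _ _ b => .h b
  | gam a b => .t (.h a) (.h b)
  | ev _ _ => .one
  | sc _ => .one
  | act _ i => .x i
  | omx i => .x i

/-- The list of input wires of a box. -/
def Box.ins (b : Box) : List Wire := b.dom.flat

/-- The list of output wires of a box. -/
def Box.outs (b : Box) : List Wire := b.cod.flat

/-- Renaming of a wire. -/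
def Wire.map (p q : ℕ → ℕ) : Wire → Wire
  | h n => h (p n)
  | x n => x (q n)

/-- Renaming of the wires of a box. -/
def Box.map (p q : ℕ → ℕ) : Box → Box
  | mul a b c => mul (p a) (p b) (p c)
  | comul a b c => comul (p a) (p b) (p c)
  | pt k a => pt k (p a)
  | cov k a => cov k (p a)
  | en k a b => en k (p a) (p b)
  | gam a b => gam (p a) (p b)
  | ev a b => ev (p a) (p b)
  | sc k => sc k
  | act a i => act (p a) (q i)
  | omx i => omx (q i)

theorem Box.ins_map (p q : ℕ → ℕ) (b : Box) : (b.map p q).ins = b.ins.map (Wire.map p q) := by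
  cases b <;> rfl

theorem Box.outs_map (p q : ℕ → ℕ) (b : Box) : (b.map p q).outs = b.outs.map (Wire.map p q) := by
  cases b <;> rfl

/-- All wires of a net. -/
def wires : List Box → List Wire
  | [] => []
  | b :: N => b.ins ++ (b.outs ++ wires N)

/-! ### The denotation of a net -/

section Den

variable {S : Type u} [Category.{v} S] [MonoidalCategory S] [SymmetricCategory S]

/-- The data by which the boxes are interpreted. -/
structure Data (H : S) [HopfObj H] where
  gam : 𝟙_ S ⟶ H ⊗ H
  ev : H ⊗ H ⟶ 𝟙_ S
  lam : H ⟶ 𝟙_ S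
  g : 𝟙_ S ⟶ H
  gi : 𝟙_ S ⟶ H
  s : 𝟙_ S ⟶ H
  si : 𝟙_ S ⟶ H
  Si : H ⟶ H
  bet : 𝟙_ S ⟶ 𝟙_ S
  beti : 𝟙_ S ⟶ 𝟙_ S
  om : 𝟭 S ⟶ 𝟭 S

variable {H : S} [HopfObj H] (D : Data H) (E : ℕ → Mod S H)

/-- Interpretation of points. -/
def Data.pt : Pt → (𝟙_ S ⟶ H)
  | .one => η[H]
  | .g => D.g
  | .gi => D.gi
  | .s => D.s
  | .si => D.si

/-- Interpretation of covectors. -/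
def Data.cov : Cov → (H ⟶ 𝟙_ S)
  | .eps => ε[H]
  | .lam => D.lam

/-- Interpretation of endomorphisms. -/
def Data.en : En → (H ⟶ H)
  | .id => 𝟙 H
  | .S => 𝒮[H]
  | .Si => D.Si
  | .om => D.om.app H
  | .f => conjPt D.s D.si
  | .fi => conjPt D.si D.s
  | .F => fourier D.gam D.lam

/-- Interpretation of scalars. -/
def Data.sc : Bool → (𝟙_ S ⟶ 𝟙_ S)
  | true => D.bet
  | false => D.beti

/-- The object on a wire. -/
@[reducible] def wob : Wire → S
  | .h _ => H
  | .x i => (E i).X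

/-- The object of a bracketing. -/
@[reducible] def Tree.obj : Tree → S
  | .one => 𝟙_ S
  | .w a => wob E a
  | .t l r => l.obj ⊗ r.obj

/-- Interpretation of boxes. -/
def Box.sem : ∀ b : Box, b.dom.obj E ⟶ b.cod.obj E
  | mul _ _ _ => μ[H]
  | comul _ _ _ => Δ[H]
  | pt k _ => D.pt k
  | cov k _ => D.cov k
  | en k _ _ => D.en k
  | gam _ _ => D.gam
  | ev _ _ => D.ev
  | sc k => D.sc k
  | act _ i => HopfExt.act (E i)
  | omx i => D.om.app (E i).X

/-- Removal of the brackets. -/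
def Tree.flatIso : ∀ t : Tree, t.obj E ≅ listTensor (wob E) t.flat
  | .one => Iso.refl _
  | .w a => (ρ_ (wob E a)).symm
  | .t l r => (l.flatIso ⊗ᵢ r.flatIso) ≪≫ (appendIso (wob E) l.flat r.flat).symm

/-- Interpretation of boxes, between tensor products of lists. -/
def Box.mor (b : Box) : listTensor (wob E) b.ins ⟶ listTensor (wob E) b.outs :=
  (b.dom.flatIso E).inv ≫ b.sem D E ≫ (b.cod.flatIso E).hom

/-- `Den D E N L L' m` says that the net `N`, applied to the wires `L`, has the output wires `L'`
and denotes the morphism `m`. -/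
inductive Den (L' : List Wire) : List Box → ∀ L : List Wire,
    (listTensor (wob E) L ⟶ listTensor (wob E) L') → Prop
  | nil {L : List Wire} (hL : L.Nodup) {p} (h : Can (wob E) L L' p) : Den L' [] L p
  | cons (b : Box) {N : List Box} {L : List Wire} (R : List Wire) (hL : L.Nodup) {p}
      (h : Can (wob E) L (b.ins ++ R) p) {m} (h' : Den L' N (b.outs ++ R) m) :
      Den L' (b :: N) L (p ≫ frame (b.mor D E) R ≫ m)

variable {D E}

namespace Den

theorem nodup {N : List Box} {L L' : List Wire} {m} (h : Den D E L' N L m) : L.Nodup := by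
  cases h <;> assumption

theorem nodup_out {N : List Box} {L L' : List Wire} {m} (h : Den D E L' N L m) : L'.Nodup := by
  induction h with
  | nil hL h => exact h.perm.nodup_iff.1 hL
  | cons _ _ _ _ _ ih => exact ih

theorem of_eq {N : List Box} {L L' : List Wire} {m m'} (h : Den D E L' N L m) (e : m' = m) :
    Den D E L' N L m' := e ▸ h

theorem pre {N : List Box} {L₁ L L' : List Wire} {p m} (h : Den D E L' N L m)
    (hp : Can (wob E) L₁ L p) : Den D E L' N L₁ (p ≫ m) := by
  have hL := hp.perm.nodup_iff.2 h.nodup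
  cases h with
  | nil _ h => exact .nil hL (hp.trans h)
  | cons b R _ h h' =>
    rw [← Category.assoc]
    exact .cons b R hL (hp.trans h) h'

theorem post {N : List Box} {L L' L₁ : List Wire} {p m} (h : Den D E L' N L m)
    (hp : Can (wob E) L' L₁ p) : Den D E L₁ N L (m ≫ p) := by
  induction h with
  | nil hL h => exact .nil hL (h.trans hp)
  | cons b R hL h _ ih =>
    rw [Category.assoc, Category.assoc]
    exact .cons b R hL h ih

theorem append {N N' : List Box} {L M L' : List Wire} {m m'} (h : Den D E M N L m)
    (h' : Den D E L' N' M m') : Den D E L' (N ++ N') L (m ≫ m') := by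
  induction h with
  | nil _ h => exact h'.pre h
  | cons b R hL h _ ih =>
    rw [Category.assoc, Category.assoc]
    exact .cons b R hL h ih

theorem split {N N' : List Box} {L L' : List Wire} {m} (h : Den D E L' (N ++ N') L m) :
    ∃ M m₁ m₂, Den D E M N L m₁ ∧ Den D E L' N' M m₂ ∧ m = m₁ ≫ m₂ := by
  induction N generalizing L with
  | nil => exact ⟨L, 𝟙 _, m, .nil h.nodup (.refl L), h, by simp⟩
  | cons b N ih =>
    cases h with
    | cons _ R hL hc h' =>
      obtain ⟨M, m₁, m₂, h₁, h₂, rfl⟩ := ih h'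
      exact ⟨M, _, m₂, .cons b R hL hc h₁, h₂, by simp⟩

/-- The output of a net is determined up to the arrangement of the wires. -/
theorem det {N : List Box} {L M M' : List Wire} {m m'} (h : Den D E M N L m)
    (h' : Den D E M' N L m') : ∃ c, Can (wob E) M M' c ∧ m ≫ c = m' := by
  induction N generalizing L with
  | nil =>
    cases h with
    | nil hL h => cases h' with
      | nil _ h' =>
        obtain ⟨c, hc⟩ := Can.exists_of_perm (ob := wob E) (h.perm.symm.trans h'.perm)
        exact ⟨c, hc, (h.trans hc).unique h' hL⟩
  | cons b N ih =>
    cases h with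
    | cons _ R hL h k => cases h' with
      | @cons _ _ _ R' hL' p' h' m₂ k' =>
        -- The wires left over by the first box agree in both evaluations up to order. The
        -- rearrangement `r` slides past the box and is absorbed into the remaining net.
        obtain ⟨r, hr⟩ := Can.exists_of_perm (ob := wob E)
          ((List.perm_append_left_iff b.ins).1 (h.perm.symm.trans h'.perm))
        have e := (h.trans (hr.coframe b.ins)).unique h' hL
        obtain ⟨c, hc, e'⟩ := ih k (k'.pre (hr.coframe b.outs))
        refine ⟨c, hc, ?_⟩
        rw [Category.assoc, Category.assoc, e', ← e, Category.assoc, reassoc_of% frame_coframe]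

/-- With the order of the output wires fixed, a net has at most one value. Every equation of
morphisms below is finally read off from this. -/
theorem unique {N : List Box} {L L' : List Wire} {m m'} (h : Den D E L' N L m)
    (h' : Den D E L' N L m') : m = m' := by
  obtain ⟨c, hc, e⟩ := h.det h'
  rw [← e, hc.unique (.refl L') h.nodup_out, Category.comp_id]

/-- Extra wires may be carried along. -/
theorem frame {N : List Box} {L L' : List Wire} {m} (h : Den D E L' N L m) {R : List Wire}
    (hR : R.Nodup) (hd : ∀ w ∈ R, w ∉ L ∧ w ∉ wires N) :
    Den D E (L' ++ R) N (L ++ R) (frame m R) := by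
  induction h with
  | nil hL h =>
    refine .nil ?_ (h.frame R)
    exact List.Nodup.append hL hR fun w hw hw' => (hd w hw').1 hw
  | @cons b N L Q hL p h m h' ih =>
    have hLR : (L ++ R).Nodup := List.Nodup.append hL hR fun w hw hw' => (hd w hw').1 hw
    have ih' := ih fun w hw => ⟨by
      have := hd w hw
      have hp := h.perm.mem_iff (a := w)
      simp only [wires, List.mem_append] at this hp ⊢
      tauto, by
      have := hd w hw
      simp only [wires, List.mem_append] at this
      tauto⟩
    have := Den.cons b (Q ++ R) hLR ((h.frame R).trans (.assocHom b.ins Q R)) (ih'.pre (.assocInv b.outs Q R))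
    refine this.of_eq ?_
    simp only [HopfExt.frame, assocHom, assocInv, Category.assoc, Iso.inv_hom_id_assoc, comp_whiskerRight,
      ← whisker_exchange_assoc, whiskerLeft_inv_hom_assoc]
    simp

theorem perm_of_mem {A B : List Wire} (hA : A.Nodup) (hB : B.Nodup) (h : ∀ w, w ∈ A ↔ w ∈ B) :
    A.Perm B := (List.perm_ext_iff_of_nodup hA hB).2 h

/-- Independent boxes may be interchanged. -/
theorem swap {b c : Box} {N : List Box} {L L' : List Wire} {m}
    (h : Den D E L' (b :: c :: N) L m) (h₁ : ∀ w ∈ c.ins, w ∉ b.outs)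
    (h₂ : ∀ w ∈ b.ins, w ∉ c.outs) : Den D E L' (c :: b :: N) L m := by
  cases h with
  | @cons _ _ _ R hL p hp m hm => cases hm with
    | @cons _ _ _ R' hR q hq m hm =>
      have n1 := hp.perm.nodup_iff.1 hL
      have n2 := hq.perm.nodup_iff.1 hR
      have n3 := hm.nodup
      have hmem := fun w => hq.perm.mem_iff (a := w)
      simp only [List.mem_append] at hmem
      rw [List.nodup_append] at n1 n2 n3 hR
      -- `Q` consists of the wires that neither box touches. Independence of the boxes makes the
      -- wires at hand the disjoint union of `b.ins`, `c.ins` and `Q`.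
      have nQ : (R.filter (· ∉ c.ins)).Nodup := n1.2.1.filter _
      generalize hQ : R.filter (· ∉ c.ins) = Q at nQ
      have mQ : ∀ w, w ∈ Q ↔ w ∈ R ∧ w ∉ c.ins := fun w => by rw [← hQ]; simp
      have n4 : (c.ins ++ Q).Nodup := List.Nodup.append n2.1 nQ fun w hw hw' =>
        ((mQ w).1 hw').2 hw
      obtain ⟨r, hr⟩ := Can.exists_of_perm (ob := wob E) (perm_of_mem n1.2.1 n4 fun w => by
        have := hmem w; have := h₁ w
        have := fun a b => hR.2.2 w a w b
        simp only [List.mem_append, mQ]; tauto)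
      have n5 : (b.outs ++ Q).Nodup := List.Nodup.append hR.1 nQ fun w hw hw' =>
        hR.2.2 w hw w ((mQ w).1 hw').1 rfl
      obtain ⟨r', hr'⟩ := Can.exists_of_perm (ob := wob E) (perm_of_mem n5 n2.2.1 fun w => by
        have := hmem w; have := h₁ w
        have := fun a b => n2.2.2 w a w b
        simp only [List.mem_append, mQ]; tauto)
      have eq := hq.unique ((hr.coframe _).trans ((Can.blockSwap _ _ _).trans (hr'.coframe _)))
        (List.nodup_append.2 hR)
      have n6 : (c.outs ++ (b.ins ++ Q)).Nodup := by
        refine List.Nodup.append n3.1 (List.Nodup.append n1.1 nQ fun w hw hw' =>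
          n1.2.2 w hw w ((mQ w).1 hw').1 rfl) fun w hw hw' => ?_
        rcases List.mem_append.1 hw' with hw' | hw'
        · exact h₂ w hw' hw
        · exact n3.2.2 w hw w (hr'.perm.mem_iff.1 (List.mem_append_right _ hw')) rfl
      have k₁ := hm.pre ((Can.blockSwap b.outs c.outs Q).trans (hr'.coframe c.outs))
      have k₂ := Den.cons b (c.outs ++ Q) n6 (Can.blockSwap _ _ _) k₁
      have k₃ := Den.cons c (b.ins ++ Q) hL (hp.trans ((hr.coframe _).trans (Can.blockSwap _ _ _))) k₂
      refine k₃.of_eq ?_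
      simp only [eq, Category.assoc]
      rw [reassoc_of% frame_coframe, ← reassoc_of% (frame_coframe (c.mor D E) r'),
        ← reassoc_of% (coframe_frame_blockSwap b.ins), reassoc_of% blockSwap_blockSwap,
        ← reassoc_of% (frame_coframe (b.mor D E) (HopfExt.frame (c.mor D E) Q)),
        reassoc_of% coframe_frame_blockSwap]

end Den

end Den

/-! ### Computations with nets -/

/-- `A` and `B` have no wire in common. -/
def disj (A B : List Wire) : Bool := A.all fun a => !B.elem a

theorem disj_iff {A B : List Wire} : disj A B = true ↔ ∀ w ∈ A, w ∉ B := by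
  simp [disj]

/-- Removal of a box from a net in which it can be moved to the front. -/
def extract (b : Box) : List Box → Option (List Box)
  | [] => none
  | c :: N => if c = b then some N else
      if disj b.ins c.outs && disj c.ins b.outs then (extract b N).map (c :: ·) else none

/-- Do two nets differ only by interchanges of independent boxes? -/
def reorder : List Box → List Box → Bool
  | N, [] => N.isEmpty
  | N, b :: N' => match extract b N with
    | some M => reorder M N'
    | none => false

/-- The wires of `L` that are not in `A`. -/
def rest (A L : List Wire) : List Wire := L.filter fun w => !A.elem w

theorem mem_rest {A L : List Wire} {w : Wire} : w ∈ rest A L ↔ w ∈ L ∧ w ∉ A := by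
  simp [rest]

/-- Distinctness of wires. -/
def distinct : List Wire → Bool
  | [] => true
  | w :: L => !L.elem w && distinct L

theorem distinct_iff {L : List Wire} : distinct L = true ↔ L.Nodup := by
  induction L with
  | nil => simp [distinct]
  | cons w L ih => simp [distinct, ih]

/-- The output wires of a net with input wires `L`. -/
def run : List Box → List Wire → Option (List Wire)
  | [], L => some L
  | b :: N, L =>
    if distinct b.ins && b.ins.all L.elem && distinct b.outs && disj (rest b.ins L) b.outs then
      run N (b.outs ++ rest b.ins L) else none

/-- Is the net well-formed with these input and output wires? -/
def wellFormed (N : List Box) (L L' : List Wire) : Bool :=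
  distinct L && match run N L with
    | some M => M.isPerm L'
    | none => false

section Den

variable {S : Type u} [Category.{v} S] [MonoidalCategory S] [SymmetricCategory S]
variable {H : S} [HopfObj H] {D : Data H} {E : ℕ → Mod S H}

namespace Den

theorem cons_mono {N N' : List Box} {L' : List Wire}
    (h : ∀ {L m}, Den D E L' N L m → Den D E L' N' L m) (b : Box) {L : List Wire} {m}
    (hm : Den D E L' (b :: N) L m) : Den D E L' (b :: N') L m := by
  cases hm with
  | cons _ R hL hp hm => exact .cons b R hL hp (h hm)

theorem extract {b : Box} {N N' : List Box} (e : extract b N = some N') {L L' : List Wire} {m}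
    (h : Den D E L' N L m) : Den D E L' (b :: N') L m := by
  induction N generalizing N' L with
  | nil => simp [HopfExt.extract] at e
  | cons c N ih =>
    rw [HopfExt.extract] at e
    split_ifs at e with h₁ h₂
    · obtain rfl : N = N' := by simpa using e
      exact h₁ ▸ h
    · obtain ⟨N₂, e₂, rfl⟩ := Option.map_eq_some_iff.1 e
      rw [Bool.and_eq_true, disj_iff, disj_iff] at h₂
      exact swap (cons_mono (fun h => ih e₂ h) c h) h₂.1 h₂.2

theorem reorder {N N' : List Box} (e : reorder N N' = true) {L L' : List Wire} {m}
    (h : Den D E L' N L m) : Den D E L' N' L m := by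
  induction N' generalizing N L with
  | nil =>
    obtain rfl : N = [] := by simpa [HopfExt.reorder] using e
    exact h
  | cons b N' ih =>
    rw [HopfExt.reorder] at e
    split at e
    · next M hM => exact cons_mono (fun h => ih e h) b (h.extract hM)
    · simp at e

/-- The tests made by `run` are the side conditions of `Den.cons`, so one computation yields a value
under every interpretation. -/
theorem exists_of_run {N : List Box} {L M : List Wire} (hL : L.Nodup) (e : run N L = some M) :
    ∃ m, Den D E M N L m := by
  induction N generalizing L with
  | nil =>
    obtain rfl : L = M := by simpa [run] using e
    exact ⟨_, .nil hL (.refl L)⟩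
  | cons b N ih =>
    rw [run] at e
    split_ifs at e with h
    simp only [Bool.and_eq_true, distinct_iff, disj_iff, List.all_eq_true] at h
    obtain ⟨⟨⟨h₁, h₂⟩, h₃⟩, h₄⟩ := h
    have nr : (rest b.ins L).Nodup := hL.filter _
    obtain ⟨m, hm⟩ := ih (List.Nodup.append h₃ nr fun w hw hw' => h₄ w hw' hw) e
    obtain ⟨p, hp⟩ := Can.exists_of_perm (ob := wob E)
      (perm_of_mem hL (B := b.ins ++ rest b.ins L)
        (List.Nodup.append h₁ nr fun w hw hw' => (mem_rest.1 hw').2 hw) fun w => by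
          have := h₂ w
          simp only [List.elem_eq_mem, decide_eq_true_eq] at this
          simp only [List.mem_append, mem_rest]; tauto)
    exact ⟨_, .cons b _ hL hp hm⟩

theorem exists_of_wellFormed {N : List Box} {L L' : List Wire} (e : wellFormed N L L' = true) :
    ∃ m, Den D E L' N L m := by
  rw [wellFormed, Bool.and_eq_true, distinct_iff] at e
  obtain ⟨hL, e⟩ := e
  split at e
  · next M hM =>
    obtain ⟨m, hm⟩ := exists_of_run (D := D) (E := E) hL hM
    obtain ⟨p, hp⟩ := Can.exists_of_perm (ob := wob E) (List.isPerm_iff.1 e)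
    exact ⟨_, hm.post hp⟩
  · simp at e

end Den

theorem Box.mor_same (p q : ℕ → ℕ) (b : Box) :
    Same ((b.map p q).mor D E) (b.mor D (E ∘ q)) := by
  cases b <;> exact .rfl' _

theorem wob_comp (p q : ℕ → ℕ) : wob E ∘ Wire.map p q = wob (E ∘ q) := by
  funext w; cases w <;> rfl

/-- A net may be renamed. -/
theorem Den.map (p q : ℕ → ℕ) {N : List Box} {L L' : List Wire} {m}
    (h : Den D (E ∘ q) L' N L m)
    (hi : ∀ w ∈ L ++ wires N, ∀ w' ∈ L ++ wires N, w.map p q = w'.map p q → w = w') :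
    ∃ m', Den D E (L'.map (Wire.map p q)) (N.map (Box.map p q)) (L.map (Wire.map p q)) m' ∧
      Same m' m := by
  have key : ∀ {L L' : List Wire} {f}, Can (wob (E ∘ q)) L L' f →
      ∃ f', Can (wob E) (L.map (Wire.map p q)) (L'.map (Wire.map p q)) f' ∧ Same f' f := by
    rw [← wob_comp p q]
    exact fun h => h.map
  have nd : ∀ {L : List Wire}, L.Nodup → (∀ w ∈ L, ∀ w' ∈ L, w.map p q = w'.map p q → w = w') →
      (L.map (Wire.map p q)).Nodup := fun h h' => List.Nodup.map_on h' h
  induction h with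
  | @nil L hL f h =>
    obtain ⟨f', h', e⟩ := key h
    exact ⟨f', .nil (nd hL fun w hw w' hw' => hi w (by simp [hw]) w' (by simp [hw'])) h', e⟩
  | @cons b N L R hL f h m hm ih =>
    obtain ⟨f', h', e⟩ : ∃ f', Can (wob E) (L.map (Wire.map p q))
        ((b.map p q).ins ++ R.map (Wire.map p q)) f' ∧ Same f' f := by
      rw [Box.ins_map, ← List.map_append]
      exact key h
    have sub : ∀ w ∈ (b.outs ++ R) ++ wires N, w ∈ L ++ wires (b :: N) := fun w hw => by
      have := h.perm.mem_iff (a := w)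
      simp only [wires, List.mem_append] at this hw ⊢
      tauto
    obtain ⟨m', hm', em⟩ : ∃ m', Den D E (L'.map (Wire.map p q)) (N.map (Box.map p q))
        ((b.map p q).outs ++ R.map (Wire.map p q)) m' ∧ Same m' m := by
      rw [Box.outs_map, ← List.map_append]
      exact ih fun w hw w' hw' => hi w (sub w hw) w' (sub w' hw')
    have hN := nd hL fun w hw w' hw' => hi w (by simp [hw]) w' (by simp [hw'])
    have fs : ∀ {A A' B B' : List Wire} (_ : A = B.map (Wire.map p q))
        (_ : A' = B'.map (Wire.map p q)) {f : listTensor (wob E) A ⟶ listTensor (wob E) A'}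
        {f' : listTensor (wob (E ∘ q)) B ⟶ listTensor (wob (E ∘ q)) B'} (_ : Same f f')
        (R : List Wire), Same (HopfExt.frame f (R.map (Wire.map p q))) (HopfExt.frame f' R) := by
      rw [← wob_comp p q]
      exact frame_same _
    exact ⟨_, .cons (b.map p q) _ hN h' hm',
      e.comp ((fs (Box.ins_map p q b) (Box.outs_map p q b) (b.mor_same p q) R).comp em)⟩

end Den
end HopfExt

namespace HopfExt

/-! ### Rewriting of nets -/

/-- An equation between two nets with the same input and output wires. -/
structure Rule where
  dom : List Wire
  cod : List Wire
  lhs : List Box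
  rhs : List Box
  deriving DecidableEq

/-- Renaming through a table. -/
def table (l : List ℕ) (n : ℕ) : ℕ := l.getD n 0

/-- The transposition of two names. -/
def transp (a b n : ℕ) : ℕ := if n = a then b else if n = b then a else n

/-- The value of a function at a number, after evaluation of the number. -/
def forceNat {α : Type*} (k : ℕ → α) : ℕ → α
  | 0 => k 0
  | n + 1 => k (n + 1)

/-- The value of a function at a box, after evaluation of the names in the box. -/
def Box.force {α : Type*} (k : Box → α) : Box → α
  | mul a b c => forceNat (fun a => forceNat (fun b => forceNat (fun c => k (mul a b c)) c) b) a
  | comul a b c => forceNat (fun a => forceNat (fun b => forceNat (fun c => k (comul a b c)) c) b) a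
  | pt p a => forceNat (fun a => k (pt p a)) a
  | cov p a => forceNat (fun a => k (cov p a)) a
  | en p a b => forceNat (fun a => forceNat (fun b => k (en p a b)) b) a
  | gam a b => forceNat (fun a => forceNat (fun b => k (gam a b)) b) a
  | ev a b => forceNat (fun a => forceNat (fun b => k (ev a b)) b) a
  | sc p => k (sc p)
  | act a i => forceNat (fun a => forceNat (fun i => k (act a i)) i) a
  | omx i => forceNat (fun i => k (omx i)) i

/-- The value of a function at a net, after evaluation of the names in the net. -/
def forceNet {α : Type*} (k : List Box → α) : List Box → α
  | [] => k []
  | b :: N => b.force fun b => forceNet (fun N => k (b :: N)) N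

theorem forceNat_eq {α : Type*} (k : ℕ → α) (n : ℕ) : forceNat k n = k n := by
  cases n <;> rfl

theorem Box.force_eq {α : Type*} (k : Box → α) (b : Box) : b.force k = k b := by
  cases b <;> simp only [Box.force, forceNat_eq]

theorem forceNet_eq {α : Type*} (k : List Box → α) (N : List Box) : forceNet k N = k N := by
  induction N generalizing k with
  | nil => rfl
  | cons b N ih => rw [forceNet, Box.force_eq, ih]

/-- Separation of a net into the boxes that can be moved in front of those in `A`, and the other
boxes that are not in `A`. -/
def splitNet (A : List Box) : List Box → List Box → List Box × List Box
  | [], _ => ([], [])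
  | b :: N, acc => match extract b A with
    | some A' => splitNet A' N (b :: acc)
    | none =>
      if acc.all fun c => disj b.ins c.outs && disj c.ins b.outs then
        ((b :: (splitNet A N acc).1), (splitNet A N acc).2) else
        ((splitNet A N (b :: acc)).1, b :: (splitNet A N (b :: acc)).2)

/-- Replacement of the subnet `A`, with input wires `d`, by `B`. -/
def replaceNet (A B : List Box) (d : List Wire) (dom : List Wire) (N : List Box) :
    Option (List Box) :=
  let s := splitNet A N []
  if reorder N (s.1 ++ (A ++ s.2)) then
    match run s.1 dom with
    | some M =>
      if d.all M.elem && disj (rest d M) (wires A) && disj (rest d M) (wires B) then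
        some (s.1 ++ (B ++ s.2)) else none
    | none => none
  else none

/-- Injectivity on a list of wires. -/
def injOn (p q : ℕ → ℕ) : List Wire → Bool
  | [] => true
  | w :: L => L.all (fun w' => decide (w.map p q = w'.map p q → w = w')) && injOn p q L

/-- The part of a net before and after an identity box. -/
def splitAt (b : Box) : List Box → Option (List Box × List Box)
  | [] => none
  | c :: N => if c = b then some ([], N) else
      (splitAt b N).map fun s => (c :: s.1, s.2)

/-- Application of a rule whose wires are renamed through the tables `hs` and `xs`. -/
def applyRule (r : Rule) (hs xs : List ℕ) (dom : List Wire) (N : List Box) : Option (List Box) :=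
  if injOn (table hs) (table xs) (r.dom ++ (wires r.lhs ++ wires r.rhs)) then
    replaceNet (r.lhs.map (Box.map (table hs) (table xs)))
      (r.rhs.map (Box.map (table hs) (table xs))) (r.dom.map (Wire.map (table hs) (table xs))) dom N
  else none

/-- Removal of an identity box. -/
def absorb (dom cod : List Wire) (a b : ℕ) (N : List Box) : Option (List Box) :=
  match splitAt (.en .id a b) N with
  | some s =>
    if !(cod.elem (.h a) || cod.elem (.h b)) then
      some (s.1 ++ s.2.map (Box.map (transp a b) id)) else
    if !(dom.elem (.h a) || dom.elem (.h b)) then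
      some (s.1.map (Box.map (transp a b) id) ++ s.2) else none
  | none => none

/-- Removal of identity boxes. -/
def tidy (dom cod : List Wire) : ℕ → List Box → List Box
  | 0, N => N
  | k + 1, N =>
    match N.findSome? fun b => match b with
      | .en .id a b => absorb dom cod a b N
      | _ => none with
    | some N' => forceNet (tidy dom cod k) N'
    | none => N

/-- Partial injections between names, for the two kinds of wires. -/
abbrev Sub := List (ℕ × ℕ) × List (ℕ × ℕ)

/-- The value at `a` of a partial map. -/
def find (a : ℕ) : List (ℕ × ℕ) → Option ℕ
  | [] => none
  | p :: l => bif Nat.beq a p.1 then some p.2 else find a l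

/-- Extension of a partial injection. -/
def bind (a b : ℕ) (l : List (ℕ × ℕ)) : Option (List (ℕ × ℕ)) :=
  match find a l with
  | some c => bif Nat.beq c b then some l else none
  | none => bif l.any fun p => Nat.beq p.2 b then none else some ((a, b) :: l)

/-- Extension of a partial injection such that it maps one list to another. -/
def bindAll : List ℕ → List ℕ → List (ℕ × ℕ) → Option (List (ℕ × ℕ))
  | a :: l, b :: l', t => match bind a b t with
    | some t => bindAll l l' t
    | none => none
  | _, _, t => some t

/-- A number for each point. -/
def Pt.label : Pt → ℕ
  | one => 0 | g => 1 | gi => 2 | s => 3 | si => 4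

/-- A number for each covector. -/
def Cov.label : Cov → ℕ
  | eps => 0 | lam => 1

/-- A number for each endomorphism. -/
def En.label : En → ℕ
  | id => 0 | S => 1 | Si => 2 | om => 3 | f => 4 | fi => 5 | F => 6

/-- A number for the kind of a box. -/
def Box.label : Box → ℕ
  | mul _ _ _ => 0
  | comul _ _ _ => 1
  | gam _ _ => 2
  | ev _ _ => 3
  | act _ _ => 4
  | omx _ => 5
  | sc true => 6
  | sc false => 7
  | pt p _ => 10 + p.label
  | cov p _ => 20 + p.label
  | en p _ _ => 30 + p.label

/-- The names of the `H`-wires at a box. -/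
def Box.hs : Box → List ℕ
  | mul a b c => [a, b, c]
  | comul a b c => [a, b, c]
  | gam a b => [a, b]
  | ev a b => [a, b]
  | act a _ => [a]
  | omx _ => []
  | sc _ => []
  | pt _ a => [a]
  | cov _ a => [a]
  | en _ a b => [a, b]

/-- The names of the module wires at a box. -/
def Box.xs : Box → List ℕ
  | act _ i => [i]
  | omx i => [i]
  | _ => []

/-- Extension of a partial injection such that it maps one box to another one of the same kind. -/
def Box.unify (b c : Box) (t : Sub) : Option Sub :=
  match bindAll b.hs c.hs t.1 with
  | some h => match bindAll b.xs c.xs t.2 with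
    | some x => some (h, x)
    | none => none
  | none => none

/-- The boxes of a net with the numbers of their kinds. -/
def withLabels : List Box → List (ℕ × Box)
  | [] => []
  | b :: N => forceNat (fun n => (n, b) :: withLabels N) b.label

/-- The values of a function at the boxes of a given kind. -/
def atLabel (n : ℕ) (k : Box → List Sub) : List (ℕ × Box) → List Sub
  | [] => []
  | c :: N => bif Nat.beq n c.1 then k c.2 ++ atLabel n k N else atLabel n k N

/-- The occurrences of a net in another one. -/
def occurrences (N : List (ℕ × Box)) : List Box → Sub → List Sub
  | [], t => [t]
  | b :: A, t => forceNat (fun n => atLabel n (fun c => match b.unify c t with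
    | some t' => occurrences N A t'
    | none => []) N) b.label

/-- The names of the `H`-wires in a list. -/
def hNames : List Wire → List ℕ
  | [] => []
  | .h n :: L => n :: hNames L
  | .x _ :: L => hNames L

/-- A number that is larger than all names of `H`-wires in the list. -/
def bound (L : List Wire) : ℕ :=
  (hNames L).foldr (fun n k => bif Nat.ble k n then n + 1 else k) 0

/-- The table of a partial injection, with new names outside of its domain. -/
def tableOf (t : List (ℕ × ℕ)) (n k : ℕ) : List ℕ :=
  (List.range n).map fun a => match find a t with
    | some b => b
    | none => k + a

/-- The reverse of a rule. -/
def Rule.rev (r : Rule) : Rule := ⟨r.dom, r.cod, r.rhs, r.lhs⟩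

/-- Application of a rule at its `k`-th occurrence. -/
def rewrite (r : Rule) (k : ℕ) (dom cod : List Wire) (N : List Box) : Option (List Box) :=
  match (occurrences (withLabels N) r.lhs ([], []))[k]? with
  | some t =>
    (applyRule r (tableOf t.1 (bound (wires r.lhs ++ wires r.rhs)) (bound (dom ++ wires N)))
      -- Unmatched `H`-names of the rule receive names beyond those in the net, unmatched module
      -- names stay as they are; 4 exceeds the module names in the rules applied.
      (tableOf t.2 4 0) dom N).map fun N' => forceNet (fun N' => tidy dom cod N'.length N') N'
  | none => none

/-- The set of names of the wires at a box, as a bit mask. Module wires have odd numbers. -/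
def Box.mask (b : Box) : ℕ :=
  b.hs.foldr (fun n k => Nat.lor (Nat.shiftLeft 1 (Nat.mul 2 n)) k)
    (b.xs.foldr (fun n k => Nat.lor (Nat.shiftLeft 2 (Nat.mul 2 n)) k) 0)

/-- Removal of the first box that is attached to a set of wires. -/
def pick (m : ℕ) : List (ℕ × Box) → Option ((ℕ × Box) × List (ℕ × Box))
  | [] => none
  | b :: N => bif Nat.beq (Nat.land m b.1) 0 then
      match pick m N with
      | some s => some (s.1, b :: s.2)
      | none => none
    else some (b, N)

/-- Arrangement of a net that starts at a set of wires and proceeds to neighbours. -/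
def arrange : ℕ → ℕ → List (ℕ × Box) → List Box
  | 0, _, N => N.map (·.2)
  | k + 1, m, N => match pick m N with
    | some s => s.1.2 :: forceNat (fun m => arrange k m s.2) (Nat.lor m s.1.1)
    | none => match N with
      | [] => []
      | b :: N => b.2 :: arrange k (Nat.lor m b.1) N

/-- The set of names of a list of wires, as a bit mask. -/
def wireMask (L : List Wire) : ℕ :=
  L.foldr (fun w k => match w with
    | .h n => Nat.lor (Nat.shiftLeft 1 (Nat.mul 2 n)) k
    | .x n => Nat.lor (Nat.shiftLeft 2 (Nat.mul 2 n)) k) 0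

/-- The boxes of a net with their masks. -/
def withMasks : List Box → List (ℕ × Box)
  | [] => []
  | b :: N => forceNat (fun m => (m, b) :: withMasks N) b.mask

/-- The identity on the names in a list. -/
def idSub : List Wire → Sub
  | [] => ([], [])
  | .h n :: L => ((n, n) :: (idSub L).1, (idSub L).2)
  | .x n :: L => ((idSub L).1, if (idSub L).2.elem (n, n) then (idSub L).2 else (n, n) :: (idSub L).2)

/-- Distinctness of numbers. -/
def distinctNat : List ℕ → Bool
  | [] => true
  | a :: l => l.all (fun b => !Nat.beq a b) && distinctNat l

/-- The output wires of the boxes of a net. -/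
def outputs : List Box → List Wire
  | [] => []
  | b :: N => b.outs ++ outputs N

/-- The value of a function at a list of numbers, after evaluation of the numbers. -/
def forceNats {α : Type*} (k : List ℕ → α) : List ℕ → α
  | [] => k []
  | a :: l => forceNat (fun a => forceNats (fun l => k (a :: l)) l) a

theorem forceNats_eq {α : Type*} (k : List ℕ → α) (l : List ℕ) : forceNats k l = k l := by
  induction l generalizing k with
  | nil => rfl
  | cons a l ih => rw [forceNats, forceNat_eq, ih]

/-- Renaming through a list of pairs. -/
def pairing (l : List (ℕ × ℕ)) (n : ℕ) : ℕ := match find n l with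
  | some k => k
  | none => 0

/-- Does the renaming through the list of pairs `l` lead from the first net to the second one? -/
def isoVia (dom cod : List Wire) (N N' : List Box) (l : List (ℕ × ℕ)) : Bool :=
  forceNats distinctNat ((hNames (dom ++ outputs N)).map (pairing l)) &&
    decide (dom.map (Wire.map (pairing l) id) = dom) &&
    decide (cod.map (Wire.map (pairing l) id) = cod) &&
    forceNet (fun M => reorder M N') (N.map (Box.map (pairing l) id))

/-- Are two nets equal up to names? -/
def isoNet (dom cod : List Wire) (N N' : List Box) : Bool :=
  match occurrences (withLabels N') (arrange N.length (wireMask (dom ++ cod)) (withMasks N)) (idSub (dom ++ cod)) with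
  | t :: _ => isoVia dom cod N N' t.1
  | [] => false

/-- The net `N'`, if the rule leads from it to `N`. -/
def undo (r : Rule) (hs : List ℕ) (N' : List Box) (dom cod : List Wire) (N : List Box) :
    Option (List Box) :=
  match applyRule r hs [] dom N' with
  | some M =>
    if wellFormed N' dom cod && isoNet dom cod (tidy dom cod M.length M) N then some N' else none
  | none => none

/-- Insertion of the left-hand side of a rule, whose right-hand side is an identity box, at the
wire `a`. -/
def insertAt (r : Rule) (a : ℕ) (dom cod : List Wire) (N : List Box) : Option (List Box) :=
  match r.rhs with
  | [.en .id i j] =>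
    let n := bound (wires r.lhs ++ wires r.rhs)
    let c := bound (dom ++ wires N)
    let s := N.span fun b => !b.ins.elem (.h a)
    -- If no box consumes `a`, the new piece goes to the end and the earlier occurrences of `a` are
    -- renamed to `c`. Otherwise it goes before the first consumer, and the occurrences from there
    -- on are renamed.
    let u := s.2.isEmpty
    let hs := tableOf [(i, if u then c else a), (j, if u then a else c)] n (c + 1)
    let A := r.lhs.map (Box.map (table hs) id)
    undo r hs (if u then N.map (Box.map (transp a c) id) ++ A
      else s.1 ++ (A ++ s.2.map (Box.map (transp a c) id))) dom cod N
  | _ => none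

/-- Steps of a computation with nets: `rw r k` applies the rule `r` at its `k`-th occurrence,
`wr r k` applies it in the reverse direction, and `ins r a` inserts the left-hand side of a rule
whose right-hand side is an identity. -/
inductive Step
  | rw (r : Rule) (k : ℕ)
  | wr (r : Rule) (k : ℕ)
  | ins (r : Rule) (a : ℕ)

/-- The rule that is used in a step. -/
def Step.rule : Step → Rule
  | rw r _ => r
  | wr r _ => r
  | ins r _ => r

/-- Execution of a step. -/
def Step.exec (dom cod : List Wire) (N : List Box) : Step → Option (List Box)
  | rw r k => rewrite r k dom cod N
  | wr r k => rewrite r.rev k dom cod N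
  | ins r a => insertAt r a dom cod N

/-- Execution of a list of steps. -/
def execAll (dom cod : List Wire) : List Step → List Box → Option (List Box)
  | [], N => some N
  | s :: l, N => match s.exec dom cod N with
    | some N' => forceNet (execAll dom cod l) N'
    | none => none

/-- Do the two computations, from both sides of the rule, lead to the same net? -/
def Rule.check (r : Rule) (fwd bwd : List Step) : Bool :=
  wellFormed r.lhs r.dom r.cod && wellFormed r.rhs r.dom r.cod &&
  match execAll r.dom r.cod fwd r.lhs, execAll r.dom r.cod bwd r.rhs with
  | some N, some N' => isoNet r.dom r.cod N N'
  | _, _ => false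

/-! ### Soundness of the rewriting steps. -/

section Sound

variable {S : Type u} [Category.{v} S] [MonoidalCategory S] [SymmetricCategory S]
variable {H : S} [HopfObj H]

/-- The rule holds under the interpretation `D`. -/
class Valid (D : Data H) (r : Rule) : Prop where
  out : ∀ E : ℕ → Mod S H, ∃ m, Den D E r.cod r.lhs r.dom m ∧ Den D E r.cod r.rhs r.dom m

/-- All rules used in a list of steps hold. -/
class ValidSteps (D : Data H) (l : List Step) : Prop where
  out : ∀ s ∈ l, Valid D s.rule

instance (D : Data H) : ValidSteps D [] := ⟨by simp⟩

theorem ValidSteps.cons (D : Data H) (s : Step) (l : List Step) (h : Valid D s.rule)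
    [hl : ValidSteps D l] : ValidSteps D (s :: l) :=
  ⟨fun s' h' => by
    rcases List.mem_cons.1 h' with rfl | h'
    · exact h
    · exact hl.out _ h'⟩

instance (D : Data H) (r : Rule) (k : ℕ) (l : List Step) [h : Valid D r] [ValidSteps D l] :
    ValidSteps D (.rw r k :: l) := .cons D _ l h

instance (D : Data H) (r : Rule) (k : ℕ) (l : List Step) [h : Valid D r] [ValidSteps D l] :
    ValidSteps D (.wr r k :: l) := .cons D _ l h

instance (D : Data H) (r : Rule) (a : ℕ) (l : List Step) [h : Valid D r] [ValidSteps D l] :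
    ValidSteps D (.ins r a :: l) := .cons D _ l h

theorem Valid.rev {D : Data H} {r : Rule} (h : Valid D r) : Valid D r.rev :=
  ⟨fun E => let ⟨m, h₁, h₂⟩ := h.out E; ⟨m, h₂, h₁⟩⟩

variable {D : Data H} {E : ℕ → Mod S H}

/-- Once the boxes of `A` stand together, the wires that they do not consume are carried along by
`Den.frame`. The disjointness tests ensure this for `A` and for `B`, and both have the value `a`. -/
theorem Den.replaceNet {A B N N' : List Box} {d c dom cod : List Wire}
    (e : replaceNet A B d dom N = some N') {a} (hA : Den D E c A d a) (hB : Den D E c B d a) {m}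
    (h : Den D E cod N dom m) : Den D E cod N' dom m := by
  rw [HopfExt.replaceNet] at e
  generalize splitNet A N [] = s at e
  obtain ⟨pre, post⟩ := s
  dsimp only at e
  split_ifs at e with h₁
  split at e
  swap
  · simp at e
  next M hM =>
  split_ifs at e with h₂
  obtain rfl : pre ++ (B ++ post) = N' := by simpa using e
  simp only [Bool.and_eq_true, disj_iff, List.all_eq_true] at h₂
  obtain ⟨⟨h₂, h₃⟩, h₄⟩ := h₂
  obtain ⟨M₁, p, k, hp, hk, rfl⟩ := (h.reorder h₁).split
  obtain ⟨p', hp'⟩ := exists_of_run (D := D) (E := E) h.nodup hM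
  obtain ⟨u, hu, eu⟩ := hp'.det hp
  obtain ⟨M₂, q, k', hq, hk', rfl⟩ := hk.split
  have nM := hp'.nodup_out
  have nR : (rest d M).Nodup := nM.filter _
  have nd : (d ++ rest d M).Nodup :=
    List.Nodup.append hA.nodup nR fun w hw hw' => (mem_rest.1 hw').2 hw
  obtain ⟨t, ht⟩ := Can.exists_of_perm (ob := wob E) (perm_of_mem nd nM fun w => by
    have := h₂ w
    simp only [List.elem_eq_mem, decide_eq_true_eq] at this
    simp only [List.mem_append, mem_rest]; tauto)
  obtain ⟨t', ht', e₁, e₂⟩ := ht.exists_inv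
  have fA := hA.frame nR fun w hw => ⟨(mem_rest.1 hw).2, h₃ w hw⟩
  have fB := hB.frame nR fun w hw => ⟨(mem_rest.1 hw).2, h₄ w hw⟩
  -- The actual evaluation of `A` inside the net and the framed one differ by a rearrangement `x` of
  -- the outputs, which is used for `B` as well.
  obtain ⟨x, hx, ex⟩ := fA.det (hq.pre (ht.trans hu))
  have := hp'.append ((fB.post hx).append hk' |>.pre ht')
  refine this.of_eq ?_
  rw [ex, ← eu]
  simp [reassoc_of% e₂]

theorem injOn_iff {p q : ℕ → ℕ} {L : List Wire} (h : injOn p q L = true) :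
    ∀ w ∈ L, ∀ w' ∈ L, w.map p q = w'.map p q → w = w' := by
  induction L with
  | nil => simp
  | cons v L ih =>
    simp only [injOn, Bool.and_eq_true, List.all_eq_true, decide_eq_true_eq] at h
    have := ih h.2
    intro w hw w' hw' e
    rcases List.mem_cons.1 hw with h₁ | h₁ <;> rcases List.mem_cons.1 hw' with h₂ | h₂
    · exact h₁.trans h₂.symm
    · subst h₁; exact h.1 _ h₂ e
    · subst h₂; exact (h.1 _ h₁ e.symm).symm
    · exact this w h₁ w' h₂ e

theorem splitAt_eq {b : Box} {N : List Box} {s : List Box × List Box}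
    (e : splitAt b N = some s) : N = s.1 ++ b :: s.2 := by
  induction N generalizing s with
  | nil => simp [splitAt] at e
  | cons c N ih =>
    rw [splitAt] at e
    split_ifs at e with h
    · obtain rfl : ([], N) = s := by simpa using e
      simp [h]
    · obtain ⟨s', e', rfl⟩ := Option.map_eq_some_iff.1 e
      rw [ih e']; rfl

theorem transp_involutive (a b : ℕ) : Function.Involutive (transp a b) := by
  intro n; simp only [transp]; split_ifs <;> simp_all

theorem wire_map_transp_injective (a b : ℕ) :
    Function.Injective (Wire.map (transp a b) id) := by
  intro w w' h
  cases w <;> cases w' <;> simp_all [Wire.map, (transp_involutive a b).injective.eq_iff]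

theorem map_transp_eq {a b : ℕ} {L : List Wire} (ha : Wire.h a ∉ L) (hb : Wire.h b ∉ L) :
    L.map (Wire.map (transp a b) id) = L := by
  conv_rhs => rw [← List.map_id L]
  refine List.map_congr_left fun w hw => ?_
  cases w with
  | x n => rfl
  | h n =>
    have h₁ : n ≠ a := fun e => ha (e ▸ hw)
    have h₂ : n ≠ b := fun e => hb (e ▸ hw)
    simp [Wire.map, transp, h₁, h₂]

theorem Den.transp {N : List Box} {L L' : List Wire} {m} (h : Den D E L' N L m) (a b : ℕ)
    {M M' : List Wire} (hM : L.map (Wire.map (transp a b) id) = M)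
    (hM' : L'.map (Wire.map (HopfExt.transp a b) id) = M') :
    ∃ m', Den D E M' (N.map (Box.map (HopfExt.transp a b) id)) M m' ∧ Same m' m := by
  subst hM hM'
  exact Den.map (E := E) (HopfExt.transp a b) id h
    fun _ _ _ _ e => wire_map_transp_injective a b e

theorem frame_en_id (a b : ℕ) (R : List Wire) :
    frame (Box.mor D E (.en .id a b)) R = 𝟙 (H ⊗ listTensor (wob E) R) := by
  have : Box.mor D E (.en .id a b) = 𝟙 (H ⊗ 𝟙_ S) := by
    change (ρ_ H).hom ≫ 𝟙 H ≫ (ρ_ H).inv = _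
    simp
  rw [this]
  exact frame_id (ob := wob E) [.h a] R

/-- Validity refers to all environments, so it may be used for `E ∘ table xs`. This is what permits
one rule to act on any module wire. -/
theorem Den.applyRule {r : Rule} (hr : Valid D r) {hs xs : List ℕ} {dom cod : List Wire}
    {N N' : List Box} (e : applyRule r hs xs dom N = some N') {m} (h : Den D E cod N dom m) :
    Den D E cod N' dom m := by
  rw [HopfExt.applyRule] at e
  split_ifs at e with hi
  have hi := injOn_iff hi
  obtain ⟨k, hl, hr⟩ := hr.out (E ∘ table xs)
  obtain ⟨k₁, hl, e₁⟩ := hl.map (E := E) (table hs) (table xs) fun w hw w' hw' =>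
    hi w (by simp at hw ⊢; tauto) w' (by simp at hw' ⊢; tauto)
  obtain ⟨k₂, hr, e₂⟩ := hr.map (E := E) (table hs) (table xs) fun w hw w' hw' =>
    hi w (by simp at hw ⊢; tauto) w' (by simp at hw' ⊢; tauto)
  obtain rfl := (e₁.trans e₂.symm).eq
  exact Den.replaceNet e hl hr h

/-- An identity box from `a` to `b` disappears after `a` and `b` are transposed, either in the net
behind it, if neither name is an output, or in the net before it, if neither is an input. -/
theorem Den.absorb {dom cod : List Wire} {a b : ℕ} {N N' : List Box}
    (e : absorb dom cod a b N = some N') {m} (h : Den D E cod N dom m) : Den D E cod N' dom m := by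
  rw [HopfExt.absorb] at e
  split at e
  swap
  · simp at e
  next s hs =>
  rw [splitAt_eq hs] at h
  obtain ⟨M, m₁, m₂, h₁, h₂, rfl⟩ := h.split
  cases h₂ with
  | @cons _ _ _ R hM p hp m₂ h₂ =>
  have n₁ := hp.perm.nodup_iff.1 hM
  have n₂ := h₂.nodup
  have haR : Wire.h a ∉ R := (List.nodup_cons.1 n₁).1
  have hbR : Wire.h b ∉ R := (List.nodup_cons.1 n₂).1
  have hid := frame_en_id (D := D) (E := E) a b R
  split_ifs at e with i₁ i₂
  · obtain rfl := Option.some.inj e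
    simp only [List.elem_eq_mem, Bool.not_eq_true', Bool.or_eq_false_iff,
      decide_eq_false_iff_not] at i₁
    obtain ⟨m', k, e'⟩ := h₂.transp a b (M := [.h a] ++ R) (M' := cod) (by
      change Wire.h (HopfExt.transp a b b) :: R.map _ = Wire.h a :: R
      rw [map_transp_eq haR hbR]
      simp only [HopfExt.transp]; split_ifs <;> simp_all) (map_transp_eq i₁.1 i₁.2)
    refine (h₁.append (k.pre hp)).of_eq ?_
    refine Same.eq (.comp (.rfl' _) (.comp (.rfl' _) (.trans (.of_eq ?_) e'.symm)))
    exact (congrArg (· ≫ m₂) hid).trans (Category.id_comp m₂)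
  · obtain rfl := Option.some.inj e
    simp only [List.elem_eq_mem, Bool.not_eq_true', Bool.or_eq_false_iff,
      decide_eq_false_iff_not] at i₂
    obtain ⟨m', k, e'⟩ := (h₁.post hp).transp a b (M := dom) (M' := [.h b] ++ R)
      (map_transp_eq i₂.1 i₂.2) (by
      change Wire.h (HopfExt.transp a b a) :: R.map _ = Wire.h b :: R
      rw [map_transp_eq haR hbR]
      simp [HopfExt.transp])
    refine (k.append h₂).of_eq ?_
    rw [← Category.assoc]
    refine Same.eq (.comp e'.symm (.of_eq ?_))
    exact (congrArg (· ≫ m₂) hid).trans (Category.id_comp m₂)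

theorem Den.tidy {dom cod : List Wire} (k : ℕ) {N : List Box} {m} (h : Den D E cod N dom m) :
    Den D E cod (tidy dom cod k N) dom m := by
  induction k generalizing N with
  | zero => exact h
  | succ k ih =>
    rw [HopfExt.tidy]
    split
    · next N' e =>
      rw [forceNet_eq]
      obtain ⟨b, -, e⟩ := List.exists_of_findSome?_eq_some e
      refine ih ?_
      split at e
      · exact h.absorb e
      · simp at e
    · exact h

/-- Every wire of a net that can be evaluated is an input of the net or an output of some box. Hence
`isoVia` needs to test injectivity on these wires only. -/
theorem Den.mem_outputs {L L' : List Wire} {N : List Box} {m} (h : Den D E L' N L m) :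
    ∀ w ∈ L ++ wires N, w ∈ L ++ outputs N := by
  induction h with
  | nil => simp [wires, outputs]
  | @cons b N L R hL p h m h' ih =>
    intro w hw
    have hp := h.perm.mem_iff (a := w)
    have := ih w
    simp only [wires, outputs, List.mem_append] at *
    tauto

theorem mem_hNames {n : ℕ} {L : List Wire} : n ∈ hNames L ↔ Wire.h n ∈ L := by
  induction L with
  | nil => simp [hNames]
  | cons w L ih => cases w <;> simp [hNames, ih]

theorem distinctNat_iff {l : List ℕ} : distinctNat l = true ↔ l.Nodup := by
  induction l with
  | nil => simp [distinctNat]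
  | cons a l ih =>
    simp only [distinctNat, ih, Bool.and_eq_true, List.all_eq_true, List.nodup_cons,
      Bool.not_eq_true']
    refine and_congr_left fun _ => ⟨fun h ha => by simpa using h a ha, fun h b hb => ?_⟩
    rw [← Bool.not_eq_true, Nat.beq_eq]
    rintro rfl
    exact h hb

theorem Den.isoVia {dom cod : List Wire} {N N' : List Box} {l : List (ℕ × ℕ)}
    (e : isoVia dom cod N N' l = true) {m} (h : Den D E cod N dom m) : Den D E cod N' dom m := by
  rw [HopfExt.isoVia, forceNats_eq, forceNet_eq] at e
  simp only [Bool.and_eq_true, decide_eq_true_eq, distinctNat_iff] at e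
  obtain ⟨⟨⟨e₁, e₂⟩, e₃⟩, e₄⟩ := e
  have hi : ∀ w ∈ dom ++ wires N, ∀ w' ∈ dom ++ wires N,
      w.map (pairing l) id = w'.map (pairing l) id → w = w' := by
    intro w hw w' hw' hh
    cases w <;> cases w' <;> simp only [Wire.map, Wire.h.injEq, Wire.x.injEq, id,
      reduceCtorEq] at hh ⊢
    · exact List.inj_on_of_nodup_map e₁ (mem_hNames.2 (h.mem_outputs _ hw))
        (mem_hNames.2 (h.mem_outputs _ hw')) hh
    · exact hh
  obtain ⟨m', h', e⟩ : ∃ m', Den D E cod (N.map (Box.map (pairing l) id)) dom m' ∧ Same m' m := by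
    have := Den.map (E := E) (pairing l) id h hi
    rwa [e₂, e₃] at this
  exact (h'.reorder e₄).of_eq e.eq.symm

/-- The search by `occurrences` merely proposes a renaming; `isoVia` verifies it. -/
theorem Den.isoNet {dom cod : List Wire} {N N' : List Box} (e : isoNet dom cod N N' = true) {m}
    (h : Den D E cod N dom m) : Den D E cod N' dom m := by
  rw [HopfExt.isoNet] at e
  split at e
  · exact h.isoVia e
  · simp at e

theorem Den.rewrite {r : Rule} (hr : Valid D r) {k : ℕ} {dom cod : List Wire}
    {N N' : List Box} (e : rewrite r k dom cod N = some N') {m} (h : Den D E cod N dom m) :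
    Den D E cod N' dom m := by
  rw [HopfExt.rewrite] at e
  split at e
  · obtain ⟨M, e', rfl⟩ := Option.map_eq_some_iff.1 e
    rw [forceNet_eq]
    exact (h.applyRule hr e').tidy _
  · simp at e

/-- A right-hand side that consists of an identity box leaves nothing to match, since `tidy` removes
such boxes. So the larger net `M` is guessed. It is well-formed and therefore has a value, the rule
leads from it back to `N`, and uniqueness identifies the two values. -/
theorem Den.undo {r : Rule} (hr : Valid D r) {hs : List ℕ} {dom cod : List Wire}
    {M N N' : List Box} (e : undo r hs M dom cod N = some N') {m} (h : Den D E cod N dom m) :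
    Den D E cod N' dom m := by
  rw [HopfExt.undo] at e
  split at e
  · next M hM =>
    split_ifs at e with hw
    obtain rfl := Option.some.inj e
    rw [Bool.and_eq_true] at hw
    obtain ⟨m', h'⟩ := Den.exists_of_wellFormed (D := D) (E := E) hw.1
    exact h'.of_eq ((((h'.applyRule hr hM).tidy _).isoNet hw.2).unique h).symm
  · simp at e

theorem Den.insertAt {r : Rule} (hr : Valid D r) {a : ℕ} {dom cod : List Wire}
    {N N' : List Box} (e : insertAt r a dom cod N = some N') {m} (h : Den D E cod N dom m) :
    Den D E cod N' dom m := by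
  rw [HopfExt.insertAt] at e
  split at e
  · exact h.undo hr e
  · simp at e

theorem Den.exec {s : Step} (hs : Valid D s.rule) {dom cod : List Wire} {N N' : List Box}
    (e : s.exec dom cod N = some N') {m} (h : Den D E cod N dom m) : Den D E cod N' dom m := by
  cases s with
  | rw r k => exact h.rewrite hs e
  | wr r k => exact h.rewrite hs.rev e
  | ins r a => exact h.insertAt hs e

theorem Den.execAll {dom cod : List Wire} {l : List Step} [hl : ValidSteps D l]
    {N N' : List Box} (e : execAll dom cod l N = some N') {m} (h : Den D E cod N dom m) :
    Den D E cod N' dom m := by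
  replace hl := hl.out
  induction l generalizing N with
  | nil =>
    obtain rfl := Option.some.inj e
    exact h
  | cons s l ih =>
    rw [HopfExt.execAll] at e
    split at e
    · next N₁ e₁ =>
      rw [forceNet_eq] at e
      exact ih e (h.exec (hl s List.mem_cons_self) e₁)
        fun s hs => hl s (List.mem_cons_of_mem _ hs)
    · simp at e

/-- A rule holds if the computations lead from its two sides to the same net. -/
theorem Valid.prove {r : Rule} (fwd bwd : List Step) [hf : ValidSteps D fwd]
    [hb : ValidSteps D bwd] (e : r.check fwd bwd = true := by decide +kernel) : Valid D r := by
  rw [Rule.check, Bool.and_eq_true, Bool.and_eq_true] at e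
  refine ⟨fun E => ?_⟩
  obtain ⟨m, h⟩ := Den.exists_of_wellFormed (D := D) (E := E) e.1.1
  obtain ⟨m', h'⟩ := Den.exists_of_wellFormed (D := D) (E := E) e.1.2
  have e := e.2
  split at e
  · next N N' hN hN' =>
    refine ⟨m, h, h'.of_eq ?_⟩
    exact ((h.execAll hN).isoNet e).unique (h'.execAll hN')
  · simp at e

end Sound
end HopfExt

namespace HopfExt

/-! ### The right unitor and the symmetry as structural isomorphisms. -/

section Can

variable {S : Type u} [Category.{v} S] [MonoidalCategory S] [SymmetricCategory S]
variable {J : Type*} {ob : J → S}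

theorem Can.rnil : ∀ L : List J,
    Can ob L (L ++ []) ((ρ_ (listTensor ob L)).inv ≫ (appendIso ob L []).inv)
  | [] => Can.nil.of_eq (by
      change (ρ_ (𝟙_ S)).inv ≫ (λ_ (𝟙_ S)).hom = _
      simp [unitors_equal])
  | w :: L => ((Can.rnil L).cons w).of_eq (by
      change (ρ_ (ob w ⊗ listTensor ob L)).inv ≫ (α_ _ _ _).hom ≫ ob w ◁ (appendIso ob L []).inv = _
      simp)

/-- A block exchange in front of an empty third block, conjugated by right unitors. -/
theorem Can.braid (L R : List J) :
    Can ob (L ++ R) (R ++ L) ((appendIso ob L R).hom ≫ (β_ _ _).hom ≫ (appendIso ob R L).inv) := by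
  obtain ⟨k, hk, e, e'⟩ := (Can.rnil (ob := ob) L).exists_inv
  refine (((Can.rnil R).coframe L).trans ((Can.blockSwap L R []).trans (hk.coframe R))).of_eq ?_
  have hk : k = (appendIso ob L []).hom ≫ (ρ_ _).hom := by
    rw [← cancel_epi ((ρ_ (listTensor ob L)).inv ≫ (appendIso ob L []).inv), e]
    simp
  subst hk
  simp only [HopfExt.coframe, HopfExt.blockSwap, whiskerLeft_comp, Category.assoc, Iso.inv_hom_id_assoc,
    whiskerLeft_inv_hom_assoc, headSwap]
  simp

end Can

/-! ### Syntax of morphisms -/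

/-- Shapes of objects. -/
inductive Sh
  | one
  | H
  | X (i : ℕ)
  | t (l r : Sh)

/-- Names for the `H`-factors of an object. -/
@[reducible] def Sh.Names : Sh → Type
  | .one => Unit
  | .H => ℕ
  | .X _ => Unit
  | .t l r => l.Names × r.Names

/-- The list of wires. -/
def Sh.flat : (s : Sh) → s.Names → List Wire
  | .one, _ => []
  | .H, a => [.h a]
  | .X i, _ => [.x i]
  | .t l r, n => l.flat n.1 ++ r.flat n.2

/-- Syntax of morphisms between tensor products of `H` and of modules. -/
inductive Ex : Sh → Sh → Type
  | id (a : Sh) : Ex a a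
  | comp {a b c : Sh} (e : Ex a b) (f : Ex b c) : Ex a c
  | tens {a b c d : Sh} (e : Ex a b) (f : Ex c d) : Ex (.t a c) (.t b d)
  | whL (a : Sh) {b c : Sh} (e : Ex b c) : Ex (.t a b) (.t a c)
  | whR {b c : Sh} (e : Ex b c) (a : Sh) : Ex (.t b a) (.t c a)
  | al (a b c : Sh) : Ex (.t (.t a b) c) (.t a (.t b c))
  | al' (a b c : Sh) : Ex (.t a (.t b c)) (.t (.t a b) c)
  | lu (a : Sh) : Ex (.t .one a) a
  | lu' (a : Sh) : Ex a (.t .one a)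
  | ru (a : Sh) : Ex (.t a .one) a
  | ru' (a : Sh) : Ex a (.t a .one)
  | br (a b : Sh) : Ex (.t a b) (.t b a)
  | mul : Ex (.t .H .H) .H
  | comul : Ex .H (.t .H .H)
  | pt (p : Pt) : Ex .one .H
  | cov (p : Cov) : Ex .H .one
  | en (p : En) : Ex .H .H
  | gam : Ex .one (.t .H .H)
  | ev : Ex (.t .H .H) .one
  | sc (p : Bool) : Ex .one .one
  | act (i : ℕ) : Ex (.t .H (.X i)) (.X i)
  | omx (i : ℕ) : Ex (.X i) (.X i)

/-- The net of a morphism, with names of the output wires; `k` is the first name not in use. -/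
def Ex.run : {s t : Sh} → Ex s t → s.Names → ℕ → List Box × t.Names × ℕ
  | _, _, .id _, n, k => ([], n, k)
  | _, _, .comp e f, n, k =>
    let r := e.run n k
    let r' := f.run r.2.1 r.2.2
    (r.1 ++ r'.1, r'.2)
  | _, _, .tens e f, n, k =>
    let r := e.run n.1 k
    let r' := f.run n.2 r.2.2
    (r.1 ++ r'.1, (r.2.1, r'.2.1), r'.2.2)
  | _, _, .whL _ e, n, k => let r := e.run n.2 k; (r.1, (n.1, r.2.1), r.2.2)
  | _, _, .whR e _, n, k => let r := e.run n.1 k; (r.1, (r.2.1, n.2), r.2.2)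
  | _, _, .al _ _ _, n, k => ([], (n.1.1, (n.1.2, n.2)), k)
  | _, _, .al' _ _ _, n, k => ([], ((n.1, n.2.1), n.2.2), k)
  | _, _, .lu _, n, k => ([], n.2, k)
  | _, _, .lu' _, n, k => ([], ((), n), k)
  | _, _, .ru _, n, k => ([], n.1, k)
  | _, _, .ru' _, n, k => ([], (n, ()), k)
  | _, _, .br _ _, n, k => ([], (n.2, n.1), k)
  | _, _, .mul, n, k => ([.mul n.1 n.2 k], k, k + 1)
  | _, _, .comul, n, k => ([.comul n k (k + 1)], (k, k + 1), k + 2)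
  | _, _, .pt p, _, k => ([.pt p k], k, k + 1)
  | _, _, .cov p, n, k => ([.cov p n], (), k)
  | _, _, .en p, n, k => ([.en p n k], k, k + 1)
  | _, _, .gam, _, k => ([.gam k (k + 1)], (k, k + 1), k + 2)
  | _, _, .ev, n, k => ([.ev n.1 n.2], (), k)
  | _, _, .sc p, _, k => ([.sc p], (), k)
  | _, _, .act i, n, k => ([.act n.1 i], (), k)
  | _, _, .omx i, _, k => ([.omx i], (), k)

/-- Consecutive names. -/
def Sh.init : (s : Sh) → ℕ → s.Names × ℕ
  | .one, k => ((), k)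
  | .H, k => (k, k + 1)
  | .X _, k => ((), k)
  | .t l r, k =>
    let n := l.init k
    let n' := r.init n.2
    ((n.1, n'.1), n'.2)

/-- Identity boxes that change names. -/
def Sh.close : (s : Sh) → s.Names → s.Names → List Box
  | .one, _, _ => []
  | .H, a, b => [.en .id a b]
  | .X _, _, _ => []
  | .t l r, n, m => l.close n.1 m.1 ++ r.close n.2 m.2

/-- The input wires of the net of a morphism. -/
def Ex.ins {s t : Sh} (_ : Ex s t) : List Wire := s.flat (s.init (t.init 0).2).1

/-- The output wires of the net of a morphism. -/
def Ex.outs {s t : Sh} (_ : Ex s t) : List Wire := t.flat (t.init 0).1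

/-- The net of a morphism. -/
def Ex.net {s t : Sh} (e : Ex s t) : List Box :=
  -- The outputs are named from 0 on, then the inputs, then the inner wires. The boundary thus
  -- depends on the shapes alone, and nets of parallel morphisms can be compared.
  let i := s.init (t.init 0).2
  let r := e.run i.1 i.2
  let N := r.1 ++ t.close r.2.1 (t.init 0).1
  tidy e.ins e.outs N.length N

/-- The equation between two morphisms. -/
def Ex.rule {s t : Sh} (e e' : Ex s t) : Rule := ⟨e.ins, e.outs, e.net, e'.net⟩

/-- All names of `H`-wires in the list are less than `k`. -/
def Below (k : ℕ) (L : List Wire) : Prop := ∀ a, Wire.h a ∈ L → a < k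

theorem Sh.init_spec (s : Sh) (k : ℕ) : k ≤ (s.init k).2 ∧
    ∀ a, Wire.h a ∈ s.flat (s.init k).1 → k ≤ a ∧ a < (s.init k).2 := by
  induction s generalizing k with
  | one => simp [init, flat]
  | H => simp [init, flat]
  | X i => simp [init, flat]
  | t l r hl hr =>
    have h₁ := hl k
    have h₂ := hr (l.init k).2
    refine ⟨h₁.1.trans h₂.1, fun a ha => ?_⟩
    rcases List.mem_append.1 ha with ha | ha
    · have h := h₁.2 a ha; have := h₂.1; exact ⟨h.1, by simp only [init]; omega⟩
    · have h := h₂.2 a ha; have := h₁.1; exact ⟨by omega, h.2⟩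

/-- A list of wires with names in use before `k` or new ones. -/
def Fresh (L M : List Wire) (k k' : ℕ) : Prop :=
  k ≤ k' ∧ ∀ w ∈ M, w ∈ L ∨ ∃ a, w = .h a ∧ k ≤ a ∧ a < k'

theorem wires_append (N N' : List Box) : wires (N ++ N') = wires N ++ wires N' := by
  induction N with
  | nil => rfl
  | cons b N ih => simp [wires, ih]

theorem Fresh.refl {L M : List Wire} (k : ℕ) (h : ∀ w ∈ M, w ∈ L) : Fresh L M k k :=
  ⟨le_rfl, fun w hw => .inl (h w hw)⟩

/-- This keeps the names in the two factors of a tensor product apart, as `Den.tens` demands. -/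
theorem Ex.run_fresh {s t : Sh} (e : Ex s t) (n : s.Names) (k : ℕ) :
    Fresh (s.flat n) (wires (e.run n k).1 ++ t.flat (e.run n k).2.1) k (e.run n k).2.2 := by
  induction e generalizing k with
  | id a => exact .refl k fun w hw => by simpa [run, wires] using hw
  | comp e f he hf =>
    have h₁ := he n k
    have h₂ := hf (e.run n k).2.1 (e.run n k).2.2
    refine ⟨h₁.1.trans h₂.1, fun w hw => ?_⟩
    have h₃ := h₁.1
    have h₄ := h₂.1
    have h₁ := h₁.2 w
    have h₂ := h₂.2 w
    simp only [run, wires_append, List.mem_append] at hw h₁ h₂ ⊢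
    grind
  | tens e f he hf =>
    have h₁ := he n.1 k
    have h₂ := hf n.2 (e.run n.1 k).2.2
    refine ⟨h₁.1.trans h₂.1, fun w hw => ?_⟩
    have h₃ := h₁.1
    have h₄ := h₂.1
    have h₁ := h₁.2 w
    have h₂ := h₂.2 w
    simp only [run, wires_append, List.mem_append, Sh.flat] at hw h₁ h₂ ⊢
    grind
  | whL a e he =>
    have h₁ := he n.2 k
    refine ⟨h₁.1, fun w hw => ?_⟩
    have h₁ := h₁.2 w
    simp only [run, List.mem_append, Sh.flat] at hw h₁ ⊢
    grind
  | whR e a he =>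
    have h₁ := he n.1 k
    refine ⟨h₁.1, fun w hw => ?_⟩
    have h₁ := h₁.2 w
    simp only [run, List.mem_append, Sh.flat] at hw h₁ ⊢
    grind
  | _ =>
    refine ⟨by simp [run], fun w hw => ?_⟩
    simp [run, wires, Sh.flat, Box.ins, Box.outs, Tree.flat] at hw ⊢
    try grind

/-! ### Soundness of the translation of morphisms into nets. -/

section Sound

variable {S : Type u} [Category.{v} S] [MonoidalCategory S] [SymmetricCategory S]
variable {H : S} [HopfObj H] (D : Data H) (E : ℕ → Mod S H)

/-- The object of a shape. -/
@[reducible] def Sh.obj : Sh → S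
  | .one => 𝟙_ S
  | .H => H
  | .X i => (E i).X
  | .t l r => l.obj ⊗ r.obj

/-- Interpretation of the syntax. -/
def Ex.sem : {s t : Sh} → Ex s t → (s.obj E ⟶ t.obj E)
  | _, _, .id a => 𝟙 (a.obj E)
  | _, _, .comp e f => e.sem ≫ f.sem
  | _, _, .tens e f => e.sem ⊗ₘ f.sem
  | _, _, .whL a e => a.obj E ◁ e.sem
  | _, _, .whR e a => e.sem ▷ a.obj E
  | _, _, .al a b c => (α_ (a.obj E) (b.obj E) (c.obj E)).hom
  | _, _, .al' a b c => (α_ (a.obj E) (b.obj E) (c.obj E)).inv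
  | _, _, .lu a => (λ_ (a.obj E)).hom
  | _, _, .lu' a => (λ_ (a.obj E)).inv
  | _, _, .ru a => (ρ_ (a.obj E)).hom
  | _, _, .ru' a => (ρ_ (a.obj E)).inv
  | _, _, .br a b => (β_ (a.obj E) (b.obj E)).hom
  | _, _, .mul => μ[H]
  | _, _, .comul => Δ[H]
  | _, _, .pt p => D.pt p
  | _, _, .cov p => D.cov p
  | _, _, .en p => D.en p
  | _, _, .gam => D.gam
  | _, _, .ev => D.ev
  | _, _, .sc p => D.sc p
  | _, _, .act i => HopfExt.act (E i)
  | _, _, .omx i => D.om.app (E i).X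

/-- Removal of the brackets. -/
def Sh.flatIso : (s : Sh) → (n : s.Names) → (s.obj E ≅ listTensor (wob E) (s.flat n))
  | .one, _ => Iso.refl _
  | .H, _ => (ρ_ H).symm
  | .X i, _ => (ρ_ (E i).X).symm
  | .t l r, n => (l.flatIso n.1 ⊗ᵢ r.flatIso n.2) ≪≫ (appendIso (wob E) (l.flat n.1) (r.flat n.2)).symm

variable {D E}

section Iso

variable {A B C A' B' P Q R P' Q' T T' : S}

/-- Here and in the next lemmas the removal of brackets is replaced by arbitrary isomorphisms: only
naturality of the structure maps matters, and the terms stay small. -/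
theorem flat_tens (a : A ≅ P) (b : B ≅ Q) (c : T ≅ P ⊗ Q) (a' : A' ≅ P') (b' : B' ≅ Q')
    (c' : T' ≅ P' ⊗ Q') (x : A ⟶ A') (y : B ⟶ B') :
    ((a ⊗ᵢ b) ≪≫ c.symm).inv ≫ (x ⊗ₘ y) ≫ ((a' ⊗ᵢ b') ≪≫ c'.symm).hom =
      c.hom ≫ ((a.inv ≫ x ≫ a'.hom) ⊗ₘ (b.inv ≫ y ≫ b'.hom)) ≫ c'.inv := by
  simp

theorem flat_whL (a : A ≅ P) (b : B ≅ Q) (c : T ≅ P ⊗ Q) (b' : B' ≅ Q')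
    (c' : T' ≅ P ⊗ Q') (y : B ⟶ B') :
    ((a ⊗ᵢ b) ≪≫ c.symm).inv ≫ A ◁ y ≫ ((a ⊗ᵢ b') ≪≫ c'.symm).hom =
      c.hom ≫ (𝟙 P ⊗ₘ (b.inv ≫ y ≫ b'.hom)) ≫ c'.inv := by
  have := flat_tens a b c a b' c' (𝟙 A) y
  simpa using this

theorem flat_whR (a : A ≅ P) (b : B ≅ Q) (c : T ≅ P ⊗ Q) (a' : A' ≅ P')
    (c' : T' ≅ P' ⊗ Q) (x : A ⟶ A') :
    ((a ⊗ᵢ b) ≪≫ c.symm).inv ≫ x ▷ B ≫ ((a' ⊗ᵢ b) ≪≫ c'.symm).hom =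
      c.hom ≫ ((a.inv ≫ x ≫ a'.hom) ⊗ₘ 𝟙 Q) ≫ c'.inv := by
  have := flat_tens a b c a' b c' x (𝟙 B)
  simpa using this

theorem flat_close (a : A ≅ P) (b : B ≅ Q) (c : T ≅ P ⊗ Q) (a' : A ≅ P') (b' : B ≅ Q')
    (c' : T' ≅ P' ⊗ Q') :
    ((a ⊗ᵢ b) ≪≫ c.symm).inv ≫ ((a' ⊗ᵢ b') ≪≫ c'.symm).hom =
      c.hom ≫ ((a.inv ≫ a'.hom) ⊗ₘ (b.inv ≫ b'.hom)) ≫ c'.inv := by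
  simp

theorem flat_br (a : A ≅ P) (b : B ≅ Q) (c : T ≅ P ⊗ Q) (c' : T' ≅ Q ⊗ P) :
    ((a ⊗ᵢ b) ≪≫ c.symm).inv ≫ (β_ A B).hom ≫ ((b ⊗ᵢ a) ≪≫ c'.symm).hom =
      c.hom ≫ (β_ P Q).hom ≫ c'.inv := by
  simp

theorem flat_al {T₁ T₂ T₃ T₄ : S} (a : A ≅ P) (b : B ≅ Q) (c : C ≅ R) (i₁ : T₁ ≅ P ⊗ Q) (i₂ : T₂ ≅ T₁ ⊗ R)
    (i₃ : T₃ ≅ Q ⊗ R) (i₄ : T₄ ≅ P ⊗ T₃) :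
    ((((a ⊗ᵢ b) ≪≫ i₁.symm) ⊗ᵢ c) ≪≫ i₂.symm).inv ≫ (α_ A B C).hom ≫
      ((a ⊗ᵢ ((b ⊗ᵢ c) ≪≫ i₃.symm)) ≪≫ i₄.symm).hom =
      i₂.hom ≫ i₁.hom ▷ R ≫ (α_ P Q R).hom ≫ P ◁ i₃.inv ≫ i₄.inv := by
  have e₁ : ((((a ⊗ᵢ b) ≪≫ i₁.symm) ⊗ᵢ c) ≪≫ i₂.symm).inv =
      i₂.hom ≫ i₁.hom ▷ R ≫ ((a.inv ⊗ₘ b.inv) ⊗ₘ c.inv) := by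
    simp only [Iso.trans_inv, Iso.trans_hom, Iso.symm_inv, Iso.symm_hom, tensorIso_inv, tensorIso_hom, ← tensorHom_id, ← id_tensorHom, tensorHom_comp_tensorHom, tensorHom_comp_tensorHom_assoc, Category.comp_id, Category.id_comp, Category.assoc]
  have e₂ : ((a ⊗ᵢ ((b ⊗ᵢ c) ≪≫ i₃.symm)) ≪≫ i₄.symm).hom =
      (a.hom ⊗ₘ (b.hom ⊗ₘ c.hom)) ≫ P ◁ i₃.inv ≫ i₄.inv := by
    simp only [Iso.trans_inv, Iso.trans_hom, Iso.symm_inv, Iso.symm_hom, tensorIso_inv, tensorIso_hom, ← tensorHom_id, ← id_tensorHom, tensorHom_comp_tensorHom, tensorHom_comp_tensorHom_assoc, Category.comp_id, Category.id_comp, Category.assoc]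
  rw [e₁, e₂, Category.assoc, Category.assoc, associator_naturality_assoc]
  simp

theorem flat_al' {T₁ T₂ T₃ T₄ : S} (a : A ≅ P) (b : B ≅ Q) (c : C ≅ R) (i₁ : T₁ ≅ P ⊗ Q)
    (i₂ : T₂ ≅ T₁ ⊗ R) (i₃ : T₃ ≅ Q ⊗ R) (i₄ : T₄ ≅ P ⊗ T₃) :
    ((a ⊗ᵢ ((b ⊗ᵢ c) ≪≫ i₃.symm)) ≪≫ i₄.symm).inv ≫ (α_ A B C).inv ≫
      ((((a ⊗ᵢ b) ≪≫ i₁.symm) ⊗ᵢ c) ≪≫ i₂.symm).hom =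
      i₄.hom ≫ P ◁ i₃.hom ≫ (α_ P Q R).inv ≫ i₁.inv ▷ R ≫ i₂.inv := by
  have e₁ : ((((a ⊗ᵢ b) ≪≫ i₁.symm) ⊗ᵢ c) ≪≫ i₂.symm).hom =
      ((a.hom ⊗ₘ b.hom) ⊗ₘ c.hom) ≫ i₁.inv ▷ R ≫ i₂.inv := by
    simp only [Iso.trans_inv, Iso.trans_hom, Iso.symm_inv, Iso.symm_hom, tensorIso_inv, tensorIso_hom, ← tensorHom_id, ← id_tensorHom, tensorHom_comp_tensorHom, tensorHom_comp_tensorHom_assoc, Category.comp_id, Category.id_comp, Category.assoc]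
  have e₂ : ((a ⊗ᵢ ((b ⊗ᵢ c) ≪≫ i₃.symm)) ≪≫ i₄.symm).inv =
      i₄.hom ≫ P ◁ i₃.hom ≫ (a.inv ⊗ₘ (b.inv ⊗ₘ c.inv)) := by
    simp only [Iso.trans_inv, Iso.trans_hom, Iso.symm_inv, Iso.symm_hom, tensorIso_inv, tensorIso_hom, ← tensorHom_id, ← id_tensorHom, tensorHom_comp_tensorHom, tensorHom_comp_tensorHom_assoc, Category.comp_id, Category.id_comp, Category.assoc]
  rw [e₁, e₂, Category.assoc, Category.assoc, associator_inv_naturality_assoc]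
  simp

theorem flat_trans (a : A ≅ P) (x : A ⟶ B) (b : B ≅ Q) (c : B ≅ R) :
    a.inv ≫ x ≫ c.hom = (a.inv ≫ x ≫ b.hom) ≫ b.inv ≫ c.hom := by simp

theorem flat_cancel {a : A ≅ P} {x y : A ⟶ B} {b : B ≅ Q}
    (h : a.inv ≫ x ≫ b.hom = a.inv ≫ y ≫ b.hom) : x = y := by simpa using h

theorem flat_lu (a : A ≅ P) : ((Iso.refl (𝟙_ S) ⊗ᵢ a) ≪≫ (λ_ P).symm.symm).inv ≫ (λ_ A).hom ≫ a.hom = 𝟙 P := by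
  simp [MonoidalCategory.tensorHom_def]

theorem flat_lu' (a : A ≅ P) :
    a.inv ≫ (λ_ A).inv ≫ ((Iso.refl (𝟙_ S) ⊗ᵢ a) ≪≫ (λ_ P).symm.symm).hom = 𝟙 P := by
  simp [MonoidalCategory.tensorHom_def]

theorem flat_ru' (a : A ≅ P) (c : T ≅ P ⊗ 𝟙_ S) :
    a.inv ≫ (ρ_ A).inv ≫ ((a ⊗ᵢ Iso.refl (𝟙_ S)) ≪≫ c.symm).hom = (ρ_ P).inv ≫ c.inv := by
  simp [MonoidalCategory.tensorHom_def']

theorem flat_ru (a : A ≅ P) (c : T ≅ P ⊗ 𝟙_ S) :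
    ((a ⊗ᵢ Iso.refl (𝟙_ S)) ≪≫ c.symm).inv ≫ (ρ_ A).hom ≫ a.hom = c.hom ≫ (ρ_ P).hom := by
  simp [MonoidalCategory.tensorHom_def']

end Iso

theorem Den.single (b : Box) (hi : b.ins.Nodup) (ho : b.outs.Nodup) :
    Den D E b.outs [b] b.ins (b.mor D E) := by
  obtain ⟨k, hk, e, e'⟩ := (Can.rnil (ob := wob E) b.outs).exists_inv
  refine (Den.cons b [] hi (.rnil _) (.nil (by simpa using ho) hk)).of_eq ?_
  have hk : k = (appendIso (wob E) b.outs []).hom ≫ (ρ_ _).hom := by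
    rw [← cancel_epi ((ρ_ (listTensor (wob E) b.outs)).inv ≫ (appendIso (wob E) b.outs []).inv), e]
    simp
  subst hk
  simp only [HopfExt.frame, Category.assoc, Iso.inv_hom_id_assoc]
  change _ = _ ≫ _ ▷ 𝟙_ S ≫ _
  simp

/-- By the interchange law `N` runs first with `L'` carried along. Then the blocks are exchanged,
`N'` runs with `M` carried along, and the blocks are exchanged back. -/
theorem Den.tens {N N' : List Box} {L L' M M' : List Wire} {m m'} (h : Den D E M N L m)
    (h' : Den D E M' N' L' m') (d : ∀ w ∈ L', w ∉ L ∧ w ∉ wires N)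
    (d' : ∀ w ∈ M, w ∉ L' ∧ w ∉ wires N') :
    Den D E (M ++ M') (N ++ N') (L ++ L')
      ((appendIso (wob E) L L').hom ≫ (m ⊗ₘ m') ≫ (appendIso (wob E) M M').inv) := by
  have k₁ := h.frame h'.nodup d
  have k₂ := ((h'.frame h.nodup_out d').pre (.braid M L')).post (.braid M' M)
  refine (k₁.append k₂).of_eq ?_
  simp [HopfExt.frame, MonoidalCategory.tensorHom_def]

theorem Sh.close_wires (s : Sh) (n o : s.Names) :
    ∀ w ∈ wires (s.close n o), ∃ a, w = .h a ∧ (w ∈ s.flat n ∨ w ∈ s.flat o) := by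
  induction s with
  | one => simp [close, wires]
  | H => simp [close, wires, Box.ins, Box.outs, Tree.flat, Sh.flat]
  | X i => simp [close, wires]
  | t l r hl hr =>
    intro w hw
    simp only [close, wires_append, List.mem_append] at hw
    simp only [flat, List.mem_append]
    rcases hw with hw | hw
    · obtain ⟨a, rfl, h⟩ := hl _ _ w hw; exact ⟨a, rfl, by tauto⟩
    · obtain ⟨a, rfl, h⟩ := hr _ _ w hw; exact ⟨a, rfl, by tauto⟩

theorem Den.close (s : Sh) (n o : s.Names) (hn : (s.flat n).Nodup) (ho : (s.flat o).Nodup)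
    (h : ∀ a, Wire.h a ∈ s.flat o → Wire.h a ∉ s.flat n) :
    Den D E (s.flat o) (s.close n o) (s.flat n) ((s.flatIso E n).inv ≫ (s.flatIso E o).hom) := by
  induction s with
  | one => exact (Den.nil hn (.refl _)).of_eq (Category.id_comp (𝟙 (𝟙_ S)))
  | H =>
    exact (Den.single (.en .id n o) (by simp [Box.ins, Tree.flat]) (by simp [Box.outs, Tree.flat])).of_eq
      (by change (ρ_ H).hom ≫ (ρ_ H).inv = (ρ_ H).hom ≫ 𝟙 H ≫ (ρ_ H).inv; simp)
  | X i => exact (Den.nil hn (.refl _)).of_eq (Iso.hom_inv_id (ρ_ (E i).X))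
  | t l r hl hr =>
    simp only [Sh.flat, List.nodup_append, List.mem_append] at hn ho h
    have h₁ := hl n.1 o.1 hn.1 ho.1 fun a ha => fun h' => h a (.inl ha) (.inl h')
    have h₂ := hr n.2 o.2 hn.2.1 ho.2.1 fun a ha => fun h' => h a (.inr ha) (.inr h')
    refine (h₁.tens h₂ (fun w hw => ⟨fun h' => hn.2.2 w h' w hw rfl, fun h' => ?_⟩)
      (fun w hw => ⟨fun h' => ?_, fun h' => ?_⟩)).of_eq ?_
    · obtain ⟨a, rfl, h' | h'⟩ := Sh.close_wires _ _ _ w h'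
      · exact hn.2.2 _ h' _ hw rfl
      · exact h a (.inl h') (.inr hw)
    · cases w with
      | h a => exact h a (.inl hw) (.inr h')
      | x i =>
        have hx : ∀ (s : Sh) (n o : s.Names), Wire.x i ∈ s.flat n → Wire.x i ∈ s.flat o := by
          intro s
          induction s with
          | t l r hl hr =>
            intro n o h
            simp only [Sh.flat, List.mem_append] at h ⊢
            exact h.imp (hl _ _) (hr _ _)
          | _ => simp [Sh.flat]
        exact hn.2.2 _ (hx l _ _ hw) _ h' rfl
    · obtain ⟨a, rfl, h' | h'⟩ := Sh.close_wires _ _ _ w h'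
      · exact h a (.inl hw) (.inr h')
      · exact ho.2.2 _ hw _ h' rfl
    · exact flat_close ..

/-- By induction on the syntax. A structural isomorphism contributes no box and is accounted for by
`Den.nil`. The bound `k` on the names in use guarantees that new names are new. -/
theorem Ex.den {s t : Sh} (e : Ex s t) (n : s.Names) (k : ℕ) (hn : (s.flat n).Nodup)
    (hk : Below k (s.flat n)) :
    Den D E (t.flat (e.run n k).2.1) (e.run n k).1 (s.flat n)
      ((s.flatIso E n).inv ≫ e.sem D E ≫ (t.flatIso E (e.run n k).2.1).hom) := by
  induction e generalizing k with
  | id a => exact (Den.nil hn (.refl _)).of_eq (by simp [sem, run])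
  | comp e f he hf =>
    have h₁ := he n k hn hk
    have hb : Below (e.run n k).2.2 (Sh.flat _ (e.run n k).2.1) := fun a ha => by
      have := e.run_fresh n k
      rcases this.2 _ (List.mem_append_right _ ha) with h | ⟨b, hb, -, h⟩
      · exact (hk a h).trans_le this.1
      · cases hb; exact h
    exact (h₁.append (hf _ _ h₁.nodup_out hb)).of_eq (by simp [sem]; rfl)
  | tens e f he hf =>
    simp only [Sh.flat, List.nodup_append] at hn
    have h₁ := he n.1 k hn.1 fun a ha => hk a (List.mem_append_left _ ha)
    have f₁ := e.run_fresh n.1 k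
    have h₂ := hf n.2 (e.run n.1 k).2.2 hn.2.1 fun a ha =>
      (hk a (List.mem_append_right _ ha)).trans_le f₁.1
    have f₂ := f.run_fresh n.2 (e.run n.1 k).2.2
    refine (h₁.tens h₂ (fun w hw => ⟨fun h' => hn.2.2 w h' w hw rfl, fun h' => ?_⟩)
      (fun w hw => ?_)).of_eq ?_
    · rcases f₁.2 w (List.mem_append_left _ h') with h' | ⟨a, rfl, ha, -⟩
      · exact hn.2.2 w h' w hw rfl
      · have := hk a (List.mem_append_right _ hw); omega
    · rw [← not_or]
      intro h'
      have h' : w ∈ Sh.flat _ n.2 ∨ ∃ a, w = .h a ∧ (e.run n.1 k).2.2 ≤ a := by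
        rcases h' with h' | h'
        · exact .inl h'
        · exact (f₂.2 w (List.mem_append_left _ h')).imp_right fun ⟨a, h, h', _⟩ => ⟨a, h, h'⟩
      rcases f₁.2 w (List.mem_append_right _ hw) with hw | ⟨a, rfl, ha, ha'⟩
      · rcases h' with h' | ⟨a, rfl, ha⟩
        · exact hn.2.2 w hw w h' rfl
        · have := hk a (List.mem_append_left _ hw); have := f₁.1; omega
      · rcases h' with h' | ⟨b, hb, ha⟩
        · have := hk a (List.mem_append_right _ h'); omega
        · cases hb; omega
    · exact flat_tens ..
  | whL a e he =>
    simp only [Sh.flat, List.nodup_append] at hn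
    have h₁ := he n.2 k hn.2.1 fun a ha => hk a (List.mem_append_right _ ha)
    have f₁ := e.run_fresh n.2 k
    refine (Den.tens (Den.nil hn.1 (.refl _)) h₁ (fun w hw => ⟨fun h' => hn.2.2 w h' w hw rfl, by simp [wires]⟩)
      (fun w hw => ⟨fun h' => hn.2.2 w hw w h' rfl, fun h' => ?_⟩)).of_eq ?_
    · rcases f₁.2 w (List.mem_append_left _ h') with h' | ⟨a, rfl, ha, -⟩
      · exact hn.2.2 w hw w h' rfl
      · have := hk a (List.mem_append_left _ hw); omega
    · exact flat_whL ..
  | whR e a he =>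
    simp only [Sh.flat, List.nodup_append] at hn
    have h₁ := he n.1 k hn.1 fun a ha => hk a (List.mem_append_left _ ha)
    have f₁ := e.run_fresh n.1 k
    refine (List.append_nil (e.run n.1 k).1 ▸ Den.tens h₁ (Den.nil hn.2.1 (.refl _))
      (fun w hw => ⟨fun h' => hn.2.2 w h' w hw rfl, fun h' => ?_⟩)
      (fun w hw => ⟨fun h' => ?_, by simp [wires]⟩)).of_eq ?_
    · rcases f₁.2 w (List.mem_append_left _ h') with h' | ⟨a, rfl, ha, -⟩
      · exact hn.2.2 w h' w hw rfl
      · have := hk a (List.mem_append_right _ hw); omega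
    · rcases f₁.2 w (List.mem_append_right _ hw) with hw | ⟨a, rfl, ha, -⟩
      · exact hn.2.2 w hw w h' rfl
      · have := hk a (List.mem_append_right _ h'); omega
    · exact flat_whR ..
  | al a b c => exact (Den.nil hn (.assocHom _ _ _)).of_eq (flat_al ..)
  | al' a b c => exact (Den.nil hn (.assocInv _ _ _)).of_eq (flat_al' ..)
  | lu a => exact (Den.nil hn (.refl _)).of_eq (flat_lu _)
  | lu' a => exact (Den.nil hn (.refl _)).of_eq (flat_lu' _)
  | ru a =>
    obtain ⟨q, hq, e, -⟩ := (Can.rnil (ob := wob E) (a.flat n.1)).exists_inv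
    have hq' : q = (appendIso (wob E) (a.flat n.1) []).hom ≫ (ρ_ _).hom := by
      rw [← cancel_epi ((ρ_ (listTensor (wob E) (a.flat n.1))).inv ≫
        (appendIso (wob E) (a.flat n.1) []).inv), e]
      simp
    exact (Den.nil hn hq).of_eq ((flat_ru ..).trans hq'.symm)
  | ru' a => exact (Den.nil hn (.rnil _)).of_eq (flat_ru' ..)
  | br a b => exact (Den.nil hn (.braid _ _)).of_eq (flat_br ..)
  | mul => exact .single (.mul n.1 n.2 k) hn (List.nodup_singleton _)
  | comul => exact .single (.comul n k (k + 1)) hn (by simp [Box.outs, Tree.flat])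
  | pt p => exact .single (.pt p k) hn (List.nodup_singleton _)
  | cov p => exact .single (.cov p n) hn List.nodup_nil
  | en p => exact .single (.en p n k) hn (List.nodup_singleton _)
  | gam => exact .single (.gam k (k + 1)) hn (by simp [Box.outs, Tree.flat])
  | ev => exact .single (.ev n.1 n.2) hn List.nodup_nil
  | sc p => exact .single (.sc p) hn List.nodup_nil
  | act i => exact .single (.act n.1 i) hn (List.nodup_singleton _)
  | omx i => exact .single (.omx i) hn (List.nodup_singleton _)

/-- Are the wires of the net of a morphism distinct? -/
def Ex.ok {s t : Sh} (e : Ex s t) : Bool := distinct e.ins && distinct e.outs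

theorem Ex.den_net {s t : Sh} (e : Ex s t) (h : e.ok = true) :
    Den D E e.outs e.net e.ins
      ((s.flatIso E (s.init (t.init 0).2).1).inv ≫ e.sem D E ≫
        (t.flatIso E (t.init 0).1).hom) := by
  rw [ok, Bool.and_eq_true, distinct_iff, distinct_iff] at h
  have i₁ := t.init_spec 0
  have i₂ := s.init_spec (t.init 0).2
  have h₁ := e.den (D := D) (E := E) (s.init (t.init 0).2).1 (s.init (t.init 0).2).2 h.1
    fun a ha => (i₂.2 a ha).2
  -- The names reserved for the outputs are smaller than all names produced by `run`, so the closing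
  -- identity boxes cause no clash.
  refine Den.tidy _ ((h₁.append (Den.close t _ (t.init 0).1 h₁.nodup_out h.2 fun a ha ha' => ?_)).of_eq ?_)
  · have := i₁.2 a ha
    rcases (e.run_fresh _ _).2 _ (List.mem_append_right _ ha') with h | ⟨b, hb, h, -⟩
    · have := i₂.2 a h; omega
    · cases hb; have := i₂.1; omega
  · exact flat_trans ..

/-- An equation between morphisms yields a rule. -/
theorem Valid.of_sem {s t : Sh} {e e' : Ex s t} {r : Rule} (h : ∀ E, e.sem D E = e'.sem D E)
    (hr : (decide (e.rule e' = r) && e.ok) = true := by decide +kernel) : Valid D r := by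
  rw [Bool.and_eq_true, decide_eq_true_eq] at hr
  obtain ⟨rfl, hr⟩ := hr
  exact ⟨fun E => ⟨_, e.den_net hr, (h E) ▸ e'.den_net hr⟩⟩

/-- A valid equation between nets yields an equation between morphisms. -/
theorem Ex.sem_eq (D : Data H) (E : ℕ → Mod S H) {s t : Sh} (e e' : Ex s t) (hv : Valid D (e.rule e'))
    (h : e.ok = true := by decide +kernel) :
    e.sem D E = e'.sem D E := by
  obtain ⟨m, h₁, h₂⟩ := hv.out E
  have k₁ := h₁.unique (e.den_net h)
  have k₂ := h₂.unique (e'.den_net h)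
  exact flat_cancel (k₁.symm.trans k₂)

end Sound
end HopfExt

namespace HopfExt

/-! ### Syntax of the basic morphisms -/

namespace Ex

infixr:80 " ⨟ " => Ex.comp

/-- Left multiplication by a point. -/
def lmulE (p : Pt) : Ex .H .H := .lu' .H ⨟ .whR (.pt p) .H ⨟ .mul

/-- Right multiplication by a point. -/
def rmulE (p : Pt) : Ex .H .H := .ru' .H ⨟ .whL .H (.pt p) ⨟ .mul

/-- The product of points. -/
def pmulE (p q : Pt) : Ex .one .H := .lu' .one ⨟ .tens (.pt p) (.pt q) ⨟ .mul

/-- Exchange of the two middle factors. -/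
def tensorMu (a b c d : Sh) : Ex (.t (.t a b) (.t c d)) (.t (.t a c) (.t b d)) :=
  .al a b (.t c d) ⨟ .whL a (.al' b c d) ⨟ .whL a (.whR (.br b c) d) ⨟ .whL a (.al c b d) ⨟
    .al' a c (.t b d)

/-- The morphism `fourier`. -/
def fourierE : Ex .H .H :=
  .lu' .H ⨟ .whR .gam .H ⨟ .al .H .H .H ⨟ .tens (.en .S) (.mul ⨟ .cov .lam) ⨟ .ru .H

end Ex

/-! ### The hypotheses of the theorem as laws for the boxes. -/

section Laws

variable {S : Type u} [Category.{v} S] [MonoidalCategory S] [SymmetricCategory S]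
variable {H : S} [HopfObj H]

/-- The laws for the boxes. -/
class Data.Lawful (D : Data H) : Prop where
  g_inv : IsInvPt D.g D.gi
  s_inv : IsInvPt D.s D.si
  S_Si : 𝒮[H] ≫ D.Si = 𝟙 H
  Si_S : D.Si ≫ 𝒮[H] = 𝟙 H
  bet_beti : D.bet ≫ D.beti = 𝟙 (𝟙_ S)
  om_monoidal : NatTrans.IsMonoidal D.om
  om_om : D.om ≫ D.om = 𝟙 (𝟭 S)
  gam_hopf : IsHopfCopairing D.gam
  gam_ev : H ◁ D.gam ≫ (α_ H H H).inv ≫ D.ev ▷ H = (ρ_ H).hom ≫ (λ_ H).inv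
  lam_coint : IsRightCointegral D.lam
  lam_g : Δ[H] ≫ H ◁ D.lam ≫ (ρ_ H).hom = D.lam ≫ D.g
  lam_norm : D.gam ≫ H ◁ 𝒮[H] ≫ (D.lam ⊗ₘ D.lam) ≫ (λ_ (𝟙_ S)).hom = 𝟙 (𝟙_ S)
  gam_symm : D.gam ≫ (β_ H H).hom = D.gam ≫ H ◁ (conjPt D.gi D.g ≫ 𝒮[H] ≫ 𝒮[H])
  gam_s : D.gam = D.s ≫ Δ[H] ≫ (lmul D.si ⊗ₘ rmul D.si)
  lam_S : 𝒮[H] ≫ D.lam = conjPt D.s D.si ≫ D.lam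
  lam_s : D.s ≫ D.lam = D.bet ≫ D.bet
  s_cop : IsHopfIsoToCop (conjPt D.s D.si)
  S_s : D.s ≫ 𝒮[H] = D.s ≫ lmul D.g
  s_g : D.s ≫ lmul D.g = D.s ≫ rmul D.gi
  om_gam : D.gam ≫ H ◁ D.om.app H =
    D.gam ≫ (conjPt D.s D.si ⊗ₘ (𝒮[H] ≫ conjPt D.si D.s))

namespace Data

variable (D : Data H) [hD : D.Lawful]

theorem om_tensor (X Y : S) : D.om.app (X ⊗ Y) = D.om.app X ⊗ₘ D.om.app Y := by
  have := hD.om_monoidal.tensor X Y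
  simpa using this

theorem om_unit : D.om.app (𝟙_ S) = 𝟙 (𝟙_ S) := by
  have := hD.om_monoidal.unit
  simpa using this

theorem om_app_om_app (X : S) : D.om.app X ≫ D.om.app X = 𝟙 X := by
  rw [← NatTrans.comp_app, hD.om_om]
  rfl

theorem om_nat {X Y : S} (f : X ⟶ Y) : f ≫ D.om.app Y = D.om.app X ≫ f := D.om.naturality f

/-- Naturality along `f`, together with triviality of a monoidal transformation on the unit object.
-/
theorem pt_om (f : 𝟙_ S ⟶ H) : f ≫ D.om.app H = f := by
  exact (D.om_nat f).trans ((congrArg (· ≫ f) D.om_unit).trans (Category.id_comp f))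

theorem om_cov (f : H ⟶ 𝟙_ S) : D.om.app H ≫ f = f := by
  exact (D.om_nat f).symm.trans ((congrArg (f ≫ ·) D.om_unit).trans (Category.comp_id f))

end Data

end Laws

/-! ### The basic rules -/

def mulAssoc : Rule := ⟨[.h 1, .h 2, .h 3], [.h 0], [.mul 1 2 4, .mul 4 3 0], [.mul 2 3 4, .mul 1
    4 0]⟩

def oneMul : Rule := ⟨[.h 1], [.h 0], [.pt .one 2, .mul 2 1 0], [.en .id 1 0]⟩

def mulOne : Rule := ⟨[.h 1], [.h 0], [.pt .one 2, .mul 1 2 0], [.en .id 1 0]⟩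

def comulAssoc : Rule := ⟨[.h 3], [.h 0, .h 1, .h 2], [.comul 3 4 2, .comul 4 0 1], [.comul 3 0 5,
    .comul 5 1 2]⟩

def counitComul : Rule := ⟨[.h 1], [.h 0], [.comul 1 2 0, .cov .eps 2], [.en .id 1 0]⟩

def comulCounit : Rule := ⟨[.h 1], [.h 0], [.comul 1 0 3, .cov .eps 3], [.en .id 1 0]⟩

def mulComul : Rule := ⟨[.h 2, .h 3], [.h 0, .h 1], [.mul 2 3 4, .comul 4 0 1], [.comul 2 4 5,
    .comul 3 6 7, .mul 4 6 0, .mul 5 7 1]⟩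

def oneComul : Rule := ⟨[], [.h 0, .h 1], [.pt .one 2, .comul 2 0 1], [.pt .one 0, .pt .one 1]⟩

def mulCounit : Rule := ⟨[.h 0, .h 1], [], [.mul 0 1 2, .cov .eps 2], [.cov .eps 0, .cov .eps 1]⟩

def oneCounit : Rule := ⟨[], [], [.pt .one 0, .cov .eps 0], []⟩

def antipodeLeft : Rule := ⟨[.h 1], [.h 0], [.comul 1 2 3, .en .S 2 4, .mul 4 3 0], [.cov .eps 1,
    .pt .one 0]⟩

def antipodeRight : Rule := ⟨[.h 1], [.h 0], [.comul 1 2 3, .en .S 3 4, .mul 2 4 0], [.cov .eps 1,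
    .pt .one 0]⟩

def mulS : Rule := ⟨[.h 1, .h 2], [.h 0], [.mul 1 2 3, .en .S 3 0], [.en .S 1 3, .en .S 2 4, .mul
    4 3 0]⟩

def comulS : Rule := ⟨[.h 2], [.h 0, .h 1], [.en .S 2 3, .comul 3 0 1], [.comul 2 3 4, .en .S 4 0,
    .en .S 3 1]⟩

def oneS : Rule := ⟨[], [.h 0], [.pt .one 1, .en .S 1 0], [.pt .one 0]⟩

def counitS : Rule := ⟨[.h 0], [], [.en .S 0 1, .cov .eps 1], [.cov .eps 0]⟩

def actMul : Rule := ⟨[.h 0, .h 1, .x 0], [.x 0], [.mul 0 1 2, .act 2 0], [.act 1 0, .act 0 0]⟩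

def actOne : Rule := ⟨[.x 0], [.x 0], [.pt .one 0, .act 0 0], []⟩

def SSi : Rule := ⟨[.h 1], [.h 0], [.en .S 1 2, .en .Si 2 0], [.en .id 1 0]⟩

def SiS : Rule := ⟨[.h 1], [.h 0], [.en .Si 1 2, .en .S 2 0], [.en .id 1 0]⟩

def gMulGi : Rule := ⟨[], [.h 0], [.pt .g 1, .pt .gi 2, .mul 1 2 0], [.pt .one 0]⟩

def giMulG : Rule := ⟨[], [.h 0], [.pt .gi 1, .pt .g 2, .mul 1 2 0], [.pt .one 0]⟩

def sMulSi : Rule := ⟨[], [.h 0], [.pt .s 1, .pt .si 2, .mul 1 2 0], [.pt .one 0]⟩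

def siMulS : Rule := ⟨[], [.h 0], [.pt .si 1, .pt .s 2, .mul 1 2 0], [.pt .one 0]⟩

def betBeti : Rule := ⟨[], [], [.sc true, .sc false], []⟩

def gamComulLeft : Rule := ⟨[], [.h 0, .h 1, .h 2], [.gam 3 2, .comul 3 0 1], [.gam 0 4, .gam 1 6,
    .mul 4 6 2]⟩

def gamComulRight : Rule := ⟨[], [.h 0, .h 1, .h 2], [.gam 0 4, .comul 4 1 2], [.gam 3 1, .gam 5
    2, .mul 3 5 0]⟩

def gamCounitLeft : Rule := ⟨[], [.h 0], [.gam 1 0, .cov .eps 1], [.pt .one 0]⟩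

def gamCounitRight : Rule := ⟨[], [.h 0], [.gam 0 2, .cov .eps 2], [.pt .one 0]⟩

def gamEv : Rule := ⟨[.h 1], [.h 0], [.gam 2 0, .ev 1 2], [.en .id 1 0]⟩

def comulLam : Rule := ⟨[.h 1], [.h 0], [.comul 1 2 0, .cov .lam 2], [.cov .lam 1, .pt .one 0]⟩

def comulLamG : Rule := ⟨[.h 1], [.h 0], [.comul 1 0 3, .cov .lam 3], [.cov .lam 1, .pt .g 0]⟩

def lamNorm : Rule := ⟨[], [], [.gam 0 1, .en .S 1 2, .cov .lam 0, .cov .lam 2], []⟩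

def gamSymm : Rule := ⟨[], [.h 0, .h 1], [.gam 1 0], [.gam 0 3, .pt .gi 4, .mul 4 3 5, .pt .g 6,
    .mul 5 6 7, .en .S 7 8, .en .S 8 1]⟩

def gamEqS : Rule := ⟨[], [.h 0, .h 1], [.gam 0 1], [.pt .s 2, .comul 2 3 4, .pt .si 5, .mul 5 3
    0, .pt .si 7, .mul 4 7 1]⟩

def lamS : Rule := ⟨[.h 0], [], [.en .S 0 1, .cov .lam 1], [.en .f 0 1, .cov .lam 1]⟩

def lamPtS : Rule := ⟨[], [], [.pt .s 0, .cov .lam 0], [.sc true, .sc true]⟩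

def fEq : Rule := ⟨[.h 1], [.h 0], [.en .f 1 0], [.pt .s 2, .mul 2 1 3, .pt .si 4, .mul 3 4 0]⟩

def fiEq : Rule := ⟨[.h 1], [.h 0], [.en .fi 1 0], [.pt .si 2, .mul 2 1 3, .pt .s 4, .mul 3 4 0]⟩

def counitF : Rule := ⟨[.h 0], [], [.en .f 0 1, .cov .eps 1], [.cov .eps 0]⟩

def comulF : Rule := ⟨[.h 2], [.h 0, .h 1], [.en .f 2 3, .comul 3 1 0], [.comul 2 3 4, .en .f 3 0,
    .en .f 4 1]⟩

def antipodeS : Rule := ⟨[], [.h 0], [.pt .s 1, .en .S 1 0], [.pt .s 1, .pt .g 2, .mul 2 1 0]⟩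

def gMulS : Rule := ⟨[], [.h 0], [.pt .s 1, .pt .g 2, .mul 2 1 0], [.pt .s 1, .pt .gi 2, .mul 1 2
    0]⟩

def gamOm : Rule := ⟨[], [.h 0, .h 1], [.gam 0 3, .en .om 3 1], [.gam 2 3, .en .f 2 0, .en .S 3 5,
    .en .fi 5 1]⟩

def fourierEq : Rule := ⟨[.h 1], [.h 0], [.en .F 1 0], [.gam 2 3, .en .S 2 0, .mul 3 1 5, .cov
    .lam 5]⟩

def omOm : Rule := ⟨[.h 1], [.h 0], [.en .om 1 2, .en .om 2 0], [.en .id 1 0]⟩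

def omxOmx : Rule := ⟨[.x 0], [.x 0], [.omx 0, .omx 0], []⟩

def mulOm : Rule := ⟨[.h 1, .h 2], [.h 0], [.mul 1 2 3, .en .om 3 0], [.en .om 1 3, .en .om 2 4,
    .mul 3 4 0]⟩

def gamOmOm : Rule := ⟨[], [.h 0, .h 1], [.gam 2 3, .en .om 2 0, .en .om 3 1], [.gam 0 1]⟩

def SOm : Rule := ⟨[.h 1], [.h 0], [.en .S 1 2, .en .om 2 0], [.en .om 1 2, .en .S 2 0]⟩

def SiOm : Rule := ⟨[.h 1], [.h 0], [.en .Si 1 2, .en .om 2 0], [.en .om 1 2, .en .Si 2 0]⟩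

def actOm : Rule := ⟨[.h 0, .x 0], [.x 0], [.act 0 0, .omx 0], [.en .om 0 1, .omx 0, .act 1 0]⟩

def gOm : Rule := ⟨[], [.h 0], [.pt .g 1, .en .om 1 0], [.pt .g 0]⟩

def giOm : Rule := ⟨[], [.h 0], [.pt .gi 1, .en .om 1 0], [.pt .gi 0]⟩

def sOm : Rule := ⟨[], [.h 0], [.pt .s 1, .en .om 1 0], [.pt .s 0]⟩

def siOm : Rule := ⟨[], [.h 0], [.pt .si 1, .en .om 1 0], [.pt .si 0]⟩

def omLam : Rule := ⟨[.h 0], [], [.en .om 0 1, .cov .lam 1], [.cov .lam 0]⟩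

/-! ### Validity of the basic rules. -/

section Valid

variable {S : Type u} [Category.{v} S] [MonoidalCategory S] [SymmetricCategory S]
variable {H : S} [HopfObj H] (D : Data H) [hD : D.Lawful]

instance : Valid D mulAssoc := .of_sem (e := .whR .mul .H ⨟ .mul)
    (e' := .al .H .H .H ⨟ .whL .H .mul ⨟ .mul) (fun _ => MonObj.mul_assoc H)

instance : Valid D oneMul := .of_sem (e := .whR (.pt .one) .H ⨟ .mul)
    (e' := .lu .H) (fun _ => MonObj.one_mul H)

instance : Valid D mulOne := .of_sem (e := .whL .H (.pt .one) ⨟ .mul)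
    (e' := .ru .H) (fun _ => MonObj.mul_one H)

instance : Valid D comulAssoc := .of_sem (e := .comul ⨟ .whR .comul .H ⨟ .al .H .H .H)
    (e' := .comul ⨟ .whL .H .comul) (fun _ => (ComonObj.comul_assoc H).symm)

instance : Valid D counitComul := .of_sem (e := .comul ⨟ .whR (.cov .eps) .H)
    (e' := .lu' .H) (fun _ => ComonObj.counit_comul H)

instance : Valid D comulCounit := .of_sem (e := .comul ⨟ .whL .H (.cov .eps))
    (e' := .ru' .H) (fun _ => ComonObj.comul_counit H)

instance : Valid D mulComul := .of_sem (e := .mul ⨟ .comul)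
    (e' := .tens .comul .comul ⨟ .tensorMu .H .H .H .H ⨟ .tens .mul .mul) (fun _ => BimonObj.mul_comul H)

instance : Valid D oneComul := .of_sem (e := .pt .one ⨟ .comul)
    (e' := .lu' .one ⨟ .tens (.pt .one) (.pt .one)) (fun _ => BimonObj.one_comul H)

instance : Valid D mulCounit := .of_sem (e := .mul ⨟ .cov .eps)
    (e' := .tens (.cov .eps) (.cov .eps) ⨟ .lu .one) (fun _ => BimonObj.mul_counit H)

instance : Valid D oneCounit := .of_sem (e := .pt .one ⨟ .cov .eps)
    (e' := .id .one) (fun _ => BimonObj.one_counit H)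

instance : Valid D antipodeLeft := .of_sem (e := .comul ⨟ .whR (.en .S) .H ⨟ .mul)
    (e' := .cov .eps ⨟ .pt .one) (fun _ => HopfObj.antipode_left H)

instance : Valid D antipodeRight := .of_sem (e := .comul ⨟ .whL .H (.en .S) ⨟ .mul)
    (e' := .cov .eps ⨟ .pt .one) (fun _ => HopfObj.antipode_right H)

instance : Valid D mulS := .of_sem (e := .mul ⨟ .en .S)
    (e' := .tens (.en .S) (.en .S) ⨟ .br .H .H ⨟ .mul) (fun _ => HopfObj.mul_antipode H)

instance : Valid D comulS := .of_sem (e := .en .S ⨟ .comul)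
    (e' := .comul ⨟ .br .H .H ⨟ .tens (.en .S) (.en .S)) (fun _ => HopfObj.antipode_comul H)

instance : Valid D oneS := .of_sem (e := .pt .one ⨟ .en .S)
    (e' := .pt .one) (fun _ => HopfObj.one_antipode H)

instance : Valid D counitS := .of_sem (e := .en .S ⨟ .cov .eps)
    (e' := .cov .eps) (fun _ => HopfObj.antipode_counit H)

instance : Valid D actMul := .of_sem (e := .whR .mul (.X 0) ⨟ .act 0)
    (e' := .al .H .H (.X 0) ⨟ .whL .H (.act 0) ⨟ .act 0) (fun E => ModObj.mul_smul_self (M := H) (E 0).X)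

instance : Valid D actOne := .of_sem (e := .whR (.pt .one) (.X 0) ⨟ .act 0)
    (e' := .lu (.X 0)) (fun E => ModObj.one_smul_self (M := H) (E 0).X)

instance : Valid D SSi := .of_sem (e := .en .S ⨟ .en .Si)
    (e' := .id .H) (fun _ => hD.S_Si)

instance : Valid D SiS := .of_sem (e := .en .Si ⨟ .en .S)
    (e' := .id .H) (fun _ => hD.Si_S)

instance : Valid D gMulGi := .of_sem (e := .pmulE .g .gi)
    (e' := .pt .one) (fun _ => hD.g_inv.mul_inv)

instance : Valid D giMulG := .of_sem (e := .pmulE .gi .g)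
    (e' := .pt .one) (fun _ => hD.g_inv.inv_mul)

instance : Valid D sMulSi := .of_sem (e := .pmulE .s .si)
    (e' := .pt .one) (fun _ => hD.s_inv.mul_inv)

instance : Valid D siMulS := .of_sem (e := .pmulE .si .s)
    (e' := .pt .one) (fun _ => hD.s_inv.inv_mul)

instance : Valid D betBeti := .of_sem (e := .sc true ⨟ .sc false)
    (e' := .id .one) (fun _ => hD.bet_beti)

instance : Valid D gamComulLeft := .of_sem (e := .gam ⨟ .whR .comul .H)
    (e' := .lu' .one ⨟ .tens .gam .gam ⨟ .tensorMu .H .H .H .H ⨟ .whL (.t .H .H) .mul) (fun _ => hD.gam_hopf.comul_left)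

instance : Valid D gamComulRight := .of_sem (e := .gam ⨟ .whL .H .comul)
    (e' := .lu' .one ⨟ .tens .gam .gam ⨟ .tensorMu .H .H .H .H ⨟ .whR .mul (.t .H .H)) (fun _ => hD.gam_hopf.comul_right)

instance : Valid D gamCounitLeft := .of_sem (e := .gam ⨟ .whR (.cov .eps) .H ⨟ .lu .H)
    (e' := .pt .one) (fun _ => hD.gam_hopf.counit_left)

instance : Valid D gamCounitRight := .of_sem (e := .gam ⨟ .whL .H (.cov .eps) ⨟ .ru .H)
    (e' := .pt .one) (fun _ => hD.gam_hopf.counit_right)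

instance : Valid D gamEv := .of_sem (e := .whL .H .gam ⨟ .al' .H .H .H ⨟ .whR .ev .H)
    (e' := .ru .H ⨟ .lu' .H) (fun _ => hD.gam_ev)

instance : Valid D comulLam := .of_sem (e := .comul ⨟ .whR (.cov .lam) .H ⨟ .lu .H)
    (e' := .cov .lam ⨟ .pt .one) (fun _ => hD.lam_coint)

instance : Valid D comulLamG := .of_sem (e := .comul ⨟ .whL .H (.cov .lam) ⨟ .ru .H)
    (e' := .cov .lam ⨟ .pt .g) (fun _ => hD.lam_g)

instance : Valid D lamNorm := .of_sem (e := .gam ⨟ .whL .H (.en .S) ⨟ .tens (.cov .lam) (.cov .lam) ⨟ .lu .one)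
    (e' := .id .one) (fun _ => hD.lam_norm)

instance : Valid D gamSymm := .of_sem (e := .gam ⨟ .br .H .H)
    (e' := .gam ⨟ .whL .H ((.lmulE .gi ⨟ .rmulE .g) ⨟ .en .S ⨟ .en .S)) (fun _ => hD.gam_symm)

instance : Valid D gamEqS := .of_sem (e := .gam)
    (e' := .pt .s ⨟ .comul ⨟ .tens (.lmulE .si) (.rmulE .si)) (fun _ => hD.gam_s)

instance : Valid D lamS := .of_sem (e := .en .S ⨟ .cov .lam)
    (e' := .en .f ⨟ .cov .lam) (fun _ => hD.lam_S)

instance : Valid D lamPtS := .of_sem (e := .pt .s ⨟ .cov .lam)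
    (e' := .sc true ⨟ .sc true) (fun _ => hD.lam_s)

instance : Valid D fEq := .of_sem (e := .en .f)
    (e' := .lmulE .s ⨟ .rmulE .si) (fun _ => rfl)

instance : Valid D fiEq := .of_sem (e := .en .fi)
    (e' := .lmulE .si ⨟ .rmulE .s) (fun _ => rfl)

instance : Valid D counitF := .of_sem (e := .en .f ⨟ .cov .eps)
    (e' := .cov .eps) (fun _ => hD.s_cop.counit)

instance : Valid D comulF := .of_sem (e := .en .f ⨟ .comul ⨟ .br .H .H)
    (e' := .comul ⨟ .tens (.en .f) (.en .f)) (fun _ => hD.s_cop.comul)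

instance : Valid D antipodeS := .of_sem (e := .pt .s ⨟ .en .S)
    (e' := .pt .s ⨟ .lmulE .g) (fun _ => hD.S_s)

instance : Valid D gMulS := .of_sem (e := .pt .s ⨟ .lmulE .g)
    (e' := .pt .s ⨟ .rmulE .gi) (fun _ => hD.s_g)

instance : Valid D gamOm := .of_sem (e := .gam ⨟ .whL .H (.en .om))
    (e' := .gam ⨟ .tens (.en .f) (.en .S ⨟ .en .fi)) (fun _ => hD.om_gam)

instance : Valid D fourierEq := .of_sem (e := .en .F)
    (e' := .fourierE) (fun _ => rfl)

instance : Valid D omOm := .of_sem (e := .en .om ⨟ .en .om)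
    (e' := .id .H) (fun _ => D.om_app_om_app H)

instance : Valid D omxOmx := .of_sem (e := .omx 0 ⨟ .omx 0)
    (e' := .id (.X 0)) (fun E => D.om_app_om_app (E 0).X)

instance : Valid D mulOm := .of_sem (e := .mul ⨟ .en .om)
    (e' := .tens (.en .om) (.en .om) ⨟ .mul) (fun _ => (D.om_nat μ[H]).trans (by rw [D.om_tensor]; rfl))

instance : Valid D gamOmOm := .of_sem (e := .gam ⨟ .tens (.en .om) (.en .om))
    (e' := .gam) (fun _ => by
    change D.gam ≫ (D.om.app H ⊗ₘ D.om.app H) = D.gam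
    rw [← D.om_tensor]
    exact (D.om_nat D.gam).trans
      ((congrArg (· ≫ D.gam) D.om_unit).trans (Category.id_comp D.gam)))

instance : Valid D SOm := .of_sem (e := .en .S ⨟ .en .om)
    (e' := .en .om ⨟ .en .S) (fun _ => D.om_nat 𝒮[H])

instance : Valid D SiOm := .of_sem (e := .en .Si ⨟ .en .om)
    (e' := .en .om ⨟ .en .Si) (fun _ => D.om_nat D.Si)

instance : Valid D actOm := .of_sem (e := .act 0 ⨟ .omx 0)
    (e' := .tens (.en .om) (.omx 0) ⨟ .act 0) (fun E => (D.om_nat (act (E 0))).trans (by rw [D.om_tensor]; rfl))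

instance : Valid D gOm := .of_sem (e := .pt .g ⨟ .en .om)
    (e' := .pt .g) (fun _ => D.pt_om D.g)

instance : Valid D giOm := .of_sem (e := .pt .gi ⨟ .en .om)
    (e' := .pt .gi) (fun _ => D.pt_om D.gi)

instance : Valid D sOm := .of_sem (e := .pt .s ⨟ .en .om)
    (e' := .pt .s) (fun _ => D.pt_om D.s)

instance : Valid D siOm := .of_sem (e := .pt .si ⨟ .en .om)
    (e' := .pt .si) (fun _ => D.pt_om D.si)

instance : Valid D omLam := .of_sem (e := .en .om ⨟ .cov .lam)
    (e' := .cov .lam) (fun _ => D.om_cov D.lam)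

end Valid
end HopfExt

namespace HopfExt

section

variable {S : Type u} [Category.{v} S] [MonoidalCategory S] [SymmetricCategory S]
variable {H : S} [HopfObj H] (D : Data H) [D.Lawful]

/-! ### Derived rules

Each rule is an equation between two diagrams; the steps rewrite both sides to a common diagram.
In the names, `comul`, `counit`, `antipode`, `antipodeInv` are the structure maps and the inverse
antipode, `gam`, `lam`, `fourier` are `γ`, `λ` and `h ↦ S(γ') λ(γ'' h)`, `s`, `si`, `g`, `gi` are
`σ`, `g` and their inverses, `conj`, `conjInv` (also `F`, `Fi` at the end of a name) are `Ad_σ` and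
its inverse. A final `Mul`, `K`, `L` stands for a version with further factors on the right. -/

/-! ### The inverse antipode, and cancellation of inverse pairs. -/

def oneSi : Rule := ⟨[], [.h 0], [.pt .one 1, .en .Si 1 0], [.pt .one 0]⟩

instance : Valid D oneSi := .prove [.wr oneS 0, .rw SSi 0] []

def counitSi : Rule := ⟨[.h 0], [], [.en .Si 0 1, .cov .eps 1], [.cov .eps 0]⟩

instance : Valid D counitSi := .prove [.wr counitS 0, .rw SiS 0] []

def mulSi : Rule := ⟨[.h 1, .h 2], [.h 0], [.mul 1 2 3, .en .Si 3 0], [.en .Si 2 3, .en .Si 1 4,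
  .mul 3 4 0]⟩

instance : Valid D mulSi := .prove [] [.ins SSi 0, .rw mulS 0, .rw SiS 0, .rw SiS 0]

def comulSi : Rule := ⟨[.h 2], [.h 0, .h 1], [.en .Si 2 3, .comul 3 0 1], [.comul 2 3 4, .en .Si 4
  0, .en .Si 3 1]⟩

instance : Valid D comulSi := .prove [.ins SSi 0, .ins SSi 1] [.ins SiS 2, .rw comulS 0]

def antipodeInvLeft : Rule := ⟨[.h 1], [.h 0], [.comul 1 2 3, .en .Si 3 4, .mul 4 2 0], [.cov .eps
  1, .pt .one 0]⟩

instance : Valid D antipodeInvLeft := .prove [.ins SSi 0, .rw mulS 0, .rw SiS 0, .rw antipodeLeft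
  0, .rw oneSi 0] []

def antipodeInvRight : Rule := ⟨[.h 1], [.h 0], [.comul 1 2 3, .en .Si 2 4, .mul 3 4 0], [.cov
  .eps 1, .pt .one 0]⟩

instance : Valid D antipodeInvRight := .prove [.ins SSi 0, .rw mulS 0, .rw SiS 0, .rw
  antipodeRight 0, .rw oneSi 0] []

def antipodeLeftMul : Rule := ⟨[.h 1, .h 2], [.h 0], [.comul 1 3 4, .en .S 3 5, .mul 4 2 6, .mul 5
  6 0], [.cov .eps 1, .en .id 2 0]⟩

instance : Valid D antipodeLeftMul := .prove [.wr mulAssoc 0, .rw antipodeLeft 0, .rw oneMul 0] []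

def antipodeInvLeftMul : Rule := ⟨[.h 1, .h 2], [.h 0], [.comul 1 3 4, .en .Si 4 5, .mul 3 2 6,
  .mul 5 6 0], [.cov .eps 1, .en .id 2 0]⟩

instance : Valid D antipodeInvLeftMul := .prove [.wr mulAssoc 0, .rw antipodeInvLeft 0, .rw oneMul
  0] []

def antipodeLeftComul : Rule := ⟨[.h 2], [.h 0, .h 1], [.comul 2 3 4, .comul 4 5 1, .en .S 3 6,
  .mul 6 5 0], [.pt .one 0, .en .id 2 1]⟩

instance : Valid D antipodeLeftComul := .prove [.wr comulAssoc 0, .rw antipodeLeft 0, .rw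
  counitComul 0] []

def antipodeInvLeftComul : Rule := ⟨[.h 2], [.h 0, .h 1], [.comul 2 3 4, .comul 4 5 1, .en .Si 5
  6, .mul 6 3 0], [.pt .one 0, .en .id 2 1]⟩

instance : Valid D antipodeInvLeftComul := .prove [.wr comulAssoc 0, .rw antipodeInvLeft 0, .rw
  counitComul 0] []

def antipodeInvRightComul : Rule := ⟨[.h 2], [.h 0, .h 1], [.comul 2 3 4, .comul 4 5 1, .en .Si 3
  6, .mul 5 6 0], [.pt .one 0, .en .id 2 1]⟩

instance : Valid D antipodeInvRightComul := .prove [.wr comulAssoc 0, .rw antipodeInvRight 0, .rw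
  counitComul 0] []

def antipodeInvLeftComulMul : Rule := ⟨[.h 2, .h 3], [.h 0, .h 1], [.comul 2 4 5, .comul 5 6 1,
  .en .Si 6 7, .mul 4 3 8, .mul 7 8 0], [.en .id 3 0, .en .id 2 1]⟩

instance : Valid D antipodeInvLeftComulMul := .prove [.wr comulAssoc 0, .rw antipodeInvLeftMul 0,
  .rw counitComul 0] []

def gMulGiMul : Rule := ⟨[.h 1], [.h 0], [.pt .g 2, .pt .gi 3, .mul 3 1 4, .mul 2 4 0], [.en .id 1
  0]⟩

instance : Valid D gMulGiMul := .prove [.wr mulAssoc 0, .rw gMulGi 0, .rw oneMul 0] []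

def giMulGMul : Rule := ⟨[.h 1], [.h 0], [.pt .gi 2, .pt .g 3, .mul 3 1 4, .mul 2 4 0], [.en .id 1
  0]⟩

instance : Valid D giMulGMul := .prove [.wr mulAssoc 0, .rw giMulG 0, .rw oneMul 0] []

def sMulSiMul : Rule := ⟨[.h 1], [.h 0], [.pt .s 2, .pt .si 3, .mul 3 1 4, .mul 2 4 0], [.en .id 1
  0]⟩

instance : Valid D sMulSiMul := .prove [.wr mulAssoc 0, .rw sMulSi 0, .rw oneMul 0] []

def siMulSMul : Rule := ⟨[.h 1], [.h 0], [.pt .si 2, .pt .s 3, .mul 3 1 4, .mul 2 4 0], [.en .id 1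
  0]⟩

instance : Valid D siMulSMul := .prove [.wr mulAssoc 0, .rw siMulS 0, .rw oneMul 0] []

/-- Invariance of `λ` gives `λ(hk₁) 1 = λ(h₁k₁) h₂k₂`; multiplication by `S` of a further leg of `k`
cancels `k₂`. In the same way the other invariance yields `lamMulRight`, with an extra factor `g`.
-/
def lamMulLeft : Rule := ⟨[.h 1, .h 2], [.h 0], [.comul 1 3 0, .mul 3 2 4, .cov .lam 4], [.comul 2
  3 4, .mul 1 3 5, .cov .lam 5, .en .S 4 0]⟩

instance : Valid D lamMulLeft := .prove [] [.ins oneMul 0, .wr comulLam 0, .rw mulComul 0, .rw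
  mulAssoc 0, .rw comulAssoc 0, .rw antipodeRight 0, .rw mulOne 0, .rw comulCounit 0]

def lamMulLeftInv : Rule := ⟨[.h 1, .h 2], [.h 0], [.comul 1 3 4, .mul 3 2 5, .cov .lam 5, .en .Si
  4 0], [.comul 2 3 0, .mul 1 3 4, .cov .lam 4]⟩

instance : Valid D lamMulLeftInv := .prove [.rw lamMulLeft 0, .rw SSi 0] []

def lamMulRight : Rule := ⟨[.h 1, .h 2], [.h 0], [.comul 1 0 3, .mul 3 2 4, .cov .lam 4], [.comul
  2 3 4, .pt .g 5, .en .Si 3 6, .mul 5 6 0, .mul 1 4 7, .cov .lam 7]⟩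

instance : Valid D lamMulRight := .prove [] [.wr comulLamG 0, .rw mulComul 0, .rw mulAssoc 0, .rw
  antipodeInvRightComul 0, .rw mulOne 0]

/-! ### The point `g` is group-like. -/

/-- The normalisation writes the scalar 1 with a factor `λ`, so it suffices to prove the equation
after multiplication by `λ`. There `λ g = (id ⊗ λ)Δ` and the counit axiom apply; coassociativity
treats `comulG` in the same way. -/
def counitG : Rule := ⟨[], [], [.pt .g 0, .cov .eps 0], []⟩

instance : Valid D counitG := .prove [.wr lamNorm 0, .wr comulLamG 0, .rw counitComul 0] [.wr
  lamNorm 0]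

def comulG : Rule := ⟨[], [.h 0, .h 1], [.pt .g 2, .comul 2 0 1], [.pt .g 0, .pt .g 1]⟩

instance : Valid D comulG := .prove [.wr lamNorm 0, .wr comulLamG 0, .rw comulAssoc 0, .rw
  comulLamG 0] [.wr lamNorm 0, .wr comulLamG 0]

def antipodeG : Rule := ⟨[], [.h 0], [.pt .g 1, .en .S 1 0], [.pt .gi 0]⟩

instance : Valid D antipodeG := .prove [.ins mulOne 0, .wr gMulGi 0, .wr comulG 0, .rw
  antipodeLeftMul 0, .rw counitG 0] []

def antipodeGi : Rule := ⟨[], [.h 0], [.pt .gi 1, .en .S 1 0], [.pt .g 0]⟩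

instance : Valid D antipodeGi := .prove [] [.ins oneMul 0, .wr oneS 0, .wr gMulGi 0, .rw mulS 0,
  .rw antipodeG 0, .rw mulAssoc 0, .rw giMulG 0, .rw mulOne 0]

def counitGi : Rule := ⟨[], [], [.pt .gi 0, .cov .eps 0], []⟩

instance : Valid D counitGi := .prove [.wr antipodeG 0, .rw counitS 0, .rw counitG 0] []

def antipodeInvG : Rule := ⟨[], [.h 0], [.pt .g 1, .en .Si 1 0], [.pt .gi 0]⟩

instance : Valid D antipodeInvG := .prove [.wr antipodeGi 0, .rw SSi 0] []

def antipodeInvGi : Rule := ⟨[], [.h 0], [.pt .gi 1, .en .Si 1 0], [.pt .g 0]⟩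

instance : Valid D antipodeInvGi := .prove [.wr antipodeG 0, .rw SSi 0] []

/-! ### The inverse of the copairing. -/

def gamInvLeft : Rule := ⟨[], [.h 0, .h 1], [.gam 2 3, .gam 4 5, .en .S 2 6, .mul 6 4 0, .mul 3 5
  1], [.pt .one 0, .pt .one 1]⟩

instance : Valid D gamInvLeft := .prove [.wr gamComulLeft 0, .rw antipodeLeft 0, .rw gamCounitLeft
  0] []

def gamInvRight : Rule := ⟨[], [.h 0, .h 1], [.gam 2 3, .gam 4 5, .mul 2 4 0, .en .S 5 6, .mul 3 6
  1], [.pt .one 0, .pt .one 1]⟩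

instance : Valid D gamInvRight := .prove [.wr gamComulRight 0, .rw antipodeRight 0, .rw
  gamCounitRight 0] []

def gamInvLeftL : Rule := ⟨[.h 2], [.h 0, .h 1], [.gam 3 4, .gam 5 6, .en .S 3 7, .mul 7 5 0, .mul
  6 2 8, .mul 4 8 1], [.pt .one 0, .en .id 2 1]⟩

instance : Valid D gamInvLeftL := .prove [.wr mulAssoc 0, .rw gamInvLeft 0, .rw oneMul 0] []

def gamInvLeftKL : Rule := ⟨[.h 2, .h 3], [.h 0, .h 1], [.gam 4 5, .gam 6 7, .en .S 4 8, .mul 6 2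
  9, .mul 8 9 0, .mul 7 3 10, .mul 5 10 1], [.en .id 2 0, .en .id 3 1]⟩

instance : Valid D gamInvLeftKL := .prove [.wr mulAssoc 0, .rw gamInvLeftL 0, .rw oneMul 0] []

def gamInvRightL : Rule := ⟨[.h 2], [.h 0, .h 1], [.gam 3 4, .gam 5 6, .mul 3 5 0, .en .S 6 7,
  .mul 7 2 8, .mul 4 8 1], [.pt .one 0, .en .id 2 1]⟩

instance : Valid D gamInvRightL := .prove [.wr mulAssoc 0, .rw gamInvRight 0, .rw oneMul 0] []

def gamInvRightKL : Rule := ⟨[.h 2, .h 3], [.h 0, .h 1], [.gam 4 5, .gam 6 7, .mul 6 2 8, .mul 4 8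
  0, .en .S 7 9, .mul 9 3 10, .mul 5 10 1], [.en .id 2 0, .en .id 3 1]⟩

instance : Valid D gamInvRightKL := .prove [.wr mulAssoc 0, .rw gamInvRightL 0, .rw oneMul 0] []

/-- Both sides are inverse to `γ`, one from the left and one from the right, hence they agree. -/
def gamAntipode : Rule := ⟨[], [.h 0, .h 1], [.gam 0 2, .en .S 2 1], [.gam 2 1, .en .S 2 0]⟩

instance : Valid D gamAntipode := .prove [.ins oneMul 0, .ins oneMul 1, .wr gamInvLeft 0, .rw
  mulAssoc 0, .rw mulAssoc 0] [.ins mulOne 0, .ins mulOne 1, .wr gamInvRight 0]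

def gamAntipodeInv : Rule := ⟨[], [.h 0, .h 1], [.gam 0 2, .en .Si 2 1], [.gam 2 1, .en .Si 2 0]⟩

instance : Valid D gamAntipodeInv := .prove [.ins SSi 0, .wr gamAntipode 0] [.ins SSi 1]

/-! ### The point `σ`: its coproduct, its antipode, and its relations with `g`. -/

/-- Applying `ε ⊗ ε` to the formula for `γ` gives `ε(σ⁻¹)² ε(σ) = 1`, while `ε(σ⁻¹) ε(σ) = 1`. -/
def counitPtSi : Rule := ⟨[], [], [.pt .si 0, .cov .eps 0], []⟩

instance : Valid D counitPtSi := .prove [.wr oneCounit 0, .wr siMulS 0, .rw mulCounit 0] [.wr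
  oneCounit 0, .wr gamCounitLeft 0, .rw gamEqS 0, .rw mulCounit 0, .rw counitComul 0, .rw
  mulCounit 0]

def counitPtS : Rule := ⟨[], [], [.pt .s 0, .cov .eps 0], []⟩

instance : Valid D counitPtS := .prove [] [.wr oneCounit 0, .wr siMulS 0, .rw mulCounit 0, .rw
  counitPtSi 0]

def comulPtS : Rule := ⟨[], [.h 0, .h 1], [.pt .s 2, .comul 2 0 1], [.gam 2 3, .pt .s 4, .mul 4 2
  0, .pt .s 5, .mul 3 5 1]⟩

instance : Valid D comulPtS := .prove [] [.rw gamEqS 0, .rw sMulSiMul 0, .rw mulAssoc 0, .rw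
  siMulS 0, .rw mulOne 0]

/-- The inverse of `Δσ = (σ ⊗ 1)γ(1 ⊗ σ)`, computed with the inverse of `γ`. -/
def comulPtSi : Rule := ⟨[], [.h 0, .h 1], [.pt .si 2, .comul 2 0 1], [.gam 2 3, .en .S 2 4, .pt
  .si 5, .mul 4 5 0, .pt .si 6, .mul 6 3 1]⟩

instance : Valid D comulPtSi := .prove [] [.ins mulOne 0, .rw mulAssoc 0, .ins mulOne 1, .rw
  mulAssoc 0, .wr oneComul 0, .wr sMulSi 0, .rw mulComul 0, .rw comulPtS 0, .rw mulAssoc 0, .rw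
  siMulSMul 0, .rw mulAssoc 0, .rw gamInvLeftKL 0, .rw siMulSMul 0]

def gMulSMul : Rule := ⟨[.h 1], [.h 0], [.pt .g 2, .pt .s 3, .mul 3 1 4, .mul 2 4 0], [.pt .s 2,
  .pt .gi 3, .mul 3 1 4, .mul 2 4 0]⟩

instance : Valid D gMulSMul := .prove [.wr mulAssoc 0, .rw gMulS 0, .rw mulAssoc 0] []

def giMulS : Rule := ⟨[], [.h 0], [.pt .gi 1, .pt .s 2, .mul 1 2 0], [.pt .s 1, .pt .g 2, .mul 1 2
  0]⟩

instance : Valid D giMulS := .prove [] [.ins oneMul 0, .wr giMulG 0, .rw mulAssoc 0, .rw gMulSMul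
  0, .rw giMulG 0, .rw mulOne 0]

def giMulSMul : Rule := ⟨[.h 1], [.h 0], [.pt .gi 2, .pt .s 3, .mul 3 1 4, .mul 2 4 0], [.pt .s 2,
  .pt .g 3, .mul 3 1 4, .mul 2 4 0]⟩

instance : Valid D giMulSMul := .prove [.wr mulAssoc 0, .rw giMulS 0, .rw mulAssoc 0] []

def gMulSi : Rule := ⟨[], [.h 0], [.pt .g 1, .pt .si 2, .mul 1 2 0], [.pt .si 1, .pt .gi 2, .mul 1
  2 0]⟩

instance : Valid D gMulSi := .prove [.ins oneMul 0, .wr siMulS 0, .rw mulAssoc 0, .rw siMulSMul 0]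
  [.ins mulOne 0, .rw mulAssoc 0, .wr sMulSi 0, .rw giMulSMul 0, .rw siMulSMul 0]

def gMulSiMul : Rule := ⟨[.h 1], [.h 0], [.pt .g 2, .pt .si 3, .mul 3 1 4, .mul 2 4 0], [.pt .si
  2, .pt .gi 3, .mul 3 1 4, .mul 2 4 0]⟩

instance : Valid D gMulSiMul := .prove [.wr mulAssoc 0, .rw gMulSi 0, .rw mulAssoc 0] []

def giMulSi : Rule := ⟨[], [.h 0], [.pt .gi 1, .pt .si 2, .mul 1 2 0], [.pt .si 1, .pt .g 2, .mul
  1 2 0]⟩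

instance : Valid D giMulSi := .prove [] [.ins oneMul 0, .wr giMulG 0, .rw mulAssoc 0, .rw
  gMulSiMul 0, .rw giMulG 0, .rw mulOne 0]

def giMulSiMul : Rule := ⟨[.h 1], [.h 0], [.pt .gi 2, .pt .si 3, .mul 3 1 4, .mul 2 4 0], [.pt .si
  2, .pt .g 3, .mul 3 1 4, .mul 2 4 0]⟩

instance : Valid D giMulSiMul := .prove [.wr mulAssoc 0, .rw giMulSi 0, .rw mulAssoc 0] []

def antipodeSi : Rule := ⟨[], [.h 0], [.pt .si 1, .en .S 1 0], [.pt .si 1, .pt .gi 2, .mul 1 2 0]⟩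

instance : Valid D antipodeSi := .prove [] [.ins oneMul 0, .wr oneS 0, .wr sMulSi 0, .rw mulS 0,
  .rw antipodeS 0, .rw gMulS 0, .rw mulAssoc 0, .rw mulAssoc 0, .rw giMulSiMul 0, .rw sMulSiMul 0,
  .rw gMulGi 0, .rw mulOne 0]

def antipodeInvS : Rule := ⟨[], [.h 0], [.pt .s 1, .en .Si 1 0], [.pt .s 1, .pt .g 2, .mul 1 2 0]⟩

instance : Valid D antipodeInvS := .prove [] [.ins SSi 0, .rw mulS 0, .rw antipodeS 0, .rw gMulS
  0, .rw antipodeG 0, .rw giMulSMul 0, .rw mulSi 0, .rw mulSi 0, .rw antipodeInvGi 0, .rw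
  antipodeInvG 0, .rw gMulGi 0, .rw oneMul 0]

def antipodeInvSi : Rule := ⟨[], [.h 0], [.pt .si 1, .en .Si 1 0], [.pt .si 1, .pt .g 2, .mul 1 2
  0]⟩

instance : Valid D antipodeInvSi := .prove [] [.ins SSi 0, .rw mulS 0, .rw antipodeSi 0, .rw
  antipodeG 0, .rw giMulSiMul 0, .rw mulSi 0, .rw mulSi 0, .rw antipodeInvGi 0, .rw antipodeInvG
  0, .rw gMulGi 0, .rw oneMul 0]

/-! ### Conjugation by `σ`. -/

def mulF : Rule := ⟨[.h 1, .h 2], [.h 0], [.mul 1 2 3, .en .f 3 0], [.en .f 1 3, .en .f 2 4, .mul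
  3 4 0]⟩

instance : Valid D mulF := .prove [.rw fEq 0, .rw mulAssoc 0, .rw mulAssoc 0] [.rw fEq 0, .rw
  mulAssoc 0, .rw mulAssoc 0, .rw mulAssoc 0, .rw fEq 0, .rw mulAssoc 0, .rw siMulSMul 0]

def oneF : Rule := ⟨[], [.h 0], [.pt .one 1, .en .f 1 0], [.pt .one 0]⟩

instance : Valid D oneF := .prove [.rw fEq 0, .rw mulOne 0, .rw sMulSi 0] []

def fiF : Rule := ⟨[.h 1], [.h 0], [.en .f 1 2, .en .fi 2 0], [.en .id 1 0]⟩

instance : Valid D fiF := .prove [.rw fEq 0, .rw mulAssoc 0, .rw fiEq 0, .rw siMulSMul 0, .rw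
  mulAssoc 0, .rw siMulS 0, .rw mulOne 0] []

def fFi : Rule := ⟨[.h 1], [.h 0], [.en .fi 1 2, .en .f 2 0], [.en .id 1 0]⟩

instance : Valid D fFi := .prove [.rw fEq 0, .rw mulAssoc 0, .rw fiEq 0, .rw mulAssoc 0, .rw
  mulAssoc 0, .rw sMulSiMul 0, .rw mulAssoc 0, .rw sMulSi 0, .rw mulOne 0] []

def mulFi : Rule := ⟨[.h 1, .h 2], [.h 0], [.mul 1 2 3, .en .fi 3 0], [.en .fi 1 3, .en .fi 2 4,
  .mul 3 4 0]⟩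

instance : Valid D mulFi := .prove [.rw fiEq 0, .rw mulAssoc 0, .rw mulAssoc 0] [.rw fiEq 0, .rw
  mulAssoc 0, .rw mulAssoc 0, .rw mulAssoc 0, .rw fiEq 0, .rw mulAssoc 0, .rw sMulSiMul 0]

def oneFi : Rule := ⟨[], [.h 0], [.pt .one 1, .en .fi 1 0], [.pt .one 0]⟩

instance : Valid D oneFi := .prove [.rw fiEq 0, .rw mulOne 0, .rw siMulS 0] []

def ptFS : Rule := ⟨[], [.h 0], [.pt .s 1, .en .f 1 0], [.pt .s 0]⟩

instance : Valid D ptFS := .prove [.rw fEq 0, .rw mulAssoc 0, .rw sMulSi 0, .rw mulOne 0] []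

def ptFiS : Rule := ⟨[], [.h 0], [.pt .s 1, .en .fi 1 0], [.pt .s 0]⟩

instance : Valid D ptFiS := .prove [.rw fiEq 0, .rw siMulS 0, .rw oneMul 0] []

def ptFSi : Rule := ⟨[], [.h 0], [.pt .si 1, .en .f 1 0], [.pt .si 0]⟩

instance : Valid D ptFSi := .prove [.rw fEq 0, .rw sMulSi 0, .rw oneMul 0] []

def ptFiSi : Rule := ⟨[], [.h 0], [.pt .si 1, .en .fi 1 0], [.pt .si 0]⟩

instance : Valid D ptFiSi := .prove [.rw fiEq 0, .rw mulAssoc 0, .rw siMulS 0, .rw mulOne 0] []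

def ptFG : Rule := ⟨[], [.h 0], [.pt .g 1, .en .f 1 0], [.pt .gi 0]⟩

instance : Valid D ptFG := .prove [.rw fEq 0, .rw mulAssoc 0, .rw gMulSi 0, .rw sMulSiMul 0] []

def ptFiG : Rule := ⟨[], [.h 0], [.pt .g 1, .en .fi 1 0], [.pt .gi 0]⟩

instance : Valid D ptFiG := .prove [.rw fiEq 0, .rw mulAssoc 0, .rw gMulS 0, .rw siMulSMul 0] []

def ptFGi : Rule := ⟨[], [.h 0], [.pt .gi 1, .en .f 1 0], [.pt .g 0]⟩

instance : Valid D ptFGi := .prove [.rw fEq 0, .rw mulAssoc 0, .rw giMulSi 0, .rw sMulSiMul 0] []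

def ptFiGi : Rule := ⟨[], [.h 0], [.pt .gi 1, .en .fi 1 0], [.pt .g 0]⟩

instance : Valid D ptFiGi := .prove [.rw fiEq 0, .rw mulAssoc 0, .rw giMulS 0, .rw siMulSMul 0] []

def conjAntipodeInv : Rule := ⟨[.h 1], [.h 0], [.comul 1 2 3, .en .f 2 4, .en .f 3 5, .en .Si 5 6,
  .mul 4 6 0], [.cov .eps 1, .pt .one 0]⟩

instance : Valid D conjAntipodeInv := .prove [.wr comulF 0, .rw antipodeInvRight 0, .rw counitF 0]
  []

/-- The antipode of `H_cop` is `S⁻¹`, and a bialgebra morphism commutes with antipodes. The proof is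
the usual uniqueness of convolution inverses. -/
def antipodeInvF : Rule := ⟨[.h 1], [.h 0], [.en .f 1 2, .en .Si 2 0], [.en .S 1 2, .en .f 2 0]⟩

instance : Valid D antipodeInvF := .prove [] [.ins comulCounit 1, .ins mulOne 0, .wr
  conjAntipodeInv 0, .wr mulAssoc 0, .wr mulF 0, .rw antipodeLeftComul 0, .rw oneF 0, .rw oneMul
  0]

def gamGamAntipode : Rule := ⟨[], [.h 0, .h 1], [.gam 2 3, .gam 4 5, .en .S 4 6, .mul 2 6 0, .mul
  3 5 1], [.pt .one 0, .pt .one 1]⟩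

instance : Valid D gamGamAntipode := .prove [.wr gamAntipode 0, .rw gamInvRight 0] []

def gamGamAntipodeKL : Rule := ⟨[.h 2, .h 3], [.h 0, .h 1], [.gam 4 5, .gam 6 7, .en .S 6 8, .mul
  8 2 9, .mul 4 9 0, .mul 7 3 10, .mul 5 10 1], [.en .id 2 0, .en .id 3 1]⟩

instance : Valid D gamGamAntipodeKL := .prove [.wr gamAntipode 0, .rw gamInvRightKL 0] []

def antipodeF : Rule := ⟨[.h 1], [.h 0], [.en .f 1 2, .en .S 2 0], [.en .Si 1 2, .en .f 2 0]⟩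

instance : Valid D antipodeF := .prove [] [.ins SiS 0, .rw antipodeInvF 0, .rw SiS 0]

def antipodeFi : Rule := ⟨[.h 1], [.h 0], [.en .fi 1 2, .en .S 2 0], [.en .Si 1 2, .en .fi 2 0]⟩

instance : Valid D antipodeFi := .prove [] [.ins fiF 0, .ins fFi 1, .rw antipodeInvF 0, .rw fFi 0,
  .rw fiF 0]

def antipodeInvFi : Rule := ⟨[.h 1], [.h 0], [.en .fi 1 2, .en .Si 2 0], [.en .S 1 2, .en .fi 2
  0]⟩

instance : Valid D antipodeInvFi := .prove [] [.ins fiF 0, .ins fFi 1, .rw antipodeF 0, .rw fFi 0,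
  .rw fiF 0]

/-! ### Conjugation, `ω` and the symmetry of the copairing. -/

def conjOm : Rule := ⟨[.h 1], [.h 0], [.en .f 1 2, .en .om 2 0], [.en .om 1 2, .en .f 2 0]⟩

instance : Valid D conjOm := .prove [.rw fEq 0, .rw mulOm 0, .rw siOm 0, .rw mulOm 0, .rw sOm 0,
  .rw mulAssoc 0] [.rw fEq 0, .rw mulAssoc 0]

def conjInvOm : Rule := ⟨[.h 1], [.h 0], [.en .fi 1 2, .en .om 2 0], [.en .om 1 2, .en .fi 2 0]⟩

instance : Valid D conjInvOm := .prove [.rw fiEq 0, .rw mulOm 0, .rw sOm 0, .rw mulOm 0, .rw siOm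
  0, .rw mulAssoc 0] [.rw fiEq 0, .rw mulAssoc 0]

def gamOmLeft : Rule := ⟨[], [.h 0, .h 1], [.gam 0 2, .en .om 2 1], [.gam 2 1, .en .om 2 0]⟩

instance : Valid D gamOmLeft := .prove [.wr gamOmOm 0, .rw omOm 0] []

/-- The condition on `(id ⊗ ω)γ`, solved for `Ad_σ`. It moves `Ad_σ` from one leg of `γ` to the
other at the cost of `S` and `ω`. -/
def gamConj : Rule := ⟨[], [.h 0, .h 1], [.gam 0 2, .en .f 2 1], [.gam 2 1, .en .om 2 3, .en .S 3
  4, .en .f 4 0]⟩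

instance : Valid D gamConj := .prove [] [.wr gamOmLeft 0, .wr gamAntipode 0, .ins fFi 2, .wr gamOm
  0, .rw gamOmLeft 0, .rw conjOm 0, .rw gamOmOm 0]

def gamConjInv : Rule := ⟨[], [.h 0, .h 1], [.gam 0 2, .en .fi 2 1], [.gam 2 1, .en .om 2 3, .en
  .S 3 4, .en .fi 4 0]⟩

instance : Valid D gamConjInv := .prove [] [.ins fiF 1, .rw gamConj 0, .rw conjOm 0, .rw SOm 0,
  .rw omOm 0, .rw antipodeF 0, .rw SSi 0, .rw fiF 0]

/-- The composite `S ∘ Ad_σ` equals `Ad_σ ∘ S⁻¹`, but it is also computed by expanding `S(σhσ⁻¹)`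
with `S(σ) = gσ = σg⁻¹`. Comparison expresses `Ad_σ²` by `S²` and conjugation with `g⁻¹`. -/
def conjConjInv : Rule := ⟨[.h 1], [.h 0], [.en .Si 1 2, .en .f 2 3, .en .f 3 0], [.pt .gi 2, .en
  .S 1 3, .pt .g 4, .mul 3 4 5, .mul 2 5 0]⟩

instance : Valid D conjConjInv := .prove [.wr antipodeF 0, .rw fEq 0, .rw mulS 0, .rw mulF 0, .rw
  antipodeSi 0, .rw mulF 0, .rw ptFGi 0, .rw ptFSi 0, .rw mulS 0, .rw mulF 0, .rw antipodeS 0, .rw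
  mulF 0, .rw ptFG 0, .rw ptFS 0, .rw giMulS 0, .rw mulAssoc 0, .rw fEq 0, .rw mulAssoc 0, .rw
  mulAssoc 0, .rw gMulSMul 0, .rw siMulSMul 0, .rw mulAssoc 0, .rw siMulSMul 0] []

def conjConj : Rule := ⟨[.h 1], [.h 0], [.en .f 1 2, .en .f 2 0], [.pt .gi 2, .en .S 1 3, .en .S 3
  4, .pt .g 5, .mul 4 5 6, .mul 2 6 0]⟩

instance : Valid D conjConj := .prove [.ins SSi 0, .rw antipodeF 0, .rw antipodeInvF 0, .rw
  antipodeInvF 0, .rw antipodeF 0, .rw conjConjInv 0] []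

/-- By `conjConj` the automorphism in the symmetry condition is `Ad_σ²`. In this form the condition
interacts well with `gamConj`. -/
def gamSwapRight : Rule := ⟨[], [.h 0, .h 1], [.gam 1 0], [.gam 0 2, .en .f 2 3, .en .f 3 1]⟩

instance : Valid D gamSwapRight := .prove [.rw gamSymm 0, .rw mulS 0, .rw antipodeG 0, .rw mulS 0,
  .rw gamAntipode 0, .rw antipodeGi 0, .rw mulS 0, .rw antipodeGi 0, .rw mulS 0, .rw gamAntipode
  0, .rw antipodeG 0, .rw mulAssoc 0] [.rw conjConj 0, .rw gamAntipode 0, .rw gamAntipode 0]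

def gamSwap : Rule := ⟨[], [.h 0, .h 1], [.gam 1 0], [.gam 2 1, .en .f 2 3, .en .f 3 0]⟩

instance : Valid D gamSwap := .prove [.rw gamSwapRight 0, .rw gamConj 0, .rw gamConj 0, .rw conjOm
  0, .rw SOm 0, .rw omOm 0, .rw antipodeF 0, .rw SSi 0] []

def gamConjFour : Rule := ⟨[], [.h 0, .h 1], [.gam 2 1, .en .f 2 3, .en .f 3 4, .en .f 4 5, .en .f
  5 0], [.gam 0 1]⟩

instance : Valid D gamConjFour := .prove [] [.rw gamSwapRight 0, .rw gamConj 0, .rw gamConj 0, .rw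
  conjOm 0, .rw SOm 0, .rw omOm 0, .rw antipodeF 0, .rw SSi 0, .rw gamSwapRight 0, .rw gamConj 0,
  .rw gamConj 0, .rw gamConj 0, .rw gamConj 0, .rw conjOm 0, .rw conjOm 0, .rw conjOm 0, .rw SOm
  0, .rw SOm 0, .rw conjOm 0, .rw SOm 0, .rw SOm 0, .rw conjOm 0, .rw SOm 0, .rw conjOm 0, .rw SOm
  0, .rw omOm 0, .rw omOm 0, .rw antipodeF 0, .rw antipodeF 0, .rw antipodeF 0, .rw antipodeInvF
  0, .rw antipodeInvF 0, .rw antipodeF 0, .rw SSi 0, .rw SSi 0]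

/-- Exchanging the legs twice gives `γ = (Ad_σ⁴ ⊗ id)γ`; non-degeneracy removes `γ`. -/
def conjFour : Rule := ⟨[.h 1], [.h 0], [.en .f 1 2, .en .f 2 3, .en .f 3 4, .en .f 4 0], [.en .id
  1 0]⟩

instance : Valid D conjFour := .prove [.ins gamEv 1, .rw gamConj 0, .rw gamConj 0, .rw gamConj 0,
  .rw gamConj 0, .rw conjOm 0, .rw conjOm 0, .rw conjOm 0, .rw SOm 0, .rw SOm 0, .rw conjOm 0, .rw
  SOm 0, .rw SOm 0, .rw conjOm 0, .rw SOm 0, .rw conjOm 0, .rw SOm 0, .rw omOm 0, .rw omOm 0, .rw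
  antipodeF 0, .rw antipodeF 0, .rw antipodeF 0, .rw antipodeInvF 0, .rw antipodeInvF 0, .rw
  antipodeF 0, .rw SSi 0, .rw SSi 0, .rw gamConjFour 0, .rw gamEv 0] []

def conjConjConj : Rule := ⟨[.h 1], [.h 0], [.en .f 1 2, .en .f 2 3, .en .f 3 0], [.en .fi 1 0]⟩

instance : Valid D conjConjConj := .prove [] [.ins conjFour 0, .rw fFi 0]

def conjInvConjInv : Rule := ⟨[.h 1], [.h 0], [.en .fi 1 2, .en .fi 2 0], [.en .f 1 2, .en .f 2
  0]⟩

instance : Valid D conjInvConjInv := .prove [] [.ins fFi 0, .ins fFi 1, .rw conjConjConj 0, .rw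
  fFi 0]

/-! ### Integrals obtained from the cointegral. -/

/-- By non-degeneracy `h` may be taken to be a leg of a second copy of `γ`. The product of legs then
becomes a coproduct, and invariance of `λ` becomes invariance of `γ'λ(γ'')`. -/
def lamIntegral : Rule := ⟨[.h 1], [.h 0], [.gam 2 3, .cov .lam 3, .mul 2 1 0], [.cov .eps 1, .gam
  0 2, .cov .lam 2]⟩

instance : Valid D lamIntegral := .prove [.ins gamEv 1, .rw gamSwapRight 1, .wr gamComulRight 0,
  .rw comulLam 0, .rw oneF 0, .rw oneF 0] [.ins gamEv 1, .rw gamSwapRight 0, .rw gamConj 0, .rw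
  gamConj 0, .rw conjOm 0, .rw SOm 0, .rw omOm 0, .rw antipodeF 0, .rw counitF 0, .rw counitF 0,
  .rw counitSi 0, .rw counitS 0, .rw gamCounitLeft 0]

/-- The same idea with the other invariance of `λ`: the extra factor `g` inside `λ` makes the
integral a left one. -/
def lamIntegralLeft : Rule := ⟨[.h 1], [.h 0], [.gam 2 3, .pt .g 4, .mul 3 4 5, .cov .lam 5, .mul
  1 2 0], [.cov .eps 1, .gam 0 2, .pt .g 3, .mul 2 3 4, .cov .lam 4]⟩

instance : Valid D lamIntegralLeft := .prove [.ins gamEv 1, .rw gamSwapRight 1, .wr gamComulRight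
  0, .rw lamMulRight 0, .rw mulF 0, .rw ptFG 0, .rw mulF 0, .rw ptFGi 0, .rw comulG 0, .rw
  antipodeInvG 0, .rw ptFGi 0, .rw ptFG 0, .rw gMulGi 0] [.ins gamEv 1, .rw gamSwapRight 0, .rw
  gamConj 0, .rw gamConj 0, .rw conjOm 0, .rw SOm 0, .rw omOm 0, .rw antipodeF 0, .rw counitF 0,
  .rw counitF 0, .rw counitSi 0, .rw counitS 0, .rw gamCounitLeft 0]

def lamNormLeft : Rule := ⟨[], [], [.gam 0 1, .en .S 0 2, .cov .lam 2, .cov .lam 1], []⟩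

instance : Valid D lamNormLeft := .prove [.wr gamAntipode 0, .rw lamNorm 0] []

/-- Since `ε(g⁻¹) = 1`, the integral absorbs a factor `g⁻¹`. Exchanging the legs of `γ` then turns
the normalisation of `λ` into the one needed in `fourierGFourier`. -/
def lamNormG : Rule := ⟨[], [], [.gam 0 1, .en .S 0 2, .en .S 2 3, .en .S 3 4, .cov .lam 4, .pt .g
  5, .mul 1 5 6, .cov .lam 6], []⟩

instance : Valid D lamNormG := .prove [] [.wr lamNormLeft 0, .wr counitGi 0, .wr lamIntegral 0,
  .rw mulS 0, .rw antipodeGi 0, .wr gamAntipode 0, .rw gamSwapRight 0, .wr gamAntipode 0, .rw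
  conjConj 0, .rw gMulGiMul 0, .rw gamAntipode 0, .rw gamAntipode 0, .rw gamAntipode 0]

def lamMulRightInv : Rule := ⟨[.h 1, .h 2], [.h 0], [.comul 1 3 4, .mul 2 4 5, .cov .lam 5, .en
  .Si 3 0], [.comul 2 3 4, .pt .gi 5, .mul 5 3 0, .mul 4 1 6, .cov .lam 6]⟩

instance : Valid D lamMulRightInv := .prove [] [.rw lamMulRight 0, .rw giMulGMul 0]

/-! ### The Fourier transform and its inverse. -/

def fourierGamRight : Rule := ⟨[.h 2], [.h 0, .h 1], [.gam 1 3, .mul 3 2 4, .en .F 4 0], [.en .F 2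
  3, .comul 3 4 0, .en .Si 4 1]⟩

instance : Valid D fourierGamRight := .prove [.rw fourierEq 0, .wr mulAssoc 0, .wr gamComulLeft 0,
  .rw gamComulLeft 0, .rw mulAssoc 0] [.rw fourierEq 0, .rw comulS 0, .rw SSi 0, .rw gamComulLeft
  0, .rw mulAssoc 0]

/-- The coproduct is moved from the argument of `λ` to the copairing by `lamMulLeftInv`; there `(id
⊗ Δ)γ = γ₁₂γ₁₃` splits it off as a multiplication. `fourierComulInv` treats the other leg. -/
def fourierComul : Rule := ⟨[.h 2], [.h 0, .h 1], [.comul 2 3 1, .en .F 3 0], [.gam 3 1, .en .F 2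
  4, .mul 3 4 0]⟩

instance : Valid D fourierComul := .prove [.rw fourierEq 0, .wr lamMulLeftInv 0, .rw gamComulRight
  0, .rw gamAntipodeInv 0, .rw mulS 0, .rw SiS 0] [.rw fourierEq 0]

def fourierComulInv : Rule := ⟨[.h 2], [.h 0, .h 1], [.comul 2 3 4, .en .F 4 0, .en .Si 3 1],
  [.gam 3 4, .en .F 2 5, .en .S 3 6, .mul 5 6 0, .pt .gi 7, .mul 7 4 1]⟩

instance : Valid D fourierComulInv := .prove [.rw fourierEq 0, .rw lamMulRightInv 0, .rw
  gamComulRight 0, .rw mulS 0] [.rw fourierEq 0]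

def antipodeAntipode : Rule := ⟨[.h 1], [.h 0], [.en .S 1 2, .en .S 2 0], [.pt .g 2, .en .f 1 3,
  .en .f 3 4, .pt .gi 5, .mul 4 5 6, .mul 2 6 0]⟩

instance : Valid D antipodeAntipode := .prove [] [.rw conjConj 0, .rw mulAssoc 0, .rw gMulGiMul 0,
  .rw mulAssoc 0, .rw gMulGi 0, .rw mulOne 0]

def gMulGam : Rule := ⟨[], [.h 0, .h 1], [.gam 2 1, .pt .g 3, .mul 3 2 0], [.gam 1 2, .en .S 2 3,
  .en .S 3 4, .pt .g 5, .mul 4 5 0]⟩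

instance : Valid D gMulGam := .prove [] [.rw antipodeAntipode 0, .rw mulAssoc 0, .rw mulAssoc 0,
  .rw giMulG 0, .rw mulOne 0, .wr gamSwapRight 0]

def lamRightIntegral : Rule := ⟨[.h 1], [.h 0], [.gam 2 3, .pt .g 4, .mul 3 4 5, .cov .lam 5, .en
  .S 2 6, .en .S 6 7, .en .S 7 8, .mul 8 1 0], [.cov .eps 1, .gam 2 3, .pt .g 4, .mul 3 4 5, .cov
  .lam 5, .en .S 2 6, .en .S 6 7, .en .S 7 0]⟩

instance : Valid D lamRightIntegral := .prove [.ins SiS 1, .ins SiS 12, .ins SiS 16, .wr mulS 0,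
  .wr mulS 0, .wr mulS 0, .rw lamIntegralLeft 0, .rw counitSi 0, .rw counitSi 0, .rw counitSi 0]
  []

def gMulGamMul : Rule := ⟨[.h 2], [.h 0, .h 1], [.gam 3 1, .pt .g 4, .mul 3 2 5, .mul 4 5 0],
  [.gam 1 3, .en .S 3 4, .en .S 4 5, .pt .g 6, .mul 6 2 7, .mul 5 7 0]⟩

instance : Valid D gMulGamMul := .prove [.wr mulAssoc 0, .rw gMulGam 0, .rw gamAntipode 0, .rw
  gamAntipode 0, .rw mulAssoc 0] [.rw gamAntipode 0, .rw gamAntipode 0]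

def lamCubeMul : Rule := ⟨[.h 1, .h 2], [.h 0], [.comul 1 3 4, .en .S 4 5, .en .S 5 6, .en .S 6 7,
  .mul 7 2 8, .cov .lam 8, .en .S 3 0], [.comul 2 3 4, .en .S 1 5, .en .S 5 6, .en .S 6 7, .mul 7
  3 8, .cov .lam 8, .en .Si 4 0]⟩

instance : Valid D lamCubeMul := .prove [] [.ins SSi 4, .wr lamMulLeft 0, .rw comulS 0, .rw comulS
  0, .rw comulS 0, .rw SSi 0, .rw SSi 0]

/-- Fourier inversion. After an exchange of legs the two copairings combine to a coproduct of one of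
them, `lamCubeMul` moves it onto `h`, and what remains is the right integral `S³(γ')λ(γ''g)`, whose
total weight is 1 by `lamNormG`. -/
def fourierGFourier : Rule := ⟨[.h 1], [.h 0], [.pt .g 2, .en .F 1 3, .mul 2 3 4, .en .F 4 0],
  [.en .Si 1 0]⟩

instance : Valid D fourierGFourier := .prove [.rw fourierEq 0, .rw fourierEq 0, .wr gamAntipode 0,
  .rw gMulGam 0, .rw gamAntipode 0, .rw gamAntipode 0, .wr mulAssoc 0, .wr gamComulLeft 0, .rw
  lamCubeMul 0, .rw lamRightIntegral 0, .rw lamNormG 0, .rw counitComul 0] []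

def fourierGFourierS : Rule := ⟨[.h 1], [.h 0], [.pt .g 2, .en .S 1 3, .en .F 3 4, .mul 2 4 5, .en
  .F 5 0], [.en .id 1 0]⟩

instance : Valid D fourierGFourierS := .prove [.rw fourierGFourier 0, .rw SSi 0] []

/-- The inversion formula is applied once to write `h = F(gF(S h))`, and once more from outside. It
follows that `h ↦ gF(S h)` is a left inverse of `F` as well, which is `gFourierFourier`. -/
def antipodeFourierG : Rule := ⟨[.h 1], [.h 0], [.pt .g 2, .mul 2 1 3, .en .F 3 4, .en .S 4 0],
  [.pt .g 2, .en .S 1 3, .en .F 3 4, .mul 2 4 0]⟩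

instance : Valid D antipodeFourierG := .prove [.ins fourierGFourierS 1, .rw fourierGFourier 0, .rw
  mulSi 0, .rw antipodeInvG 0, .rw mulS 0, .rw antipodeGi 0, .rw SiS 0] []

def gFourierFourier : Rule := ⟨[.h 1], [.h 0], [.pt .g 2, .en .F 1 3, .en .S 3 4, .en .F 4 5, .mul
  2 5 0], [.en .id 1 0]⟩

instance : Valid D gFourierFourier := .prove [.wr antipodeFourierG 0, .rw fourierGFourier 0, .rw
  SiS 0] []

def gFourierFourierMul : Rule := ⟨[.h 1, .h 2], [.h 0], [.pt .g 3, .en .F 1 4, .en .S 4 5, .en .F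
  5 6, .mul 6 2 7, .mul 3 7 0], [.mul 1 2 0]⟩

instance : Valid D gFourierFourierMul := .prove [.wr mulAssoc 0, .rw gFourierFourier 0] []

def fourierAntipodeFourierG : Rule := ⟨[.h 1], [.h 0], [.pt .g 2, .mul 2 1 3, .en .F 3 4, .en .S 4
  5, .en .F 5 0], [.en .id 1 0]⟩

instance : Valid D fourierAntipodeFourierG := .prove [.rw antipodeFourierG 0, .rw fourierGFourierS
  0] []

def fourierGComul : Rule := ⟨[.h 2], [.h 0, .h 1], [.comul 2 3 1, .pt .g 4, .mul 4 3 5, .en .F 5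
  0], [.gam 3 4, .pt .g 5, .mul 5 2 6, .en .F 6 7, .mul 3 7 0, .pt .gi 8, .mul 8 4 1]⟩

instance : Valid D fourierGComul := .prove [] [.wr fourierComul 0, .rw mulComul 0, .rw comulG 0,
  .rw giMulGMul 0]

/-- The inverse transform of `fourierGComul`. It is used in the pentagon in degrees 1101. -/
def fourierMulGam : Rule := ⟨[.h 2], [.h 0, .h 1], [.gam 3 4, .mul 2 4 5, .en .F 5 0, .pt .g 6,
  .mul 6 3 1], [.en .F 2 3, .comul 3 0 4, .en .S 4 1]⟩

instance : Valid D fourierMulGam := .prove [.rw gMulGam 0, .rw gamAntipode 0, .rw gamAntipode 0]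
  [.ins fourierAntipodeFourierG 0, .rw fourierGComul 0, .rw fourierGFourier 0, .rw mulS 0, .rw
  antipodeGi 0, .rw mulS 0, .rw SiS 0, .rw gamAntipode 0]

/-! ### The cointegral and `σ`. -/

/-- The antipode axiom for `σ⁻¹`, with `Δσ⁻¹` written through `γ`. -/
def gamSiPt : Rule := ⟨[], [.h 0], [.gam 1 2, .en .S 1 3, .en .S 3 4, .pt .si 5, .mul 5 2 6, .mul
  4 6 0], [.pt .g 1, .pt .s 2, .mul 1 2 0]⟩

instance : Valid D gamSiPt := .prove [] [.rw gMulS 0, .ins mulOne 0, .rw mulAssoc 0, .wr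
  counitPtSi 0, .wr antipodeLeft 0, .rw comulPtSi 0, .rw mulS 0, .rw antipodeSi 0, .rw mulAssoc 0,
  .rw mulAssoc 0, .rw giMulSiMul 0, .rw sMulSiMul 0, .rw mulAssoc 0, .rw gMulGiMul 0]

/-- By the two invariances of `λ` the left side is `λ(S(σ))` times the unit, and the right side is
`λ(gσ)` times the unit; moreover `S(σ) = gσ`. -/
def lamAntipodePtS : Rule := ⟨[], [.h 0], [.pt .s 1, .comul 1 0 2, .en .S 2 3, .cov .lam 3], [.pt
  .s 1, .comul 1 0 2, .pt .g 3, .mul 3 2 4, .cov .lam 4]⟩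

instance : Valid D lamAntipodePtS := .prove [.ins SSi 0, .wr comulS 0, .rw antipodeS 0, .rw
  comulLam 0, .rw oneSi 0, .rw gMulS 0] [.ins oneMul 0, .wr giMulG 0, .rw mulAssoc 0, .wr comulG
  1, .wr mulComul 0, .rw comulLamG 0, .rw gMulS 0, .rw giMulG 0]

def lamAntipodeGam : Rule := ⟨[], [.h 0], [.gam 0 1, .pt .s 2, .mul 1 2 3, .en .S 3 4, .cov .lam
  4], [.gam 0 1, .pt .g 2, .pt .s 3, .mul 1 3 4, .mul 2 4 5, .cov .lam 5]⟩

instance : Valid D lamAntipodeGam := .prove [.ins oneMul 0, .wr siMulS 0, .rw mulAssoc 0, .wr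
  comulPtS 0, .rw lamAntipodePtS 0, .rw comulPtS 0, .rw siMulSMul 0] [.ins oneMul 0, .wr siMulS 0,
  .rw mulAssoc 0, .wr comulPtS 0, .rw comulPtS 0, .rw siMulSMul 0]

/-- As `σ` is invertible and `γ` is non-degenerate, `γ''σ` in `lamAntipodeGam` stands for an
arbitrary element. -/
def lamAntipode : Rule := ⟨[.h 0], [], [.en .S 0 1, .cov .lam 1], [.pt .g 1, .mul 1 0 2, .cov .lam
  2]⟩

instance : Valid D lamAntipode := .prove [.ins mulOne 0, .wr siMulS 0, .wr mulAssoc 0, .ins gamEv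
  5, .rw lamAntipodeGam 0, .rw gamEv 0, .rw mulAssoc 0, .rw siMulS 0, .rw mulOne 0] []

def lamSMulSi : Rule := ⟨[.h 0], [], [.pt .s 1, .pt .si 2, .mul 0 2 3, .mul 1 3 4, .cov .lam 4],
  [.pt .g 1, .mul 1 0 2, .cov .lam 2]⟩

instance : Valid D lamSMulSi := .prove [] [.wr lamAntipode 0, .rw lamS 0, .rw fEq 0, .rw mulAssoc
  0]

def lamMulSi : Rule := ⟨[.h 0], [], [.pt .si 1, .mul 0 1 2, .cov .lam 2], [.pt .g 1, .pt .si 2,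
  .mul 2 0 3, .mul 1 3 4, .cov .lam 4]⟩

instance : Valid D lamMulSi := .prove [] [.wr lamSMulSi 0, .rw mulAssoc 0, .rw sMulSiMul 0]

/-! ### The Fourier transform and multiplication by `σ`. -/

/-- The points `γ''σ` and `σγ'` combine to the coproduct of `σ`, which `lamMulRight` transfers to
`h`. The resulting factors `g` cancel. -/
def fourierSMul : Rule := ⟨[.h 1], [.h 0], [.pt .s 2, .mul 2 1 3, .en .F 3 0], [.comul 1 2 3, .pt
  .si 4, .mul 2 4 0, .pt .s 5, .mul 5 3 6, .cov .lam 6]⟩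

instance : Valid D fourierSMul := .prove [.rw fourierEq 0, .ins oneMul 6, .wr siMulS 0, .rw
  mulAssoc 0, .wr mulAssoc 0, .wr comulPtS 0, .rw lamMulRight 0, .rw mulS 0, .rw antipodeSi 0, .rw
  mulS 0, .rw antipodeG 0, .rw SiS 0, .rw mulAssoc 0, .rw giMulSiMul 0, .rw gMulGi 0, .rw mulOne
  0] []

def lamSGi : Rule := ⟨[], [], [.pt .s 0, .pt .gi 1, .mul 0 1 2, .cov .lam 2], [.sc true, .sc
  true]⟩

instance : Valid D lamSGi := .prove [.wr gMulS 0, .wr lamAntipode 0, .rw lamS 0, .rw ptFS 0, .rw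
  lamPtS 0] []

def lamSFourier : Rule := ⟨[.h 0], [], [.pt .s 1, .en .F 0 2, .mul 1 2 3, .cov .lam 3], [.sc true,
  .sc true, .pt .g 1, .pt .si 2, .mul 2 0 3, .mul 1 3 4, .cov .lam 4]⟩

instance : Valid D lamSFourier := .prove [.rw fourierEq 0, .rw gamEqS 0, .rw mulS 0, .rw
  antipodeSi 0, .rw mulAssoc 0, .rw lamMulRight 0, .rw mulS 0, .rw antipodeG 0, .rw SiS 0, .rw
  mulAssoc 0, .rw giMulSiMul 0, .rw gMulGi 0, .rw mulOne 0, .rw lamSMulSi 0, .wr lamMulLeftInv 0,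
  .rw comulG 0, .rw gMulSiMul 0, .rw antipodeInvG 0, .rw lamSGi 0] [.rw gMulSiMul 0]

/-- The hexagon identity in degrees 111. By `fourierSMul` the left side involves the coproduct of
`F(h)`; `fourierGamRight` trades it for a copairing, and `lamSFourier` evaluates the rest, with
`λ(σg⁻¹) = β²` as the scalar. -/
def fourierSFourier : Rule := ⟨[.h 1], [.h 0], [.pt .s 2, .en .F 1 3, .mul 2 3 4, .en .F 4 0],
  [.sc true, .sc true, .pt .si 2, .mul 1 2 3, .en .F 3 4, .pt .si 5, .mul 4 5 0]⟩

instance : Valid D fourierSFourier := .prove [.rw fourierSMul 0, .ins SiS 0, .rw mulSi 0, .rw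
  antipodeInvSi 0, .rw mulS 0, .rw mulS 0, .rw antipodeSi 0, .rw antipodeG 0, .rw giMulSiMul 0,
  .rw gMulGi 0, .rw mulOne 0, .wr fourierGamRight 0, .rw lamSFourier 0, .rw gMulSiMul 0] [.rw
  fourierEq 0, .wr mulAssoc 0, .rw lamMulSi 0, .rw gMulSiMul 0]

def fourierS : Rule := ⟨[.h 1], [.h 0], [.pt .s 2, .mul 2 1 3, .en .F 3 0], [.sc true, .sc true,
  .pt .g 2, .en .S 1 3, .en .F 3 4, .mul 2 4 5, .pt .si 6, .mul 5 6 7, .en .F 7 8, .pt .si 9, .mul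
  8 9 0]⟩

instance : Valid D fourierS := .prove [.ins fourierGFourierS 1, .rw fourierSFourier 0, .rw
  mulAssoc 0] [.rw mulAssoc 0]

def mulSFourier : Rule := ⟨[.h 1], [.h 0], [.pt .s 2, .mul 1 2 0], [.sc true, .sc true, .pt .g 2,
  .pt .si 3, .pt .g 4, .en .S 1 5, .en .F 5 6, .mul 4 6 7, .mul 3 7 8, .en .S 8 9, .en .F 9 10,
  .mul 2 10 11, .pt .si 12, .mul 11 12 13, .en .F 13 0]⟩

instance : Valid D mulSFourier := .prove [.ins fourierGFourierS 1, .ins oneMul 8, .wr sMulSi 0,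
  .rw mulAssoc 0, .rw gMulSMul 0, .rw giMulSiMul 0, .rw fourierS 0, .rw mulS 0, .rw antipodeSi 0,
  .rw mulS 0, .rw antipodeG 0, .rw mulAssoc 0, .rw giMulSiMul 0, .rw gMulGi 0, .rw mulOne 0, .rw
  mulAssoc 0, .rw mulAssoc 0, .rw siMulS 0, .rw mulOne 0] [.rw mulS 0, .rw antipodeSi 0, .rw mulS
  0, .rw antipodeG 0, .rw mulAssoc 0, .rw giMulSiMul 0, .rw gMulGi 0, .rw mulOne 0, .rw mulAssoc
  0]

/-- The inverse of both sides of `fourierSFourier`, with `F⁻¹(h) = gF(S h)`. It has to be rewritten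
in terms of `F` for the second hexagon. -/
def fourierInvSiFourierInv : Rule := ⟨[.h 1], [.h 0], [.pt .g 2, .pt .si 3, .pt .g 4, .en .S 1 5,
  .en .F 5 6, .mul 4 6 7, .mul 3 7 8, .en .S 8 9, .en .F 9 10, .mul 2 10 0], [.sc false, .sc
  false, .pt .g 2, .pt .s 3, .mul 1 3 4, .en .S 4 5, .en .F 5 6, .pt .s 7, .mul 6 7 8, .mul 2 8
  0]⟩

instance : Valid D fourierInvSiFourierInv := .prove [.rw mulS 0, .rw antipodeSi 0, .rw mulS 0, .rw
  antipodeG 0, .rw mulAssoc 0, .rw giMulSiMul 0, .rw gMulGi 0, .rw mulOne 0] [.rw mulSFourier 0,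
  .rw betBeti 0, .rw betBeti 0, .rw gFourierFourierMul 0, .rw mulAssoc 0, .rw mulAssoc 0, .rw
  mulAssoc 0, .rw siMulS 0, .rw mulOne 0, .rw mulS 0, .rw antipodeSi 0, .rw mulS 0, .rw antipodeG
  0, .rw mulAssoc 0, .rw giMulSiMul 0, .rw gMulGi 0, .rw mulOne 0]

/-! ### The Fourier transform, conjugation and `ω`. -/

def counitFourier : Rule := ⟨[.h 0], [], [.en .F 0 1, .cov .eps 1], [.cov .lam 0]⟩

instance : Valid D counitFourier := .prove [.rw fourierEq 0, .rw counitS 0, .rw gamCounitLeft 0,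
  .rw oneMul 0] []

def lamMulGam : Rule := ⟨[.h 1], [.h 0], [.gam 0 2, .mul 1 2 3, .cov .lam 3], [.pt .gi 2, .en .F 1
  3, .en .S 3 4, .mul 2 4 0]⟩

instance : Valid D lamMulGam := .prove [.ins oneMul 0, .wr giMulG 0, .rw mulAssoc 0, .wr
  counitFourier 0, .rw fourierMulGam 0, .rw counitComul 0] []

def omFourier : Rule := ⟨[.h 1], [.h 0], [.en .F 1 2, .en .om 2 0], [.en .om 1 2, .en .F 2 0]⟩

instance : Valid D omFourier := .prove [.rw fourierEq 0, .rw SOm 0] [.rw fourierEq 0, .wr omLam 0,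
  .rw mulOm 0, .rw gamOmLeft 0, .rw omOm 0]

def lamMulGamAntipode : Rule := ⟨[.h 1], [.h 0], [.gam 2 3, .en .S 2 0, .mul 1 3 4, .cov .lam 4],
  [.en .F 1 2, .en .S 2 3, .en .S 3 4, .pt .g 5, .mul 4 5 0]⟩

instance : Valid D lamMulGamAntipode := .prove [.rw lamMulGam 0, .rw mulS 0, .rw antipodeGi 0] []

/-- Since `λ ∘ Ad_σ = λ ∘ S`, the argument of `λ` is reversed. The conjugation of one leg of `γ`
moves to the other leg by `gamConjInv`, which brings in `ω`, and `lamMulGamAntipode` recognises the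
transform again. -/
def fourierConj : Rule := ⟨[.h 1], [.h 0], [.en .f 1 2, .en .F 2 0], [.pt .gi 2, .en .om 1 3, .en
  .S 3 4, .en .F 4 5, .en .f 5 6, .mul 2 6 0]⟩

instance : Valid D fourierConj := .prove [.rw fourierEq 0, .ins fFi 6, .wr mulF 0, .wr lamS 0, .rw
  mulS 0, .rw antipodeFi 0, .rw gamAntipodeInv 0, .rw SiS 0, .rw gamConjInv 0, .wr SOm 0, .rw
  lamMulGamAntipode 0, .rw mulOm 0, .rw gOm 0, .rw mulFi 0, .rw ptFiG 0, .rw antipodeAntipode 0,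
  .rw mulOm 0, .rw gOm 0, .rw mulOm 0, .rw conjOm 0, .rw conjOm 0, .rw omFourier 0, .rw giOm 0,
  .rw mulFi 0, .rw ptFiG 0, .rw mulFi 0, .rw ptFiGi 0, .rw fiF 0, .rw mulAssoc 0, .rw mulAssoc 0,
  .rw gMulGi 0, .rw mulOne 0, .rw SOm 0] []

def fourierAntipodeSiFourier : Rule := ⟨[.h 1], [.h 0], [.pt .si 2, .pt .g 3, .en .S 1 4, .en .F 4
  5, .mul 3 5 6, .mul 2 6 7, .en .S 7 8, .en .F 8 0], [.sc false, .sc false, .pt .s 2, .mul 1 2 3,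
  .en .S 3 4, .en .F 4 5, .pt .s 6, .mul 5 6 0]⟩

instance : Valid D fourierAntipodeSiFourier := .prove [.ins oneMul 0, .wr giMulG 0, .rw mulAssoc
  0, .rw fourierInvSiFourierInv 0, .rw giMulGMul 0, .rw mulS 0, .rw antipodeS 0, .rw gMulS 0, .rw
  mulAssoc 0] [.rw mulS 0, .rw antipodeS 0, .rw gMulS 0, .rw mulAssoc 0]

def fourierAntipodeFourierSi : Rule := ⟨[.h 1], [.h 0], [.en .F 1 2, .en .S 2 3, .pt .si 4, .mul 3
  4 5, .en .F 5 0], [.sc false, .sc false, .pt .s 2, .pt .gi 3, .mul 3 1 4, .mul 2 4 5, .en .F 5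
  6, .pt .s 7, .mul 6 7 0]⟩

instance : Valid D fourierAntipodeFourierSi := .prove [] [.ins SiS 5, .rw mulSi 0, .rw
  antipodeInvS 0, .rw mulSi 0, .rw antipodeInvGi 0, .rw mulAssoc 0, .rw gMulSMul 0, .rw giMulG 0,
  .rw mulOne 0, .wr fourierAntipodeSiFourier 0, .rw SiS 0, .rw mulS 0, .rw antipodeSi 0, .rw mulS
  0, .rw antipodeG 0, .rw mulAssoc 0, .rw giMulSiMul 0, .rw gMulGi 0, .rw mulOne 0]

def fourierUnconj : Rule := ⟨[.h 1], [.h 0], [.en .F 1 0], [.pt .gi 2, .en .om 1 3, .en .Si 3 4,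
  .en .fi 4 5, .en .F 5 6, .en .f 6 7, .mul 2 7 0]⟩

instance : Valid D fourierUnconj := .prove [.ins fFi 1, .rw fourierConj 0, .rw conjInvOm 0, .rw
  antipodeFi 0] []

/-- Rewriting `F` through `fourierUnconj` provides the antipode between the two transforms that
`fourierAntipodeFourierSi` requires. -/
def fourierSiFourier : Rule := ⟨[.h 1], [.h 0], [.pt .si 2, .en .F 1 3, .en .om 3 4, .mul 2 4 5,
  .en .F 5 0], [.sc false, .sc false, .pt .s 2, .mul 1 2 3, .en .F 3 4, .pt .s 5, .mul 4 5 0]⟩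

instance : Valid D fourierSiFourier := .prove [.rw omFourier 0, .rw fourierUnconj 0, .rw omOm 0,
  .rw fourierUnconj 1, .rw mulOm 0, .rw siOm 0, .rw mulOm 0, .rw conjOm 0, .rw omFourier 0, .rw
  conjInvOm 0, .rw giOm 0, .rw SiOm 0, .rw mulSi 0, .rw mulFi 0, .rw antipodeInvSi 0, .rw mulFi 0,
  .rw ptFiG 0, .rw ptFiSi 0, .rw mulSi 0, .rw antipodeInvF 0, .rw mulFi 0, .rw fiF 0, .rw
  antipodeInvGi 0, .rw ptFiG 0, .rw mulAssoc 0, .rw giMulSiMul 0, .rw gMulGi 0, .rw mulOne 0, .rw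
  fourierAntipodeFourierSi 0, .rw mulF 0, .rw ptFS 0] [.rw fourierUnconj 0, .rw mulOm 0, .rw sOm
  0, .rw mulSi 0, .rw mulFi 0, .rw antipodeInvS 0, .rw mulFi 0, .rw ptFiG 0, .rw ptFiS 0, .rw
  mulAssoc 0, .rw mulAssoc 0]

/-! ### Normal form: points are moved to the right of other factors. -/

def sMul : Rule := ⟨[.h 1], [.h 0], [.pt .s 2, .mul 2 1 0], [.en .f 1 2, .pt .s 3, .mul 2 3 0]⟩

instance : Valid D sMul := .prove [] [.rw fEq 0, .rw mulAssoc 0, .rw mulAssoc 0, .rw mulAssoc 0,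
  .rw siMulS 0, .rw mulOne 0]

def sMulMul : Rule := ⟨[.h 1, .h 2], [.h 0], [.pt .s 3, .mul 1 2 4, .mul 3 4 0], [.en .f 1 3, .pt
  .s 4, .mul 4 2 5, .mul 3 5 0]⟩

instance : Valid D sMulMul := .prove [.wr mulAssoc 0, .rw sMul 0, .rw mulAssoc 0] []

def siMul : Rule := ⟨[.h 1], [.h 0], [.pt .si 2, .mul 2 1 0], [.en .fi 1 2, .pt .si 3, .mul 2 3
  0]⟩

instance : Valid D siMul := .prove [] [.rw fiEq 0, .rw mulAssoc 0, .rw mulAssoc 0, .rw mulAssoc 0,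
  .rw sMulSi 0, .rw mulOne 0]

def siMulMul : Rule := ⟨[.h 1, .h 2], [.h 0], [.pt .si 3, .mul 1 2 4, .mul 3 4 0], [.en .fi 1 3,
  .pt .si 4, .mul 4 2 5, .mul 3 5 0]⟩

instance : Valid D siMulMul := .prove [.wr mulAssoc 0, .rw siMul 0, .rw mulAssoc 0] []

/-- From `Ad_σ² = Ad_g⁻¹ ∘ S²` and `Ad_σ⁴ = id` follows `Ad_g = S² ∘ Ad_σ²`. So `g` passes other
factors by means of the same endomorphisms as `σ`. -/
def gMul : Rule := ⟨[.h 1], [.h 0], [.pt .g 2, .mul 2 1 0], [.en .f 1 2, .en .f 2 3, .en .S 3 4,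
  .en .S 4 5, .pt .g 6, .mul 5 6 0]⟩

instance : Valid D gMul := .prove [] [.rw antipodeF 0, .rw antipodeF 0, .rw antipodeInvF 0, .rw
  antipodeInvF 0, .rw antipodeAntipode 0, .rw mulF 0, .rw ptFG 0, .rw mulF 0, .rw conjConjConj 0,
  .rw ptFGi 0, .rw mulF 0, .rw ptFGi 0, .rw mulF 0, .rw ptFG 0, .rw fFi 0, .rw mulAssoc 0, .rw
  mulAssoc 0, .rw giMulG 0, .rw mulOne 0]

def gMulMul : Rule := ⟨[.h 1, .h 2], [.h 0], [.pt .g 3, .mul 1 2 4, .mul 3 4 0], [.en .f 1 3, .en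
  .f 3 4, .en .S 4 5, .en .S 5 6, .pt .g 7, .mul 7 2 8, .mul 6 8 0]⟩

instance : Valid D gMulMul := .prove [.wr mulAssoc 0, .rw gMul 0, .rw antipodeF 0, .rw antipodeF
  0, .rw antipodeInvF 0, .rw antipodeInvF 0, .rw mulAssoc 0] [.rw antipodeF 0, .rw antipodeF 0,
  .rw antipodeInvF 0, .rw antipodeInvF 0]

def giMul : Rule := ⟨[.h 1], [.h 0], [.pt .gi 2, .mul 2 1 0], [.en .f 1 2, .en .f 2 3, .en .Si 3
  4, .en .Si 4 5, .pt .gi 6, .mul 5 6 0]⟩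

instance : Valid D giMul := .prove [] [.rw antipodeInvF 0, .rw antipodeF 0, .rw antipodeInvF 0,
  .rw antipodeF 0, .ins oneMul 0, .wr giMulG 0, .rw mulAssoc 0, .rw gMulMul 0, .rw conjConjConj 0,
  .rw antipodeF 0, .rw antipodeInvFi 0, .rw antipodeF 0, .rw antipodeInvFi 0, .rw fFi 0, .rw
  gMulGi 0, .rw mulOne 0, .rw SiS 0, .rw SiS 0]

def giMulMul : Rule := ⟨[.h 1, .h 2], [.h 0], [.pt .gi 3, .mul 1 2 4, .mul 3 4 0], [.en .f 1 3,
  .en .f 3 4, .en .Si 4 5, .en .Si 5 6, .pt .gi 7, .mul 7 2 8, .mul 6 8 0]⟩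

instance : Valid D giMulMul := .prove [.wr mulAssoc 0, .rw giMul 0, .rw antipodeInvF 0, .rw
  antipodeF 0, .rw antipodeInvF 0, .rw antipodeF 0, .rw mulAssoc 0] [.rw antipodeInvF 0, .rw
  antipodeF 0, .rw antipodeInvF 0, .rw antipodeF 0]

/-! ### Cancellation and commutation of copairings for the pentagons and hexagons. -/

def gamGamSwapKL : Rule := ⟨[.h 2, .h 3], [.h 0, .h 1], [.gam 4 5, .gam 6 7, .mul 5 2 8, .mul 6 8
  0, .pt .g 9, .en .Si 4 10, .mul 10 3 11, .mul 9 11 12, .mul 7 12 1], [.pt .g 4, .mul 4 3 1, .en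
  .id 2 0]⟩

instance : Valid D gamGamSwapKL := .prove [.wr gamAntipodeInv 0, .rw gMulGamMul 0, .rw gamAntipode
  0, .rw gamAntipode 0, .rw SSi 0, .rw gamGamAntipodeKL 0] []

def gamSwapInv : Rule := ⟨[], [.h 0, .h 1], [.gam 2 3, .gam 4 5, .en .Si 2 6, .mul 6 4 0, .mul 5 3
  1], [.pt .one 0, .pt .one 1]⟩

instance : Valid D gamSwapInv := .prove [.ins SSi 0, .rw mulS 0, .rw SiS 0, .rw gamInvLeft 0, .rw
  oneSi 0] []

def gamSwapInvLeft : Rule := ⟨[], [.h 0, .h 1], [.gam 2 3, .gam 4 5, .en .Si 2 6, .mul 4 6 0, .mul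
  3 5 1], [.pt .one 0, .pt .one 1]⟩

instance : Valid D gamSwapInvLeft := .prove [.ins SSi 0, .rw mulS 0, .rw SiS 0, .rw gamGamAntipode
  0, .rw oneSi 0] []

def gamSwapInvLeftK : Rule := ⟨[.h 2], [.h 0, .h 1], [.gam 3 4, .gam 5 6, .en .Si 3 7, .mul 7 2 8,
  .mul 5 8 0, .mul 4 6 1], [.pt .one 1, .en .id 2 0]⟩

instance : Valid D gamSwapInvLeftK := .prove [.wr mulAssoc 0, .rw gamSwapInvLeft 0, .rw oneMul 0]
  []

def oneOm : Rule := ⟨[], [.h 0], [.pt .one 1, .en .om 1 0], [.pt .one 0]⟩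

instance : Valid D oneOm := .prove [.wr gMulGi 0, .rw mulOm 0, .rw giOm 0, .rw gOm 0, .rw gMulGi
  0] []

def conjOmGamSwapInv : Rule := ⟨[], [.h 0, .h 1], [.gam 2 3, .gam 4 5, .en .om 2 6, .en .Si 6 7,
  .en .fi 7 8, .en .om 4 9, .en .fi 9 10, .mul 8 10 0, .mul 5 3 1], [.pt .one 0, .pt .one 1]⟩

instance : Valid D conjOmGamSwapInv := .prove [.wr mulFi 0, .wr SiOm 0, .wr mulOm 0, .rw
  gamSwapInv 0, .rw oneOm 0, .rw oneFi 0] []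

def conjOmGamSwapInvL : Rule := ⟨[.h 2], [.h 0, .h 1], [.gam 3 4, .gam 5 6, .en .om 3 7, .en .Si 7
  8, .en .fi 8 9, .en .om 5 10, .en .fi 10 11, .mul 9 11 0, .mul 4 2 12, .mul 6 12 1], [.pt .one
  0, .en .id 2 1]⟩

instance : Valid D conjOmGamSwapInvL := .prove [.wr mulAssoc 0, .rw conjOmGamSwapInv 0, .rw oneMul
  0] []

def conjOmGamSwapInvKL : Rule := ⟨[.h 2, .h 3], [.h 0, .h 1], [.gam 4 5, .gam 6 7, .en .om 4 8,
  .en .Si 8 9, .en .fi 9 10, .en .om 6 11, .en .fi 11 12, .mul 12 2 13, .mul 10 13 0, .mul 5 3 14,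
  .mul 7 14 1], [.en .id 2 0, .en .id 3 1]⟩

instance : Valid D conjOmGamSwapInvKL := .prove [.wr mulAssoc 0, .rw conjOmGamSwapInvL 0, .rw
  oneMul 0] []

def gamSiPtRight : Rule := ⟨[], [.h 0], [.gam 1 2, .en .S 1 3, .en .S 3 4, .en .fi 2 5, .pt .si 6, .mul
  5 6 7, .mul 4 7 0], [.pt .s 1, .pt .gi 2, .mul 1 2 0]⟩

instance : Valid D gamSiPtRight := .prove [.wr siMul 0, .rw gamSiPt 0, .rw gMulS 0] []

def gamSiPtConj : Rule := ⟨[], [.h 0], [.gam 1 2, .en .om 1 3, .en .Si 3 4, .en .fi 4 5, .pt .si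
  6, .mul 2 6 7, .mul 5 7 0], [.pt .s 1, .pt .gi 2, .mul 1 2 0]⟩

instance : Valid D gamSiPtConj := .prove [] [.wr gamSiPtRight 0, .rw gamConjInv 0, .rw antipodeFi 0,
  .rw antipodeFi 0, .rw SSi 0]

def gamSiPtConjG : Rule := ⟨[], [.h 0], [.gam 1 2, .en .om 1 3, .en .Si 3 4, .en .fi 4 5, .pt .si
  6, .pt .g 7, .mul 6 7 8, .mul 2 8 9, .mul 5 9 0], [.pt .s 0]⟩

instance : Valid D gamSiPtConjG := .prove [.wr mulAssoc 0, .wr mulAssoc 0, .rw gamSiPtConj 0, .rw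
  mulAssoc 0, .rw giMulG 0, .rw sMul 0, .rw oneF 0, .rw oneMul 0] []

/-- The axiom of the inverse antipode for `σ`, with its coproduct written through `γ` and all points
collected on the right. -/
def gamSwapSPt : Rule := ⟨[], [.h 0], [.gam 1 2, .en .Si 1 3, .en .f 3 4, .pt .s 5, .mul 4 5 6,
  .mul 2 6 0], [.pt .si 1, .pt .g 2, .mul 1 2 0]⟩

instance : Valid D gamSwapSPt := .prove [.wr sMul 0, .rw sMul 0] [.ins oneMul 0, .wr counitPtS 0,
  .wr antipodeInvRight 0, .rw comulPtS 0, .rw mulSi 0, .rw antipodeInvS 0, .rw mulAssoc 0, .rw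
  mulAssoc 0, .rw mulAssoc 0, .rw mulAssoc 0, .rw mulAssoc 0, .rw gMulSiMul 0, .rw giMulG 0, .rw
  siMul 0, .rw oneFi 0, .rw sMulMul 0, .rw sMulMul 0, .rw sMulMul 0, .rw oneF 0, .rw oneF 0, .rw
  sMulSi 0, .rw sMul 0, .rw oneF 0, .rw oneMul 0, .rw oneMul 0]

def gamSPtConjInv : Rule := ⟨[], [.h 0], [.gam 1 2, .en .om 1 3, .en .S 3 4, .en .S 4 5, .en .fi 5
  6, .pt .s 7, .mul 2 7 8, .mul 6 8 0], [.pt .si 1, .pt .g 2, .mul 1 2 0]⟩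

instance : Valid D gamSPtConjInv := .prove [] [.wr gamSwapSPt 0, .rw gamSwap 0, .rw gamAntipodeInv
  0, .rw gamConj 0, .rw antipodeInvF 0, .rw conjConjConj 0]

def gamSPtConj : Rule := ⟨[], [.h 0], [.gam 1 2, .en .Si 1 3, .en .f 3 4, .pt .s 5, .mul 2 5 6,
  .mul 4 6 0], [.pt .si 1, .pt .gi 2, .mul 1 2 0]⟩

instance : Valid D gamSPtConj := .prove [.ins fiF 0, .rw mulF 0, .rw mulF 0, .rw gamConj 0, .rw
  antipodeInvF 0, .rw conjConjConj 0, .rw ptFS 0, .rw gamSPtConjInv 0, .rw mulFi 0, .rw ptFiG 0,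
  .rw ptFiSi 0] []

def gamSPtConjG : Rule := ⟨[], [.h 0], [.gam 1 2, .en .Si 1 3, .en .f 3 4, .pt .s 5, .pt .g 6,
  .mul 5 6 7, .mul 2 7 8, .mul 4 8 0], [.pt .si 0]⟩

instance : Valid D gamSPtConjG := .prove [.wr mulAssoc 0, .wr mulAssoc 0, .rw gamSPtConj 0, .rw
  mulAssoc 0, .rw giMulG 0, .rw siMul 0, .rw oneFi 0, .rw oneMul 0] []

def conjGamSwapInv : Rule := ⟨[], [.h 0, .h 1], [.gam 2 3, .gam 4 5, .en .Si 2 6, .en .f 6 7, .en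
  .f 4 8, .mul 7 8 0, .mul 5 3 1], [.pt .one 0, .pt .one 1]⟩

instance : Valid D conjGamSwapInv := .prove [.wr mulF 0, .rw gamSwapInv 0, .rw oneF 0] []

def conjGamSwapInvL : Rule := ⟨[.h 2], [.h 0, .h 1], [.gam 3 4, .gam 5 6, .en .Si 3 7, .en .f 7 8,
  .en .f 5 9, .mul 8 9 0, .mul 4 2 10, .mul 6 10 1], [.pt .one 0, .en .id 2 1]⟩

instance : Valid D conjGamSwapInvL := .prove [.wr mulAssoc 0, .rw conjGamSwapInv 0, .rw oneMul 0]
  []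

def conjGamSwapInvKL : Rule := ⟨[.h 2, .h 3], [.h 0, .h 1], [.gam 4 5, .gam 6 7, .en .Si 4 8, .en
  .f 8 9, .en .f 6 10, .mul 10 2 11, .mul 9 11 0, .mul 5 3 12, .mul 7 12 1], [.en .id 2 0, .en .id
  3 1]⟩

instance : Valid D conjGamSwapInvKL := .prove [.wr mulAssoc 0, .rw conjGamSwapInvL 0, .rw oneMul
  0] []

/-- The coproduct of `σh = Ad_σ(h)σ`, computed on both sides; `Ad_σ` reverses the coproduct. -/
def comulGamSCommute : Rule := ⟨[.h 2], [.h 0, .h 1], [.comul 2 3 4, .gam 5 6, .pt .s 7, .mul 5 3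
  8, .mul 7 8 0, .pt .s 9, .mul 9 4 10, .mul 6 10 1], [.comul 2 3 4, .gam 5 6, .en .f 4 7, .pt .s
  8, .mul 8 5 9, .mul 7 9 0, .en .f 3 10, .pt .s 11, .mul 6 11 12, .mul 10 12 1]⟩

instance : Valid D comulGamSCommute := .prove [.wr mulAssoc 0, .wr mulAssoc 0, .wr comulPtS 0, .wr
  mulComul 0, .rw sMul 0, .rw mulComul 0, .rw comulF 0, .rw comulPtS 0, .rw sMul 0] [.rw sMul 0]

def comulGamCommute : Rule := ⟨[.h 2], [.h 0, .h 1], [.comul 2 3 4, .gam 5 6, .mul 5 3 0, .en .f 4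
  7, .mul 6 7 1], [.comul 2 3 4, .gam 5 6, .mul 4 5 0, .en .f 3 7, .mul 7 6 1]⟩

instance : Valid D comulGamCommute := .prove [.ins mulOne 1, .wr sMulSi 0, .wr mulAssoc 0, .rw
  mulAssoc 0, .wr sMul 0, .ins oneMul 0, .wr siMulS 0, .rw mulAssoc 1, .rw comulGamSCommute 0, .rw
  sMul 0, .rw siMulMul 0, .rw siMulMul 0, .rw fiF 0, .rw fiF 0, .rw siMulS 0, .rw mulOne 0, .rw
  mulAssoc 0, .rw mulAssoc 0, .rw sMulSi 0, .rw mulOne 0] []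

def comulGamConjCommute : Rule := ⟨[.h 2], [.h 0, .h 1], [.comul 2 3 4, .gam 5 6, .en .f 5 7, .mul
  7 4 0, .mul 6 3 1], [.comul 2 3 4, .gam 5 6, .en .f 5 7, .mul 3 7 0, .mul 4 6 1]⟩

instance : Valid D comulGamConjCommute := .prove [.ins fiF 7, .wr gamSwap 0, .ins fiF 0, .rw mulF
  0, .rw fFi 0, .rw comulGamCommute 0, .rw mulFi 0, .rw gamConjInv 0, .rw fiF 0] [.ins fiF 7, .wr
  gamSwap 0, .rw gamConjInv 0]

def conjGamGamAntipode : Rule := ⟨[], [.h 0, .h 1], [.gam 2 3, .gam 4 5, .en .f 2 6, .en .S 4 7,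
  .en .f 7 8, .mul 6 8 0, .mul 3 5 1], [.pt .one 0, .pt .one 1]⟩

instance : Valid D conjGamGamAntipode := .prove [.wr mulF 0, .rw gamGamAntipode 0, .rw oneF 0] []

def conjGamGamAntipodeK : Rule := ⟨[.h 2], [.h 0, .h 1], [.gam 3 4, .gam 5 6, .en .f 3 7, .en .S 5
  8, .en .f 8 9, .mul 9 2 10, .mul 7 10 0, .mul 4 6 1], [.pt .one 1, .en .id 2 0]⟩

instance : Valid D conjGamGamAntipodeK := .prove [.wr mulAssoc 0, .rw conjGamGamAntipode 0, .rw
  oneMul 0] []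

def conjGamAntipodeGam : Rule := ⟨[], [.h 0, .h 1], [.gam 2 3, .gam 4 5, .en .S 2 6, .en .f 6 7,
  .en .f 4 8, .mul 7 8 0, .mul 3 5 1], [.pt .one 0, .pt .one 1]⟩

instance : Valid D conjGamAntipodeGam := .prove [.wr mulF 0, .rw gamInvLeft 0, .rw oneF 0] []

def conjGamAntipodeGamL : Rule := ⟨[.h 2], [.h 0, .h 1], [.gam 3 4, .gam 5 6, .en .S 3 7, .en .f 7
  8, .en .f 5 9, .mul 8 9 0, .mul 6 2 10, .mul 4 10 1], [.pt .one 0, .en .id 2 1]⟩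

instance : Valid D conjGamAntipodeGamL := .prove [.wr mulAssoc 0, .rw conjGamAntipodeGam 0, .rw
  oneMul 0] []

def conjGamAntipodeGamKL : Rule := ⟨[.h 2, .h 3], [.h 0, .h 1], [.gam 4 5, .gam 6 7, .en .S 4 8,
  .en .f 8 9, .en .f 6 10, .mul 10 2 11, .mul 9 11 0, .mul 7 3 12, .mul 5 12 1], [.en .id 2 0, .en
  .id 3 1]⟩

instance : Valid D conjGamAntipodeGamKL := .prove [.wr mulAssoc 0, .rw conjGamAntipodeGamL 0, .rw
  oneMul 0] []

def comulGamConjCommuteMul : Rule := ⟨[.h 2, .h 3, .h 4], [.h 0, .h 1], [.comul 2 5 6, .gam 7 8,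
  .en .f 7 9, .mul 6 3 10, .mul 9 10 0, .mul 5 4 11, .mul 8 11 1], [.comul 2 5 6, .gam 7 8, .en .f
  7 9, .mul 9 3 10, .mul 5 10 0, .mul 8 4 11, .mul 6 11 1]⟩

instance : Valid D comulGamConjCommuteMul := .prove [.wr mulAssoc 0, .wr mulAssoc 0, .rw
  comulGamConjCommute 0, .rw mulAssoc 0, .rw mulAssoc 0] []

/-- For the inverse of the element in `comulGamConjCommute`, obtained by multiplying with this
inverse on both sides. Since `(S ⊗ id)γ = (id ⊗ S)γ`, this is the intertwining property of `R =
(Ad_σ ⊗ S)γ`. -/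
def comulAntipodeGamConjCommute : Rule := ⟨[.h 2], [.h 0, .h 1], [.comul 2 3 4, .gam 5 6, .en .S 5
  7, .en .f 7 8, .mul 8 3 0, .mul 6 4 1], [.comul 2 3 4, .gam 5 6, .en .S 5 7, .en .f 7 8, .mul 4
  8 0, .mul 3 6 1]⟩

instance : Valid D comulAntipodeGamConjCommute := .prove [.ins mulOne 0, .rw mulAssoc 0, .ins
  mulOne 1, .rw mulAssoc 0, .wr conjGamGamAntipode 0, .wr comulGamConjCommuteMul 0, .rw
  conjGamAntipodeGamKL 0] []

/-- Products of the two legs of a twisted copairing, analogues of the Drinfeld element, here and in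
`gamConjAntipode`. They are monomials in `σ` and `g`, which allows `c` and its inverse to be
compared in degrees 110. -/
def gamSwapConjAntipode : Rule := ⟨[], [.h 0], [.gam 1 2, .en .Si 1 3, .en .f 3 4, .mul 2 4 0],
  [.pt .si 1, .pt .si 2, .pt .gi 3, .mul 2 3 4, .mul 1 4 0]⟩

instance : Valid D gamSwapConjAntipode := .prove [.ins mulOne 0, .wr sMulSi 0, .wr mulAssoc 0, .rw
  mulAssoc 0, .rw gamSwapSPt 0, .rw mulAssoc 0, .rw gMulSi 0] []

def gamAntipodeSiPt : Rule := ⟨[], [.h 0], [.gam 1 2, .en .S 1 3, .en .S 3 4, .en .fi 2 5, .mul 4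
  5 0], [.pt .s 1, .pt .s 2, .pt .g 3, .mul 2 3 4, .mul 1 4 0]⟩

instance : Valid D gamAntipodeSiPt := .prove [.ins mulOne 0, .wr siMulS 0, .wr mulAssoc 0, .rw
  mulAssoc 0, .rw gamSiPtRight 0, .rw mulAssoc 0, .rw giMulS 0] []

def gamConjAntipode : Rule := ⟨[], [.h 0], [.gam 1 2, .en .S 1 3, .en .S 3 4, .en .f 4 5, .mul 5 2
  0], [.pt .s 1, .pt .s 2, .pt .gi 3, .mul 2 3 4, .mul 1 4 0]⟩

instance : Valid D gamConjAntipode := .prove [.ins fFi 2, .wr mulF 0, .rw gamAntipodeSiPt 0, .rw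
  mulF 0, .rw ptFS 0, .rw sMul 1, .rw mulF 0, .rw ptFG 0, .rw ptFS 0, .rw mulF 0, .rw ptFGi 0, .rw
  ptFS 0, .rw mulAssoc 0, .rw gMulS 0] []

def gamConjAntipodeMul : Rule := ⟨[.h 1], [.h 0], [.gam 2 3, .en .S 2 4, .en .S 4 5, .en .f 5 6,
  .mul 3 1 7, .mul 6 7 0], [.pt .s 2, .pt .s 3, .pt .gi 4, .mul 4 1 5, .mul 3 5 6, .mul 2 6 0]⟩

instance : Valid D gamConjAntipodeMul := .prove [.wr mulAssoc 0, .rw gamConjAntipode 0, .rw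
  mulAssoc 0, .rw sMulMul 0, .rw sMul 1, .rw mulF 0, .rw ptFGi 0, .rw ptFS 0, .rw mulAssoc 0, .rw
  gMulMul 0, .rw sMulMul 0, .rw conjConjConj 0, .rw antipodeFi 0, .rw antipodeFi 0, .rw fFi 0, .rw
  gMulS 0] [.rw giMul 0, .rw sMulMul 1, .rw sMulMul 0, .rw antipodeInvF 0, .rw antipodeF 0, .rw
  antipodeInvF 0, .rw conjConjConj 0, .rw antipodeF 0, .rw fiF 0]

def gamSwapConjAntipodeMul : Rule := ⟨[.h 1], [.h 0], [.gam 2 3, .en .Si 2 4, .en .f 4 5, .mul 5 1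
  6, .mul 3 6 0], [.pt .si 2, .pt .si 3, .pt .gi 4, .mul 4 1 5, .mul 3 5 6, .mul 2 6 0]⟩

instance : Valid D gamSwapConjAntipodeMul := .prove [.wr mulAssoc 0, .rw gamSwapConjAntipode 0,
  .rw mulAssoc 0, .rw siMulMul 0, .rw siMul 1, .rw mulFi 0, .rw ptFiGi 0, .rw ptFiSi 0, .rw
  mulAssoc 0, .rw gMulMul 0, .rw siMulMul 0, .rw antipodeF 0, .rw antipodeF 0, .rw antipodeInvF 0,
  .rw antipodeFi 0, .rw antipodeInvF 0, .rw antipodeFi 0, .rw fFi 0, .rw fiF 0, .rw gMulSi 0] [.rw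
  giMul 0, .rw siMulMul 1, .rw siMulMul 0, .rw conjInvConjInv 0, .rw antipodeInvF 0, .rw antipodeF
  0, .rw antipodeInvF 0, .rw conjConjConj 0, .rw antipodeF 0, .rw fiF 0]

def antipodeInvAntipodeInvLeftComulMul : Rule := ⟨[.h 2, .h 3], [.h 0, .h 1], [.comul 2 4 5,
  .comul 5 6 1, .en .Si 4 7, .en .Si 6 8, .en .Si 8 9, .mul 9 3 10, .mul 7 10 0], [.en .id 3 0,
  .en .id 2 1]⟩

instance : Valid D antipodeInvAntipodeInvLeftComulMul := .prove [.wr mulAssoc 0, .wr mulSi 0, .rw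
  antipodeInvLeftComul 0, .rw oneSi 0, .rw oneMul 0] []

def fourierSFourierSi : Rule := ⟨[.h 1], [.h 0], [.en .F 1 2, .en .f 2 3, .pt .s 4, .mul 3 4 5,
  .en .F 5 0], [.sc true, .sc true, .pt .si 2, .mul 1 2 3, .en .F 3 4, .pt .si 5, .mul 4 5 0]⟩

instance : Valid D fourierSFourierSi := .prove [.wr sMul 0, .rw fourierSFourier 0] []

def fourierSiFourierS : Rule := ⟨[.h 1], [.h 0], [.en .om 1 2, .en .F 2 3, .en .fi 3 4, .pt .si 5,
  .mul 4 5 6, .en .F 6 0], [.sc false, .sc false, .pt .s 2, .mul 1 2 3, .en .F 3 4, .pt .s 5, .mul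
  4 5 0]⟩

instance : Valid D fourierSiFourierS := .prove [.wr siMul 0, .wr omFourier 0, .rw fourierSiFourier
  0] []

def gamGamAntipodeSwap : Rule := ⟨[], [.h 0, .h 1], [.gam 2 3, .gam 4 5, .en .S 2 6, .mul 6 5 0,
  .pt .g 7, .pt .gi 8, .mul 8 3 9, .mul 4 9 10, .mul 7 10 1], [.pt .one 0, .pt .one 1]⟩

instance : Valid D gamGamAntipodeSwap := .prove [.rw gMulGamMul 0, .rw gamAntipode 0, .rw
  gamAntipode 0, .rw gMulGiMul 0, .wr mulS 0, .rw gamInvLeft 0, .rw oneS 0] []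

end
end HopfExt

namespace HopfExt

/-! ### Syntax of the category `Ext H` -/

/-- Shapes with a degree; those of degree 0 have an action of `H`. -/
inductive Ob
  | m (A : Sh) (a : Ex (.t .H A) A)
  | v (U : Sh)

namespace Ex

/-- The morphism `actTwo`. -/
def actTwoE (c : Ex .one (.t .H .H)) {A B : Sh} (a : Ex (.t .H A) A) (b : Ex (.t .H B) B) :
    Ex (.t A B) (.t A B) :=
  .lu' (.t A B) ⨟ .whR c (.t A B) ⨟ tensorMu .H .H A B ⨟ .tens a b

/-- The diagonal action. -/
def diagE {A B : Sh} (a : Ex (.t .H A) A) (b : Ex (.t .H B) B) : Ex (.t .H (.t A B)) (.t A B) :=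
  .whR .comul (.t A B) ⨟ tensorMu .H .H A B ⨟ .tens a b

/-- The action on a free module. -/
def freeE (U : Sh) : Ex (.t .H (.t .H U)) (.t .H U) := .al' .H .H U ⨟ .whR .mul U

/-- The trivial action. -/
def trivE : Ex (.t .H .one) .one := .ru .H ⨟ .cov .eps

/-- The morphism `assoc010`. -/
def assoc010E (c : Ex .one (.t .H .H)) {A B : Sh} (a : Ex (.t .H A) A) (V : Sh) (b : Ex (.t .H B) B) :
    Ex (.t A (.t V B)) (.t (.t A V) B) :=
  .whL A (.br V B) ⨟ .al' A B V ⨟ .whR (actTwoE c a b) V ⨟ .al A B V ⨟ .whL A (.br B V) ⨟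
    .al' A V B

/-- The morphism `swapAct`. -/
def swapActE {A : Sh} (a : Ex (.t .H A) A) : Ex (.t A .H) (.t .H A) :=
  .whL A .comul ⨟ .br A (.t .H .H) ⨟ .whR (.br .H .H) A ⨟ .al .H .H A ⨟
    .whL .H (.whR (.en .Si) A ⨟ a)

/-- The morphism `assoc011`. -/
def assoc011E {A : Sh} (a : Ex (.t .H A) A) (U V : Sh) :
    Ex (.t A (.t .H (.t U V))) (.t .H (.t (.t A U) V)) :=
  .al' A .H (.t U V) ⨟ .whR (swapActE a) (.t U V) ⨟ .al .H A (.t U V) ⨟ .whL .H (.al' A U V)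

/-- The morphism `twistAct`, with `e` in place of the left multiplication by `g`. -/
def twistActE (e : Ex .H .H) {A : Sh} (a : Ex (.t .H A) A) : Ex (.t .H A) (.t .H A) :=
  .whL .H (.lu' A ⨟ .whR (.gam ⨟ .br .H .H ⨟ .whL .H e) A ⨟ .al .H .H A) ⨟
    .al' .H .H (.t .H A) ⨟ .tens .mul a

/-- The morphism `assoc101`, with `e` in place of the left multiplication by `g`. -/
def assoc101E (e : Ex .H .H) (U : Sh) {A : Sh} (a : Ex (.t .H A) A) (V : Sh) :
    Ex (.t .H (.t U (.t A V))) (.t .H (.t (.t U A) V)) :=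
  .whL .H (.al' U A V ⨟ .whR (.br U A) V ⨟ .al A U V) ⨟ .al' .H A (.t U V) ⨟
    .whR (twistActE e a) (.t U V) ⨟ .al .H A (.t U V) ⨟
    .whL .H (.al' A U V ⨟ .whR (.br A U) V)

/-- The morphism `assoc110`. -/
def assoc110E (U V : Sh) {A : Sh} (a : Ex (.t .H A) A) :
    Ex (.t .H (.t U (.t V A))) (.t (.t .H (.t U V)) A) :=
  .tens .comul (.al' U V A) ⨟ tensorMu .H .H (.t U V) A ⨟ .whL (.t .H (.t U V)) a

/-- The inverse of `assoc011`. -/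
def assoc011InvE {A : Sh} (a : Ex (.t .H A) A) (U V : Sh) :
    Ex (.t .H (.t (.t A U) V)) (.t A (.t .H (.t U V))) :=
  .whL .H (.al A U V) ⨟ .al' .H A (.t U V) ⨟
    .whR (.whR .comul A ⨟ .al .H .H A ⨟ .whL .H (.br .H A) ⨟ .al' .H A .H ⨟ .whR a .H) (.t U V) ⨟
    .al A .H (.t U V)

/-- The inverse of `assoc110`. -/
def assoc110InvE (U V : Sh) {A : Sh} (a : Ex (.t .H A) A) :
    Ex (.t (.t .H (.t U V)) A) (.t .H (.t U (.t V A))) :=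
  .whR (.whR (.comul ⨟ .whL .H (.en .S)) (.t U V)) A ⨟ .al (.t .H .H) (.t U V) A ⨟
    tensorMu .H .H (.t U V) A ⨟ .whL (.t .H (.t U V)) a ⨟ .al .H (.t U V) A ⨟ .whL .H (.al U V A)

/-- The inverse of `assoc111`. -/
def assoc111InvE (U V W : Sh) : Ex (.t (.t .H (.t U V)) W) (.t U (.t .H (.t V W))) :=
  .al .H (.t U V) W ⨟ .whL .H (.al U V W) ⨟ .al' .H U (.t V W) ⨟
    .whR (.whR (.en .S ⨟ fourierE ⨟ lmulE .g) U ⨟ .br .H U) (.t V W) ⨟ .al U .H (.t V W)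

/-- The morphism `assoc111`. -/
def assoc111E (U V W : Sh) : Ex (.t U (.t .H (.t V W))) (.t (.t .H (.t U V)) W) :=
  .al' U .H (.t V W) ⨟ .whR (.br U .H ⨟ .whR fourierE U) (.t V W) ⨟
    .al .H U (.t V W) ⨟ .whL .H (.al' U V W) ⨟ .al' .H (.t U V) W

/-- The morphism `actPt`. -/
def actPtE (p : Pt) {A : Sh} (a : Ex (.t .H A) A) : Ex A A := .lu' A ⨟ .whR (.pt p) A ⨟ a

/-- The morphism `scal`. -/
def scalE (p : Bool) {A B : Sh} (e : Ex A B) : Ex A B := .lu' A ⨟ .tens (.sc p) e ⨟ .lu B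

/-- The natural automorphism, on a shape. -/
def omE : (A : Sh) → Ex A A
  | .one => .id .one
  | .H => .en .om
  | .X i => .omx i
  | .t A B => .tens (omE A) (omE B)

end Ex

namespace Ob

/-- The underlying shape. -/
@[reducible] def sh : Ob → Sh
  | m A _ => A
  | v U => U

/-- The tensor product. -/
@[reducible] def t : Ob → Ob → Ob
  | m A a, m B b => m (.t A B) (Ex.diagE a b)
  | m A _, v V => v (.t A V)
  | v U, m B _ => v (.t U B)
  | v U, v V => m (.t .H (.t U V)) (Ex.freeE (.t U V))

/-- The tensor unit. -/
@[reducible] def one : Ob := m .one Ex.trivE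

/-- An atomic object of degree 0. -/
@[reducible] def mx (i : ℕ) : Ob := m (.X i) (.act i)

/-- An atomic object of degree 1. -/
@[reducible] def vx (i : ℕ) : Ob := v (.X i)

/-- The action on an object of degree 0. -/
def action : (X : Ob) → Ex (.t .H X.sh) X.sh
  | m _ a => a
  | v U => .whR (.cov .eps) U ⨟ .lu U

end Ob

/-- Syntax of morphisms that preserve the degree. -/
inductive Mor : Ob → Ob → Type
  | m {A B : Sh} {a b} (e : Ex A B) : Mor (.m A a) (.m B b)
  | v {U V : Sh} (e : Ex U V) : Mor (.v U) (.v V)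

namespace Mor

/-- The underlying morphism. -/
def ex : {X Y : Ob} → Mor X Y → Ex X.sh Y.sh
  | _, _, m e => e
  | _, _, v e => e

/-- The identity. -/
def id : (X : Ob) → Mor X X
  | .m A _ => m (.id A)
  | .v U => v (.id U)

/-- Composition. -/
def comp : {X Y Z : Ob} → Mor X Y → Mor Y Z → Mor X Z
  | _, _, _, m e, m f => m (e ⨟ f)
  | _, _, _, v e, v f => v (e ⨟ f)

infixr:80 " ⨾ " => Mor.comp

/-- The tensor product. -/
def tens : {X X' Y Y' : Ob} → Mor X X' → Mor Y Y' → Mor (X.t Y) (X'.t Y')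
  | _, _, _, _, m e, m f => m (.tens e f)
  | _, _, _, _, m e, v f => v (.tens e f)
  | _, _, _, _, v e, m f => v (.tens e f)
  | _, _, _, _, v e, v f => m (.whL .H (.tens e f))

/-- The left unitor. -/
def lunit : (X : Ob) → Mor (Ob.one.t X) X
  | .m A _ => m (.lu A)
  | .v U => v (.lu U)

/-- The right unitor. -/
def runit : (X : Ob) → Mor (X.t .one) X
  | .m A _ => m (.ru A)
  | .v U => v (.ru U)

/-- The associativity isomorphism. -/
def assoc : (X Y Z : Ob) → Mor (X.t (Y.t Z)) ((X.t Y).t Z)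
  | .m A _, .m B _, .m C _ => m (.al' A B C)
  | .m A _, .m B _, .v W => v (.al' A B W)
  | .m _ a, .v V, .m _ c => v (.assoc010E .gam a V c)
  | .m _ a, .v V, .v W => m (.assoc011E a V W)
  | .v U, .m B _, .m C _ => v (.al' U B C)
  | .v U, .m _ b, .v W => m (.assoc101E (.lmulE .g) U b W)
  | .v U, .v V, .m _ c => m (.assoc110E U V c)
  | .v U, .v V, .v W => v (.assoc111E U V W)

/-- The inverse of the associativity isomorphism. -/
def assocInverse : (X Y Z : Ob) → Mor ((X.t Y).t Z) (X.t (Y.t Z))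
  | .m A _, .m B _, .m C _ => m (.al A B C)
  | .m A _, .m B _, .v W => v (.al A B W)
  | .m _ a, .v V, .m _ c => v (.al _ _ _ ⨟
    .assoc010E (.gam ⨟ .whR (.en .S) .H) a V c ⨟ .al _ _ _)
  | .m _ a, .v V, .v W => m (.assoc011InvE a V W)
  | .v U, .m B _, .m C _ => v (.al U B C)
  | .v U, .m _ b, .v W => m (.whL .H (.al _ _ _) ⨟
    .assoc101E (.en .Si ⨟ .rmulE .gi) U b W ⨟ .whL .H (.al _ _ _))
  | .v U, .v V, .m _ c => m (.assoc110InvE U V c)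
  | .v U, .v V, .v W => v (.assoc111InvE U V W)

/-- The braiding isomorphism. -/
def braid : (X Y : Ob) → Mor (X.t Y) (Y.t X)
  | .m A a, .m B b => m (Ex.actTwoE (.gam ⨟ .tens (.lmulE .s ⨟ .rmulE .si) (.en .S)) a b ⨟ .br A B)
  | .m A a, .v V => v (.whR (.actPtE .s a) V ⨟ .br A V)
  | .v U, .m B b => v (.whL U (.omE B ⨟ .actPtE .s b) ⨟ .br U B)
  | .v U, .v V => m (.scalE true (.tens (.rmulE .si) (.whL U (.omE V) ⨟ .br U V)))

/-- The inverse braiding. -/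
def braidInverse : (X Y : Ob) → Mor (X.t Y) (Y.t X)
  | .m A a, .m B b => m (.br A B ⨟ Ex.actTwoE (.gam ⨟ .whR (.lmulE .s ⨟ .rmulE .si) .H) b a)
  | .m A a, .v V => v (.whR (.omE A ⨟ .actPtE .si a) V ⨟ .br A V)
  | .v U, .m B b => v (.whL U (.actPtE .si b) ⨟ .br U B)
  | .v U, .v V => m (.scalE false (.tens (.rmulE .s) (.whR (.omE U) V ⨟ .br U V)))

/-- The rule for the linearity of a morphism. -/
def linearRule {X Y : Ob} (f : Mor X Y) : Rule :=
  Ex.rule (X.action ⨟ f.ex) (.whL .H f.ex ⨟ Y.action)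

/-- The rule for the pentagon identity. -/
def pentagonRule (W X Y Z : Ob) : Rule :=
  Ex.rule ((id W).tens (assoc X Y Z) ⨾ assoc W (X.t Y) Z ⨾ (assoc W X Y).tens (id Z)).ex
    (assoc W X (Y.t Z) ⨾ assoc (W.t X) Y Z).ex

/-- The rule for the triangle identity. -/
def triangleRule (X Y : Ob) : Rule :=
  Ex.rule (assoc X .one Y ⨾ (runit X).tens (id Y)).ex ((id X).tens (lunit Y)).ex

/-- The rule for the hexagon identity for a family of morphisms. -/
def hexagonRule (c : (X Y : Ob) → Mor (X.t Y) (Y.t X)) (X Y Z : Ob) : Rule :=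
  Ex.rule ((id X).tens (c Y Z) ⨾ assoc X Z Y ⨾ (c X Z).tens (id Y)).ex
    (assoc X Y Z ⨾ c (X.t Y) Z ⨾ assoc Z X Y).ex

/-- The rule that says that a composite is the identity. -/
def inverseRule {X Y : Ob} (f : Mor X Y) (f' : Mor Y X) : Rule :=
  Ex.rule (f ⨾ f').ex (id X).ex

end Mor

end HopfExt

namespace HopfExt

section

variable {S : Type u} [Category.{v} S] [MonoidalCategory S] [SymmetricCategory S]
variable {H : S} [HopfObj H] (D : Data H) [D.Lawful]

set_option synthInstance.maxSize 1024
set_option synthInstance.maxHeartbeats 200000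

/-! ### The coherence equations

The digits in a name are the degrees of the objects. -/

namespace Mor

theorem pentagon0000 : Valid D (pentagonRule (.mx 0) (.mx 1) (.mx 2) (.mx 3)) := .prove [] []

theorem pentagon0001 : Valid D (pentagonRule (.mx 0) (.mx 1) (.mx 2) (.vx 3)) := .prove [] []

theorem pentagon0010 : Valid D (pentagonRule (.mx 0) (.mx 1) (.vx 2) (.mx 3)) := .prove [.wr
  actMul 0] [.rw gamComulLeft 0]

theorem pentagon0011 : Valid D (pentagonRule (.mx 0) (.mx 1) (.vx 2) (.vx 3)) := .prove [] [.rw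
  comulSi 0, .rw comulAssoc 0]

theorem pentagon0100 : Valid D (pentagonRule (.mx 0) (.vx 1) (.mx 2) (.mx 3)) := .prove [.wr
  actMul 0] [.rw gamComulRight 0]

/-- Along one path two copairings arise, with legs in opposite order. The factor `g` in the
associator in degrees 101 turns one into the inverse of the other. -/
theorem pentagon0101 : Valid D (pentagonRule (.mx 0) (.vx 1) (.mx 2) (.vx 3)) := .prove [.wr
  actMul 0, .wr actMul 0, .rw mulComul 0, .rw gamComulRight 0, .rw mulSi 0, .rw gamAntipodeInv 0,
  .rw gamGamSwapKL 0] []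

theorem pentagon0110 : Valid D (pentagonRule (.mx 0) (.vx 1) (.vx 2) (.mx 3)) := .prove [.rw
  comulAssoc 0] []

theorem pentagon0111 : Valid D (pentagonRule (.mx 0) (.vx 1) (.vx 2) (.vx 3)) := .prove [.wr
  fourierEq 0] [.wr fourierEq 0, .rw fourierGamRight 0]

theorem pentagon1000 : Valid D (pentagonRule (.vx 0) (.mx 1) (.mx 2) (.mx 3)) := .prove [] []

theorem pentagon1001 : Valid D (pentagonRule (.vx 0) (.mx 1) (.mx 2) (.vx 3)) := .prove [.rw
  mulComul 0, .rw gamComulLeft 0, .rw comulG 0] [.rw mulAssoc 0]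

theorem pentagon1010 : Valid D (pentagonRule (.vx 0) (.mx 1) (.vx 2) (.mx 3)) := .prove [.wr
  actMul 0, .wr actMul 0, .rw mulAssoc 0] [.rw mulComul 0, .rw gamComulRight 0]

/-- The coproduct from degrees 011 passes through `F` by `fourierComulInv`, and the resulting
copairing cancels the one from degrees 101. -/
theorem pentagon1011 : Valid D (pentagonRule (.vx 0) (.mx 1) (.vx 2) (.vx 3)) := .prove [.wr
  fourierEq 0, .wr actMul 0, .rw mulAssoc 0, .rw fourierComulInv 0, .rw mulAssoc 0, .rw
  gamGamAntipodeSwap 0, .rw actOne 0, .rw mulOne 0] [.wr fourierEq 0]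

theorem pentagon1100 : Valid D (pentagonRule (.vx 0) (.vx 1) (.mx 2) (.mx 3)) := .prove [.rw
  comulAssoc 0] []

theorem pentagon1101 : Valid D (pentagonRule (.vx 0) (.vx 1) (.mx 2) (.vx 3)) := .prove [.wr
  fourierEq 0, .wr actMul 0, .rw fourierMulGam 0, .rw comulAssoc 0, .rw antipodeRight 0, .rw
  actOne 0, .rw comulCounit 0] [.wr fourierEq 0]

theorem pentagon1110 : Valid D (pentagonRule (.vx 0) (.vx 1) (.vx 2) (.mx 3)) := .prove [.wr
  fourierEq 0, .rw fourierComul 0] [.wr fourierEq 0]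

/-- Fourier inversion: one path contains two transforms with the factor `g` between them, the other
one contains `S⁻¹`. -/
theorem pentagon1111 : Valid D (pentagonRule (.vx 0) (.vx 1) (.vx 2) (.vx 3)) := .prove [.wr
  fourierEq 0, .wr fourierEq 0, .rw mulAssoc 0, .wr fourierComul 0, .rw fourierGFourier 0] [.rw
  mulComul 0, .rw mulSi 0, .rw mulAssoc 0, .rw antipodeInvLeftComul 0, .rw mulOne 0]

theorem linear000 : Valid D (linearRule (assoc (.mx 0) (.mx 1) (.mx 2))) := .prove [] [.rw
  comulAssoc 0]

/-- The coproduct of the first leg of `R = (Ad_σ ⊗ S)γ` is a product of two copies of `R`. The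
inverse braiding requires the analogue for the other leg. -/
theorem hexagon000 : Valid D (hexagonRule braid (.mx 0) (.mx 1) (.mx 2)) := .prove [.rw sMul 0,
  .rw sMul 0, .wr actMul 0, .rw gamAntipode 0, .rw gamAntipode 0, .rw mulAssoc 0, .rw sMulSi 0,
  .rw mulOne 0, .rw mulAssoc 0, .rw sMulSi 0, .rw mulOne 0] (.rw sMul 0 :: [.rw gamAntipode 0, .rw
  mulComul 0, .rw comulPtSi 0, .rw siMul 0, .rw gamConjInv 0, .rw antipodeFi 0, .rw SSi 0, .rw
  mulComul 0, .rw comulF 0, .rw comulPtS 0, .rw sMul 0, .rw comulS 0, .rw gamComulLeft 0, .rw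
  mulAssoc 0, .rw mulAssoc 0, .rw sMulMul 0, .rw gamConj 0, .rw conjOm 0, .rw SOm 0, .rw omOm 0,
  .rw fiF 0, .rw sMulSi 0, .rw mulOne 0, .rw mulAssoc 0, .rw mulAssoc 0, .rw sMulMul 0, .rw
  conjGamGamAntipodeK 0, .rw sMulSi 0, .rw mulOne 0, .rw mulOne 0])

theorem hexagonInv000 : Valid D (hexagonRule braidInverse (.mx 0) (.mx 1) (.mx 2)) := .prove [.rw
  sMul 0, .rw sMul 0, .wr actMul 0, .rw mulAssoc 0, .rw sMulSi 0, .rw mulOne 0, .rw mulAssoc 0,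
  .rw sMulSi 0, .rw mulOne 0] [.rw sMul 0, .rw gamComulRight 0, .rw mulF 0, .rw mulAssoc 0, .rw
  mulAssoc 0, .rw mulAssoc 0, .rw sMulSi 0, .rw mulOne 0]

theorem hexagon001 : Valid D (hexagonRule braid (.mx 0) (.mx 1) (.vx 2)) := .prove [.wr actMul 0,
  .wr actMul 0, .rw sMul 0] [.rw comulPtS 0, .rw sMul 0]

theorem hexagonInv001 : Valid D (hexagonRule braidInverse (.mx 0) (.mx 1) (.vx 2)) := .prove [.rw
  actOm 1, .wr actMul 0, .wr actMul 0, .rw siMul 0] [.rw comulPtSi 0, .rw siMul 0, .rw gamConjInv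
  0, .rw antipodeFi 0, .rw SSi 0]

theorem hexagon010 : Valid D (hexagonRule braid (.mx 0) (.vx 1) (.mx 2)) := .prove [.rw sMul 0,
  .wr actMul 0, .rw gamAntipode 0, .rw mulAssoc 0, .rw sMulSi 0, .rw mulOne 0] [.rw actOm 0, .wr
  actMul 0, .rw sMul 0, .rw gamOmLeft 0, .rw gamConj 0, .rw conjOm 0, .rw SOm 0, .rw omOm 0]

theorem hexagonInv010 : Valid D (hexagonRule braidInverse (.mx 0) (.vx 1) (.mx 2)) := .prove [.rw
  sMul 0, .wr actMul 0, .rw mulAssoc 0, .rw sMulSi 0, .rw mulOne 0, .rw gamSwapRight 0, .rw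
  conjConjConj 0, .rw gamConjInv 0] [.wr actMul 0, .rw siMul 0, .rw gamConjInv 0]

theorem assocInv010 : Valid D (inverseRule (assoc (.mx 0) (.vx 1) (.mx 2)) (assocInverse (.mx 0)
  (.vx 1) (.mx 2))) := .prove [.wr actMul 0, .wr actMul 0, .rw gamInvLeft 0, .rw actOne 0, .rw
  actOne 0] []

theorem invAssoc010 : Valid D (inverseRule (assocInverse (.mx 0) (.vx 1) (.mx 2)) (assoc (.mx 0)
  (.vx 1) (.mx 2))) := .prove [.wr actMul 0, .wr actMul 0, .rw gamGamAntipode 0, .rw actOne 0, .rw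
  actOne 0] []

theorem linear011 : Valid D (linearRule (assoc (.mx 0) (.vx 1) (.vx 2))) := .prove [.wr actMul 0,
  .rw mulComul 0, .rw mulSi 0, .rw mulAssoc 0, .rw antipodeInvLeftComul 0, .rw mulOne 0] []

theorem hexagon011 : Valid D (hexagonRule braid (.mx 0) (.vx 1) (.vx 2)) := .prove (.wr actMul 0
  :: [.rw sMul 0, .rw mulComul 0, .rw comulPtSi 0, .rw siMul 0, .rw gamConjInv 0, .rw antipodeFi
  0, .rw mulSi 0, .rw mulF 0, .rw mulSi 0, .rw antipodeInvFi 0, .rw mulF 0, .rw fFi 0, .rw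
  antipodeInvSi 0, .rw mulF 0, .rw ptFG 0, .rw ptFSi 0, .rw SSi 0, .rw mulAssoc 0, .rw mulAssoc 0,
  .rw siMulMul 0, .rw siMul 0, .rw mulFi 0, .rw ptFiGi 0, .rw fiF 0, .rw mulAssoc 0, .rw mulAssoc
  0, .rw mulAssoc 0, .rw mulAssoc 0, .rw siMulS 0, .rw mulOne 0]) [.wr actMul 0, .rw mulAssoc 0,
  .rw siMul 0, .rw gamConjInv 0, .rw mulAssoc 0]

theorem hexagonInv011 : Valid D (hexagonRule braidInverse (.mx 0) (.vx 1) (.vx 2)) := .prove (.rw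
  actOm 0 :: .wr actMul 0 :: .rw siMul 0 :: .rw SiOm 0 :: [.rw mulComul 0, .rw mulOm 0, .rw
  comulPtS 0, .rw sMul 0, .rw mulOm 0, .rw conjOm 0, .rw sOm 0, .rw mulSi 0, .rw mulFi 0, .rw
  mulSi 0, .rw antipodeInvF 0, .rw mulFi 0, .rw fiF 0, .rw antipodeInvS 0, .rw mulFi 0, .rw ptFiG
  0, .rw ptFiS 0, .rw mulAssoc 0, .rw mulAssoc 0, .rw sMulMul 0, .rw sMul 0, .rw fFi 0, .rw mulF
  0, .rw ptFGi 0, .rw mulAssoc 0, .rw mulAssoc 0, .rw mulAssoc 0, .rw mulAssoc 0, .rw sMulSi 0,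
  .rw mulOne 0]) [.rw actOm 0, .wr actMul 0, .rw SiOm 0, .rw mulAssoc 0, .rw sMul 0, .rw gamConj
  0, .rw mulAssoc 0]

theorem assocInv011 : Valid D (inverseRule (assoc (.mx 0) (.vx 1) (.vx 2)) (assocInverse (.mx 0)
  (.vx 1) (.vx 2))) := .prove [.wr actMul 0, .rw antipodeInvRightComul 0, .rw actOne 0] []

theorem invAssoc011 : Valid D (inverseRule (assocInverse (.mx 0) (.vx 1) (.vx 2)) (assoc (.mx 0)
  (.vx 1) (.vx 2))) := .prove [.wr actMul 0, .rw antipodeInvLeftComul 0, .rw actOne 0] []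

theorem hexagon100 : Valid D (hexagonRule braid (.vx 0) (.mx 1) (.mx 2)) := .prove [.rw sMul 0,
  .rw actOm 0, .wr actMul 0, .rw sMul 0, .rw SOm 0, .rw gamOmLeft 0, .rw gamAntipode 0, .rw
  gamConj 0, .rw SOm 0, .rw conjOm 0, .rw SOm 0, .rw omOm 0, .rw antipodeF 0, .rw SSi 0, .rw
  mulAssoc 0, .rw sMulSi 0, .rw mulOne 0, .rw gamSwapRight 0, .rw conjConjConj 0, .rw gamConjInv
  0, .rw gamConj 0, .rw conjOm 0, .rw SOm 0, .rw omOm 0, .rw antipodeF 0, .rw fiF 0, .rw SSi 0]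
  [.wr actMul 0]

theorem hexagonInv100 : Valid D (hexagonRule braidInverse (.vx 0) (.mx 1) (.mx 2)) := .prove [.rw
  sMul 0, .wr actMul 0, .rw siMulMul 0, .rw mulFi 0, .rw ptFiS 0, .rw fiF 0, .rw mulAssoc 0, .rw
  sMulSiMul 0] [.wr actMul 0]

theorem assocInv100 : Valid D (inverseRule (assoc (.vx 0) (.mx 1) (.mx 2)) (assocInverse (.vx 0)
  (.mx 1) (.mx 2))) := .prove [] []

theorem invAssoc100 : Valid D (inverseRule (assocInverse (.vx 0) (.mx 1) (.mx 2)) (assoc (.vx 0)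
  (.mx 1) (.mx 2))) := .prove [] []

theorem linear101 : Valid D (linearRule (assoc (.vx 0) (.mx 1) (.vx 2))) := .prove [.rw mulAssoc
  0] []

theorem hexagon101 : Valid D (hexagonRule braid (.vx 0) (.mx 1) (.vx 2)) := .prove [.wr actMul 0]
  (.rw gMul 0 :: .wr actMul 0 :: .rw antipodeF 0 :: .rw antipodeF 0 :: .rw antipodeInvF 0 :: .rw
  antipodeInvF 0 :: .rw mulComul 0 :: .rw comulPtSi 0 :: .rw siMul 0 :: .rw gamConjInv 0 :: .rw
  antipodeFi 0 :: .rw SSi 0 :: .rw mulComul 0 :: .rw gamComulRight 0 :: .rw mulS 0 :: .rw mulS 0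
  :: [.rw mulF 0, .rw mulF 0, .rw mulAssoc 0, .rw mulAssoc 0, .rw mulAssoc 0, .rw mulAssoc 0, .rw
  mulAssoc 0, .rw mulAssoc 0, .rw siMulMul 0, .rw siMulMul 0, .rw fiF 0, .rw fiF 0, .rw gamSwap 1,
  .rw gamAntipode 0, .rw gamAntipode 0, .rw gamConj 0, .rw antipodeF 0, .rw antipodeF 0, .rw
  conjConjConj 0, .rw SSi 0, .rw conjOmGamSwapInvKL 0, .rw gamSwap 0, .rw gamAntipode 0, .rw
  gamAntipode 0, .rw gamConj 0, .rw antipodeF 0, .rw antipodeF 0, .rw conjConjConj 0, .rw SSi 0,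
  .rw gamSiPtConjG 0])

theorem hexagonInv101 : Valid D (hexagonRule braidInverse (.vx 0) (.mx 1) (.vx 2)) := .prove [.wr
  actMul 0] (.rw gMul 0 :: .rw actOm 0 :: .wr actMul 0 :: .rw mulOm 0 :: .rw gOm 0 :: .rw SOm 0 ::
  .rw SOm 0 :: .rw conjOm 0 :: .rw conjOm 0 :: .rw antipodeF 0 :: .rw antipodeF 0 :: .rw
  antipodeInvF 0 :: .rw antipodeInvF 0 :: .rw mulComul 0 :: .rw comulPtS 0 :: .rw sMul 0 :: .rw
  mulComul 0 :: .rw gamComulRight 0 :: .rw mulOm 0 :: .rw mulS 0 :: .rw mulS 0 :: .rw mulF 0 ::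
  .rw mulF 0 :: .rw mulAssoc 0 :: .rw mulAssoc 0 :: .rw mulAssoc 0 :: .rw mulAssoc 0 :: .rw
  mulAssoc 0 :: .rw mulAssoc 0 :: .rw sMulMul 0 :: .rw sMulMul 0 :: .rw conjConjConj 0 :: .rw
  conjConjConj 0 :: [.rw gamSwap 1, .rw gamOmLeft 0, .rw gamAntipode 0, .rw SOm 0, .rw gamAntipode
  0, .rw gamConjInv 0, .rw SOm 0, .rw conjInvOm 0, .rw SOm 0, .rw omOm 0, .rw antipodeFi 0, .rw
  antipodeFi 0, .rw fFi 0, .rw SSi 0, .rw conjGamSwapInvKL 0, .rw gamSwap 0, .rw gamOmLeft 0, .rw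
  gamAntipode 0, .rw SOm 0, .rw gamAntipode 0, .rw gamConjInv 0, .rw SOm 0, .rw conjInvOm 0, .rw
  SOm 0, .rw omOm 0, .rw antipodeFi 0, .rw antipodeFi 0, .rw fFi 0, .rw SSi 0, .rw gamSPtConjG 0])

theorem assocInv101 : Valid D (inverseRule (assoc (.vx 0) (.mx 1) (.vx 2)) (assocInverse (.vx 0)
  (.mx 1) (.vx 2))) := .prove [.wr actMul 0, .rw mulAssoc 0, .rw mulAssoc 0, .rw giMulGMul 0, .rw
  gamSwapInv 0, .rw actOne 0, .rw mulOne 0] []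

theorem invAssoc101 : Valid D (inverseRule (assocInverse (.vx 0) (.mx 1) (.vx 2)) (assoc (.vx 0)
  (.mx 1) (.vx 2))) := .prove [.wr actMul 0, .rw mulAssoc 0, .rw mulAssoc 0, .rw gamSwapInvLeftK
  0, .rw gMulGi 0, .rw actOne 0, .rw mulOne 0] []

theorem linear110 : Valid D (linearRule (assoc (.vx 0) (.vx 1) (.mx 2))) := .prove [.rw mulComul
  0] [.wr actMul 0]

/-- The intertwining property of `R` brings the legs of the copairings together. Their product is
evaluated by `gamConjAntipodeMul`, and points are compared in normal form. -/
theorem hexagon110 : Valid D (hexagonRule braid (.vx 0) (.vx 1) (.mx 2)) := .prove [.rw gMul 0,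
  .rw actOm 2, .rw actOm 0, .wr actMul 0, .wr actMul 0, .rw sMulMul 0, .rw sMul 0, .rw omxOmx 0,
  .rw sOm 0, .rw mulOm 0, .rw gOm 0, .rw SOm 0, .rw SOm 0, .rw conjOm 0, .rw conjOm 0, .rw
  antipodeF 0, .rw antipodeF 0, .rw antipodeInvF 0, .rw antipodeInvF 0, .rw ptFS 0, .rw mulF 0,
  .rw conjConjConj 0, .rw ptFG 0, .rw mulAssoc 0, .rw giMulSMul 0, .rw gMulS 0] (.rw sMul 0 :: .wr
  actMul 0 :: .wr actMul 0 :: .rw gamAntipode 0 :: .rw mulAssoc 0 :: .rw sMulSi 0 :: .rw mulOne 0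
  :: .rw comulAntipodeGamConjCommute 0 :: .rw mulComul 0 :: .rw comulF 0 :: .rw mulSi 0 :: .rw
  antipodeInvF 0 :: .rw comulS 0 :: .rw gamComulLeft 0 :: .rw mulAssoc 0 :: .rw
  antipodeInvLeftComulMul 0 :: .rw gamConjAntipodeMul 0 :: .rw giMul 0 :: .rw sMulMul 1 :: .rw
  sMulMul 0 :: .rw gamConj 0 :: .rw gamConj 0 :: .rw conjOm 0 :: .rw SOm 0 :: .rw omOm 0 :: .rw
  antipodeF 0 :: [.rw antipodeF 0, .rw antipodeInvF 0, .rw conjConjConj 0, .rw gamAntipodeInv 0,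
  .rw gamAntipodeInv 0, .rw gamConj 0, .rw gamConj 0, .rw conjOm 0, .rw SOm 0, .rw omOm 0, .rw
  antipodeF 0, .rw antipodeInvF 0, .rw antipodeF 0, .rw antipodeInvF 0, .rw antipodeF 0, .rw
  antipodeF 0, .rw antipodeInvF 0, .rw antipodeInvF 0, .rw antipodeF 0, .rw antipodeF 0, .rw
  antipodeInvF 0, .rw fiF 0, .rw SSi 0, .rw SSi 0, .rw SiS 0, .rw gamSwap 0, .rw gamAntipodeInv 0,
  .rw gamConj 0, .rw antipodeInvF 0, .rw conjConjConj 0])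

theorem hexagonInv110 : Valid D (hexagonRule braidInverse (.vx 0) (.vx 1) (.mx 2)) := .prove [.rw
  gMul 0, .wr actMul 0, .wr actMul 0, .rw siMulMul 0, .rw antipodeF 0, .rw antipodeF 0, .rw
  antipodeInvF 0, .rw antipodeInvF 0, .rw mulFi 0, .rw ptFiG 0, .rw fiF 0, .rw mulAssoc 0, .rw
  giMulSiMul 0, .rw gMulSi 0] (.rw sMul 0 :: .wr actMul 0 :: .wr actMul 0 :: .rw mulComul 0 :: .rw
  gamComulRight 0 :: .rw mulF 0 :: .rw mulSi 0 :: [.rw gamAntipodeInv 0, .rw mulAssoc 0, .rw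
  mulAssoc 0, .rw mulAssoc 0, .rw mulAssoc 0, .rw sMulSi 0, .rw mulOne 0, .rw mulAssoc 0, .rw
  comulAssoc 0, .rw comulGamConjCommute 0, .rw gamSwapConjAntipodeMul 0, .rw giMulMul 0, .rw giMul
  0, .rw siMulMul 1, .rw siMulMul 0, .rw siMulMul 0, .rw siMulMul 0, .rw conjInvConjInv 0, .rw
  conjInvConjInv 0, .rw conjConjConj 0, .rw antipodeInvFi 0, .rw antipodeInvFi 0, .rw antipodeInvF
  0, .rw antipodeF 0, .rw antipodeInvF 0, .rw conjConjConj 0, .rw antipodeF 0, .rw fFi 0, .rw fiF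
  0, .rw antipodeInvAntipodeInvLeftComulMul 0])

theorem assocInv110 : Valid D (inverseRule (assoc (.vx 0) (.vx 1) (.mx 2)) (assocInverse (.vx 0)
  (.vx 1) (.mx 2))) := .prove [.wr actMul 0, .rw comulAssoc 0, .rw antipodeLeft 0, .rw actOne 0,
  .rw comulCounit 0] []

theorem invAssoc110 : Valid D (inverseRule (assocInverse (.vx 0) (.vx 1) (.mx 2)) (assoc (.vx 0)
  (.vx 1) (.mx 2))) := .prove [.wr actMul 0, .rw comulAssoc 0, .rw antipodeRight 0, .rw actOne 0,
  .rw comulCounit 0] []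

/-- The scalar `β²` comes from the two crossings of degree 11 in one path; both act by `ω` on the
last object, so that these cancel. -/
theorem hexagon111 : Valid D (hexagonRule braid (.vx 0) (.vx 1) (.vx 2)) := .prove [.wr fourierEq
  0, .rw omxOmx 0] [.rw sMul 0, .wr fourierEq 0, .wr fourierEq 0, .rw fourierSFourierSi 0]

/-- For the inverse braiding `ω` acts on a product containing `H`, so it stays between the two
transforms. This is why `fourierSiFourier` contains `ω`. -/
theorem hexagonInv111 : Valid D (hexagonRule braidInverse (.vx 0) (.vx 1) (.vx 2)) := .prove [.wr
  fourierEq 0] [.rw siMul 0, .wr fourierEq 0, .wr fourierEq 0, .rw omFourier 0, .rw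
  fourierSiFourierS 0]

theorem assocInv111 : Valid D (inverseRule (assoc (.vx 0) (.vx 1) (.vx 2)) (assocInverse (.vx 0)
  (.vx 1) (.vx 2))) := .prove [.wr fourierEq 0, .wr fourierEq 0, .rw gFourierFourier 0] []

theorem invAssoc111 : Valid D (inverseRule (assocInverse (.vx 0) (.vx 1) (.vx 2)) (assoc (.vx 0)
  (.vx 1) (.vx 2))) := .prove [.wr fourierEq 0, .wr fourierEq 0, .rw fourierGFourierS 0] []

theorem linearBraid00 : Valid D (linearRule (braid (.mx 0) (.mx 1))) := .prove [.rw sMul 0, .wr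
  actMul 0, .wr actMul 0, .rw gamAntipode 0, .rw mulAssoc 0, .rw sMulSi 0, .rw mulOne 0, .rw
  comulAntipodeGamConjCommute 0] [.rw sMul 0, .wr actMul 0, .wr actMul 0, .rw gamAntipode 0, .rw
  mulAssoc 0, .rw sMulSi 0, .rw mulOne 0]

theorem triangle00 : Valid D (triangleRule (.mx 0) (.mx 1)) := .prove [] []

theorem braidInv00 : Valid D (inverseRule (braid (.mx 0) (.mx 1)) (braidInverse (.mx 1) (.mx 0)))
  := .prove [.rw sMul 0, .rw sMul 0, .wr actMul 0, .wr actMul 0, .rw gamAntipode 0, .rw mulAssoc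
  0, .rw sMulSi 0, .rw mulOne 0, .rw mulAssoc 0, .rw conjGamGamAntipodeK 0, .rw actOne 0, .rw
  sMulSi 0, .rw actOne 0] []

theorem invBraid00 : Valid D (inverseRule (braidInverse (.mx 0) (.mx 1)) (braid (.mx 1) (.mx 0)))
  := .prove [.rw sMul 0, .rw sMul 0, .wr actMul 0, .wr actMul 0, .rw gamAntipode 0, .rw mulAssoc
  0, .rw sMulSi 0, .rw mulOne 0, .rw mulAssoc 0, .rw sMulSi 0, .rw mulOne 0, .rw
  conjGamAntipodeGam 0, .rw actOne 0, .rw actOne 0] []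

theorem triangle01 : Valid D (triangleRule (.mx 0) (.vx 1)) := .prove [] []

theorem braidInv01 : Valid D (inverseRule (braid (.mx 0) (.vx 1)) (braidInverse (.vx 1) (.mx 0)))
  := .prove [.wr actMul 0, .rw siMulS 0, .rw actOne 0] []

theorem invBraid01 : Valid D (inverseRule (braidInverse (.mx 0) (.vx 1)) (braid (.vx 1) (.mx 0)))
  := .prove [.rw actOm 0, .wr actMul 0, .rw sMul 0, .rw omxOmx 0, .rw siOm 0, .rw ptFSi 0, .rw
  siMulS 0, .rw actOne 0] []

theorem triangle10 : Valid D (triangleRule (.vx 0) (.mx 1)) := .prove [] []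

theorem braidInv10 : Valid D (inverseRule (braid (.vx 0) (.mx 1)) (braidInverse (.mx 1) (.vx 0)))
  := .prove [.rw actOm 0, .wr actMul 0, .rw siMul 0, .rw omxOmx 0, .rw sOm 0, .rw ptFiS 0, .rw
  sMulSi 0, .rw actOne 0] []

theorem invBraid10 : Valid D (inverseRule (braidInverse (.vx 0) (.mx 1)) (braid (.mx 1) (.vx 0)))
  := .prove [.wr actMul 0, .rw sMulSi 0, .rw actOne 0] []

theorem linearBraid11 : Valid D (linearRule (braid (.vx 0) (.vx 1))) := .prove [.rw mulAssoc 0] []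

/-- Among the triangles, only this one involves an associator that is not that of `S`. It is trivial
on the unit by the counit axiom of `γ` and `ε(g) = 1`. -/
theorem triangle11 : Valid D (triangleRule (.vx 0) (.vx 1)) := .prove [.rw mulCounit 0, .rw
  gamCounitLeft 0, .rw counitG 0, .rw mulOne 0] []

theorem braidInv11 : Valid D (inverseRule (braid (.vx 0) (.vx 1)) (braidInverse (.vx 1) (.vx 0)))
  := .prove [.rw betBeti 0, .rw omxOmx 0, .rw mulAssoc 0, .rw siMulS 0, .rw mulOne 0] []

theorem invBraid11 : Valid D (inverseRule (braidInverse (.vx 0) (.vx 1)) (braid (.vx 1) (.vx 0)))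
  := .prove [.rw betBeti 0, .rw omxOmx 0, .rw mulAssoc 0, .rw sMulSi 0, .rw mulOne 0] []

end Mor
end
end HopfExt

namespace HopfExt

section

variable {S : Type u} [Category.{v} S] [MonoidalCategory S] [SymmetricCategory S]
variable {H : S} [HopfObj H]

/-! ### Interpretation in `Ext H` -/

/-- An object with the trivial action. -/
def trivOn (H : S) [HopfObj H] (U : S) : Mod S H where
  X := U
  mod :=
    { smul := ε[H] ▷ U ≫ (λ_ U).hom
      one_smul := by
        change η[H] ▷ U ≫ ε[H] ▷ U ≫ (λ_ U).hom = (λ_ U).hom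
        rw [← comp_whiskerRight_assoc, BimonObj.one_counit]
        simp
      mul_smul := by
        change μ[H] ▷ U ≫ ε[H] ▷ U ≫ (λ_ U).hom =
          (α_ H H U).hom ≫ H ◁ (ε[H] ▷ U ≫ (λ_ U).hom) ≫ ε[H] ▷ U ≫ (λ_ U).hom
        rw [← comp_whiskerRight_assoc, BimonObj.mul_counit, Comon.tensorObj_counit,
          MonoidalCategory.tensorHom_def]
        simp only [whiskerLeft_comp, comp_whiskerRight, Category.assoc]
        rw [whisker_exchange_assoc, whisker_exchange_assoc]
        simp }

/-- Faithfulness reduces every equation in `Ext H` to one in `S`. -/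
theorem und_map_injective {X Y : Ext H} {f f' : X ⟶ Y} (h : (und H).map f = (und H).map f') :
    f = f' := by
  match X, Y, f, f' with
  | .inl _, .inl _, ⟨f⟩, ⟨f'⟩ => exact congrArg ULift.up (Mod.hom_ext _ _ h)
  | .inr _, .inr _, ⟨f⟩, ⟨f'⟩ => exact congrArg ULift.up h

/-- Four modules as an environment. -/
def env (A B C E : Mod S H) : ℕ → Mod S H
  | 0 => A
  | 1 => B
  | 2 => C
  | _ => E

/-- The data with the inverse of the antipode. -/
@[reducible] noncomputable def Data.std (D : Data H) [IsIso 𝒮[H]] : Data H :=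
  { D with Si := inv 𝒮[H] }

variable (D : Data H) [IsIso 𝒮[H]] [hD : D.std.Lawful]

theorem Mor.sem_linear {X Y : Ob} (f : Mor X Y) (hv : Valid D (linearRule f)) (E : ℕ → Mod S H)
    (h : Ex.ok (X.action ⨟ f.ex) = true := by decide +kernel) :
    X.action.sem D E ≫ f.ex.sem D E = H ◁ f.ex.sem D E ≫ Y.action.sem D E :=
  Ex.sem_eq D E _ _ hv h

theorem Mor.sem_inverse {X Y : Ob} (f : Mor X Y) (f' : Mor Y X) (hv : Valid D (inverseRule f f'))
    (E : ℕ → Mod S H) (h : Ex.ok (f ⨾ f').ex = true := by decide +kernel) :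
    (f ⨾ f').ex.sem D E = (Mor.id X).ex.sem D E :=
  Ex.sem_eq D E _ _ hv h

/-- The associativity isomorphism, in the direction `X ∗ (Y ∗ Z) ⟶ (X ∗ Y) ∗ Z`. -/
noncomputable def assocIso : (X Y Z : Ext H) → (tObj X (tObj Y Z) ≅ tObj (tObj X Y) Z)
  | .inl A, .inl B, .inl C =>
    (Sum.inl_ _ _).mapIso (modIso H (α_ A.X B.X C.X).symm
      -- Environments have four places; places beyond the objects involved are filled by repetition.
      (Mor.sem_linear D.std _ (Mor.linear000 D.std) (env A B C C)))
  | .inl A, .inl B, .inr W => (Sum.inr_ _ _).mapIso (α_ A.X B.X W).symm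
  | .inl A, .inr V, .inl C =>
    (Sum.inr_ _ _).mapIso {
      hom := assocMap D.gam D.lam D.g (.inl A) (.inr V) (.inl C)
      inv := (Mor.assocInverse (.mx 0) (.vx 1) (.mx 2)).ex.sem D.std (env A (trivOn H V) C C)
      hom_inv_id := Mor.sem_inverse D.std _ _ (Mor.assocInv010 D.std) (env A (trivOn H V) C C)
      inv_hom_id := Mor.sem_inverse D.std _ _ (Mor.invAssoc010 D.std) (env A (trivOn H V) C C) }
  | .inl A, .inr V, .inr W =>
    (Sum.inl_ _ _).mapIso (modIso H {
      hom := assocMap D.gam D.lam D.g (.inl A) (.inr V) (.inr W)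
      inv := (Mor.assocInverse (.mx 0) (.vx 1) (.vx 2)).ex.sem D.std (env A (trivOn H V) (trivOn H W) (trivOn H W))
      hom_inv_id := Mor.sem_inverse D.std _ _ (Mor.assocInv011 D.std) (env A (trivOn H V) (trivOn H W) (trivOn H W))
      inv_hom_id := Mor.sem_inverse D.std _ _ (Mor.invAssoc011 D.std) (env A (trivOn H V) (trivOn H W) (trivOn H W)) }
      (Mor.sem_linear D.std _ (Mor.linear011 D.std) (env A (trivOn H V) (trivOn H W) (trivOn H W))))
  | .inr U, .inl B, .inl C =>
    (Sum.inr_ _ _).mapIso {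
      hom := assocMap D.gam D.lam D.g (.inr U) (.inl B) (.inl C)
      inv := (Mor.assocInverse (.vx 0) (.mx 1) (.mx 2)).ex.sem D.std (env (trivOn H U) B C C)
      hom_inv_id := Mor.sem_inverse D.std _ _ (Mor.assocInv100 D.std) (env (trivOn H U) B C C)
      inv_hom_id := Mor.sem_inverse D.std _ _ (Mor.invAssoc100 D.std) (env (trivOn H U) B C C) }
  | .inr U, .inl B, .inr W =>
    (Sum.inl_ _ _).mapIso (modIso H {
      hom := assocMap D.gam D.lam D.g (.inr U) (.inl B) (.inr W)
      inv := (Mor.assocInverse (.vx 0) (.mx 1) (.vx 2)).ex.sem D.std (env (trivOn H U) B (trivOn H W) (trivOn H W))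
      hom_inv_id := Mor.sem_inverse D.std _ _ (Mor.assocInv101 D.std) (env (trivOn H U) B (trivOn H W) (trivOn H W))
      inv_hom_id := Mor.sem_inverse D.std _ _ (Mor.invAssoc101 D.std) (env (trivOn H U) B (trivOn H W) (trivOn H W)) }
      (Mor.sem_linear D.std _ (Mor.linear101 D.std) (env (trivOn H U) B (trivOn H W) (trivOn H W))))
  | .inr U, .inr V, .inl C =>
    (Sum.inl_ _ _).mapIso (modIso H {
      hom := assocMap D.gam D.lam D.g (.inr U) (.inr V) (.inl C)
      inv := (Mor.assocInverse (.vx 0) (.vx 1) (.mx 2)).ex.sem D.std (env (trivOn H U) (trivOn H V) C C)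
      hom_inv_id := Mor.sem_inverse D.std _ _ (Mor.assocInv110 D.std) (env (trivOn H U) (trivOn H V) C C)
      inv_hom_id := Mor.sem_inverse D.std _ _ (Mor.invAssoc110 D.std) (env (trivOn H U) (trivOn H V) C C) }
      (Mor.sem_linear D.std _ (Mor.linear110 D.std) (env (trivOn H U) (trivOn H V) C C)))
  | .inr U, .inr V, .inr W =>
    (Sum.inr_ _ _).mapIso {
      hom := assocMap D.gam D.lam D.g (.inr U) (.inr V) (.inr W)
      inv := (Mor.assocInverse (.vx 0) (.vx 1) (.vx 2)).ex.sem D.std (env (trivOn H U) (trivOn H V) (trivOn H W) (trivOn H W))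
      hom_inv_id := Mor.sem_inverse D.std _ _ (Mor.assocInv111 D.std) (env (trivOn H U) (trivOn H V) (trivOn H W) (trivOn H W))
      inv_hom_id := Mor.sem_inverse D.std _ _ (Mor.invAssoc111 D.std) (env (trivOn H U) (trivOn H V) (trivOn H W) (trivOn H W)) }

theorem und_assocIso (X Y Z : Ext H) :
    (und H).map (assocIso D X Y Z).hom = assocMap D.gam D.lam D.g X Y Z := by
  match X, Y, Z with
  | .inl _, .inl _, .inl _ => rfl
  | .inl _, .inl _, .inr _ => rfl
  | .inl _, .inr _, .inl _ => rfl
  | .inl _, .inr _, .inr _ => rfl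
  | .inr _, .inl _, .inl _ => rfl
  | .inr _, .inl _, .inr _ => rfl
  | .inr _, .inr _, .inl _ => rfl
  | .inr _, .inr _, .inr _ => rfl

/-- In each of the sixteen cases the interpretation of the syntactic pentagon unfolds to the
required equation. An object of degree 1 enters the environment with the trivial action, but its
action does not occur in the equation. -/
theorem assocIso_pentagon (W X Y Z : Ext H) :
    tHom (𝟙 W) (assocIso D X Y Z).hom ≫ (assocIso D W (tObj X Y) Z).hom ≫
      tHom (assocIso D W X Y).hom (𝟙 Z) =
    (assocIso D W X (tObj Y Z)).hom ≫ (assocIso D (tObj W X) Y Z).hom := by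
  apply und_map_injective
  match W, X, Y, Z with
  | .inl A, .inl B, .inl C, .inl E =>
    exact Ex.sem_eq D.std (env A B C E) _ _ (Mor.pentagon0000 D.std)
  | .inl A, .inl B, .inl C, .inr X =>
    exact Ex.sem_eq D.std (env A B C (trivOn H X)) _ _ (Mor.pentagon0001 D.std)
  | .inl A, .inl B, .inr W, .inl E =>
    exact Ex.sem_eq D.std (env A B (trivOn H W) E) _ _ (Mor.pentagon0010 D.std)
  | .inl A, .inl B, .inr W, .inr X =>
    exact Ex.sem_eq D.std (env A B (trivOn H W) (trivOn H X)) _ _ (Mor.pentagon0011 D.std)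
  | .inl A, .inr V, .inl C, .inl E =>
    exact Ex.sem_eq D.std (env A (trivOn H V) C E) _ _ (Mor.pentagon0100 D.std)
  | .inl A, .inr V, .inl C, .inr X =>
    exact Ex.sem_eq D.std (env A (trivOn H V) C (trivOn H X)) _ _ (Mor.pentagon0101 D.std)
  | .inl A, .inr V, .inr W, .inl E =>
    exact Ex.sem_eq D.std (env A (trivOn H V) (trivOn H W) E) _ _ (Mor.pentagon0110 D.std)
  | .inl A, .inr V, .inr W, .inr X =>
    exact Ex.sem_eq D.std (env A (trivOn H V) (trivOn H W) (trivOn H X)) _ _ (Mor.pentagon0111 D.std)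
  | .inr U, .inl B, .inl C, .inl E =>
    exact Ex.sem_eq D.std (env (trivOn H U) B C E) _ _ (Mor.pentagon1000 D.std)
  | .inr U, .inl B, .inl C, .inr X =>
    exact Ex.sem_eq D.std (env (trivOn H U) B C (trivOn H X)) _ _ (Mor.pentagon1001 D.std)
  | .inr U, .inl B, .inr W, .inl E =>
    exact Ex.sem_eq D.std (env (trivOn H U) B (trivOn H W) E) _ _ (Mor.pentagon1010 D.std)
  | .inr U, .inl B, .inr W, .inr X =>
    exact Ex.sem_eq D.std (env (trivOn H U) B (trivOn H W) (trivOn H X)) _ _ (Mor.pentagon1011 D.std)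
  | .inr U, .inr V, .inl C, .inl E =>
    exact Ex.sem_eq D.std (env (trivOn H U) (trivOn H V) C E) _ _ (Mor.pentagon1100 D.std)
  | .inr U, .inr V, .inl C, .inr X =>
    exact Ex.sem_eq D.std (env (trivOn H U) (trivOn H V) C (trivOn H X)) _ _ (Mor.pentagon1101 D.std)
  | .inr U, .inr V, .inr W, .inl E =>
    exact Ex.sem_eq D.std (env (trivOn H U) (trivOn H V) (trivOn H W) E) _ _ (Mor.pentagon1110 D.std)
  | .inr U, .inr V, .inr W, .inr X =>
    exact Ex.sem_eq D.std (env (trivOn H U) (trivOn H V) (trivOn H W) (trivOn H X)) _ _ (Mor.pentagon1111 D.std)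

end
end HopfExt

namespace HopfExt

/-! ### The triangle, the braiding and the hexagons. -/

section

variable {S : Type u} [Category.{v} S] [MonoidalCategory S] [SymmetricCategory S]
variable {H : S} [HopfObj H]

variable (D : Data H) [IsIso 𝒮[H]] [hD : D.std.Lawful]

theorem assocIso_triangle (X Y : Ext H) :
    (assocIso D X (tUnit H) Y).hom ≫ tHom (tRight X).hom (𝟙 Y) = tHom (𝟙 X) (tLeft Y).hom := by
  apply und_map_injective
  match X, Y with
  | .inl A, .inl B =>
    exact Ex.sem_eq D.std (env A B B B) _ _ (Mor.triangle00 D.std)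
  | .inl A, .inr V =>
    exact Ex.sem_eq D.std (env A (trivOn H V) (trivOn H V) (trivOn H V)) _ _ (Mor.triangle01 D.std)
  | .inr U, .inl B =>
    exact Ex.sem_eq D.std (env (trivOn H U) B B B) _ _ (Mor.triangle10 D.std)
  | .inr U, .inr V =>
    exact Ex.sem_eq D.std (env (trivOn H U) (trivOn H V) (trivOn H V) (trivOn H V)) _ _ (Mor.triangle11 D.std)

/-- The braiding isomorphism. -/
noncomputable def braidIso : (X Y : Ext H) → (tObj X Y ≅ tObj Y X)
  | .inl A, .inl B =>
    (Sum.inl_ _ _).mapIso (modIso H {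
      hom := braidMap D.gam D.s D.si D.bet D.om (.inl A) (.inl B)
      inv := (Mor.braidInverse (.mx 0) (.mx 1)).ex.sem D.std (env B A A A)
      hom_inv_id := Mor.sem_inverse D.std _ _ (Mor.braidInv00 D.std) (env A B B B)
      inv_hom_id := Mor.sem_inverse D.std _ _ (Mor.invBraid00 D.std) (env B A A A) }
      (Mor.sem_linear D.std _ (Mor.linearBraid00 D.std) (env A B B B)))
  | .inl A, .inr V =>
    (Sum.inr_ _ _).mapIso {
      hom := braidMap D.gam D.s D.si D.bet D.om (.inl A) (.inr V)
      inv := (Mor.braidInverse (.vx 0) (.mx 1)).ex.sem D.std (env (trivOn H V) A A A)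
      hom_inv_id := Mor.sem_inverse D.std _ _ (Mor.braidInv01 D.std) (env A (trivOn H V) (trivOn H V) (trivOn H V))
      inv_hom_id := Mor.sem_inverse D.std _ _ (Mor.invBraid10 D.std) (env (trivOn H V) A A A) }
  | .inr U, .inl B =>
    (Sum.inr_ _ _).mapIso {
      hom := braidMap D.gam D.s D.si D.bet D.om (.inr U) (.inl B)
      inv := (Mor.braidInverse (.mx 0) (.vx 1)).ex.sem D.std (env B (trivOn H U) (trivOn H U) (trivOn H U))
      hom_inv_id := Mor.sem_inverse D.std _ _ (Mor.braidInv10 D.std) (env (trivOn H U) B B B)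
      inv_hom_id := Mor.sem_inverse D.std _ _ (Mor.invBraid01 D.std) (env B (trivOn H U) (trivOn H U) (trivOn H U)) }
  | .inr U, .inr V =>
    (Sum.inl_ _ _).mapIso (modIso H {
      hom := braidMap D.gam D.s D.si D.bet D.om (.inr U) (.inr V)
      inv := (Mor.braidInverse (.vx 0) (.vx 1)).ex.sem D.std (env (trivOn H V) (trivOn H U) (trivOn H U) (trivOn H U))
      hom_inv_id := Mor.sem_inverse D.std _ _ (Mor.braidInv11 D.std) (env (trivOn H U) (trivOn H V) (trivOn H V) (trivOn H V))
      inv_hom_id := Mor.sem_inverse D.std _ _ (Mor.invBraid11 D.std) (env (trivOn H V) (trivOn H U) (trivOn H U) (trivOn H U)) }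
      (Mor.sem_linear D.std _ (Mor.linearBraid11 D.std) (env (trivOn H U) (trivOn H V) (trivOn H V) (trivOn H V))))

theorem und_braidIso (X Y : Ext H) :
    (und H).map (braidIso D X Y).hom = braidMap D.gam D.s D.si D.bet D.om X Y := by
  match X, Y with
  | .inl _, .inl _ => rfl
  | .inl _, .inr _ => rfl
  | .inr _, .inl _ => rfl
  | .inr _, .inr _ => rfl

theorem braidIso_hexagon (X Y Z : Ext H) :
    tHom (𝟙 X) (braidIso D Y Z).hom ≫ (assocIso D X Z Y).hom ≫ tHom (braidIso D X Z).hom (𝟙 Y) =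
      (assocIso D X Y Z).hom ≫ (braidIso D (tObj X Y) Z).hom ≫ (assocIso D Z X Y).hom := by
  apply und_map_injective
  match X, Y, Z with
  | .inl A, .inl B, .inl C =>
    exact Ex.sem_eq D.std (env A B C C) _ _ (Mor.hexagon000 D.std)
  | .inl A, .inl B, .inr W =>
    exact Ex.sem_eq D.std (env A B (trivOn H W) (trivOn H W)) _ _ (Mor.hexagon001 D.std)
  | .inl A, .inr V, .inl C =>
    exact Ex.sem_eq D.std (env A (trivOn H V) C C) _ _ (Mor.hexagon010 D.std)
  | .inl A, .inr V, .inr W =>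
    exact Ex.sem_eq D.std (env A (trivOn H V) (trivOn H W) (trivOn H W)) _ _ (Mor.hexagon011 D.std)
  | .inr U, .inl B, .inl C =>
    exact Ex.sem_eq D.std (env (trivOn H U) B C C) _ _ (Mor.hexagon100 D.std)
  | .inr U, .inl B, .inr W =>
    exact Ex.sem_eq D.std (env (trivOn H U) B (trivOn H W) (trivOn H W)) _ _ (Mor.hexagon101 D.std)
  | .inr U, .inr V, .inl C =>
    exact Ex.sem_eq D.std (env (trivOn H U) (trivOn H V) C C) _ _ (Mor.hexagon110 D.std)
  | .inr U, .inr V, .inr W =>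
    exact Ex.sem_eq D.std (env (trivOn H U) (trivOn H V) (trivOn H W) (trivOn H W)) _ _ (Mor.hexagon111 D.std)

/-- The second hexagon axiom, in the form of the first one for the family of inverse braidings. -/
theorem braidIso_hexagon_inv (X Y Z : Ext H) :
    tHom (𝟙 X) (braidIso D Z Y).inv ≫ (assocIso D X Z Y).hom ≫ tHom (braidIso D Z X).inv (𝟙 Y) =
      (assocIso D X Y Z).hom ≫ (braidIso D Z (tObj X Y)).inv ≫ (assocIso D Z X Y).hom := by
  apply und_map_injective
  match X, Y, Z with
  | .inl A, .inl B, .inl C =>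
    exact Ex.sem_eq D.std (env A B C C) _ _ (Mor.hexagonInv000 D.std)
  | .inl A, .inl B, .inr W =>
    -- The inverse braiding contains `ω` of a tensor product, whereas the syntax applies `ω` to each
    -- factor. Monoidality of `ω` reconciles the two whenever the third object has degree 1.
    have h : (und H).map (braidIso D (.inr W) (tObj (.inl A) (.inl B))).inv =
        ((D.om.app A.X ⊗ₘ D.om.app B.X) ≫ actPt D.si (tensorMod A B)) ▷ W ≫
          (β_ (A.X ⊗ B.X) W).hom :=
      congrArg (fun w => (w ≫ actPt D.si (tensorMod A B)) ▷ W ≫ (β_ (A.X ⊗ B.X) W).hom)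
        (D.std.om_tensor A.X B.X)
    rw [Functor.map_comp _ (assocIso D _ _ _).hom, Functor.map_comp _ (braidIso D _ _).inv, h]
    exact Ex.sem_eq D.std (env A B (trivOn H W) (trivOn H W)) _ _ (Mor.hexagonInv001 D.std)
  | .inl A, .inr V, .inl C =>
    exact Ex.sem_eq D.std (env A (trivOn H V) C C) _ _ (Mor.hexagonInv010 D.std)
  | .inl A, .inr V, .inr W =>
    have h : (und H).map (braidIso D (.inr W) (tObj (.inl A) (.inr V))).inv =
        scal (D.beti) (rmul D.s ⊗ₘ ((D.om.app A.X ⊗ₘ D.om.app V) ▷ W ≫ (β_ (A.X ⊗ V) W).hom)) :=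
      congrArg (fun w => scal (D.beti) (rmul D.s ⊗ₘ (w ▷ W ≫ (β_ (A.X ⊗ V) W).hom)))
        (D.std.om_tensor A.X V)
    rw [Functor.map_comp _ (assocIso D _ _ _).hom, Functor.map_comp _ (braidIso D _ _).inv, h]
    exact Ex.sem_eq D.std (env A (trivOn H V) (trivOn H W) (trivOn H W)) _ _ (Mor.hexagonInv011 D.std)
  | .inr U, .inl B, .inl C =>
    exact Ex.sem_eq D.std (env (trivOn H U) B C C) _ _ (Mor.hexagonInv100 D.std)
  | .inr U, .inl B, .inr W =>
    have h : (und H).map (braidIso D (.inr W) (tObj (.inr U) (.inl B))).inv =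
        scal (D.beti) (rmul D.s ⊗ₘ ((D.om.app U ⊗ₘ D.om.app B.X) ▷ W ≫ (β_ (U ⊗ B.X) W).hom)) :=
      congrArg (fun w => scal (D.beti) (rmul D.s ⊗ₘ (w ▷ W ≫ (β_ (U ⊗ B.X) W).hom)))
        (D.std.om_tensor U B.X)
    rw [Functor.map_comp _ (assocIso D _ _ _).hom, Functor.map_comp _ (braidIso D _ _).inv, h]
    exact Ex.sem_eq D.std (env (trivOn H U) B (trivOn H W) (trivOn H W)) _ _ (Mor.hexagonInv101 D.std)
  | .inr U, .inr V, .inl C =>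
    exact Ex.sem_eq D.std (env (trivOn H U) (trivOn H V) C C) _ _ (Mor.hexagonInv110 D.std)
  | .inr U, .inr V, .inr W =>
    have h : (und H).map (braidIso D (.inr W) (tObj (.inr U) (.inr V))).inv =
        ((D.om.app H ⊗ₘ (D.om.app U ⊗ₘ D.om.app V)) ≫ actPt D.si (freeMod H (U ⊗ V))) ▷ W ≫
          (β_ (H ⊗ (U ⊗ V)) W).hom :=
      congrArg (fun w => (w ≫ actPt D.si (freeMod H (U ⊗ V))) ▷ W ≫ (β_ (H ⊗ (U ⊗ V)) W).hom)
        ((D.std.om_tensor H (U ⊗ V)).trans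
          (congrArg (D.om.app H ⊗ₘ ·) (D.std.om_tensor U V)))
    rw [Functor.map_comp _ (assocIso D _ _ _).hom, Functor.map_comp _ (braidIso D _ _).inv, h]
    exact Ex.sem_eq D.std (env (trivOn H U) (trivOn H V) (trivOn H W) (trivOn H W)) _ _ (Mor.hexagonInv111 D.std)

end
end HopfExt

namespace HopfExt

/-! ### Functoriality of the tensor product and naturality. -/

section

variable {S : Type u} [Category.{v} S] [MonoidalCategory S] [SymmetricCategory S]
variable {H : S} [HopfObj H]

/-- The morphism between objects of the same shape. -/
def Sh.map {E E' : ℕ → Mod S H} (φ : ∀ i, E i ⟶ E' i) : (s : Sh) → (s.obj E ⟶ s.obj E')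
  | .one => 𝟙 _
  | .H => 𝟙 _
  | .X i => (φ i).hom
  | .t l r => l.map φ ⊗ₘ r.map φ

/-- Naturality by induction on the syntax: every constructor is natural in the modules, for `act`
because the `φ i` are linear and for `omx` because `ω` is natural. No computation with diagrams is
needed. -/
theorem Ex.sem_natural (D : Data H) {E E' : ℕ → Mod S H} (φ : ∀ i, E i ⟶ E' i) {s t : Sh}
    (e : Ex s t) : s.map φ ≫ e.sem D E' = e.sem D E ≫ t.map φ := by
  induction e with
  | id a => simp [Ex.sem]
  | comp e f he hf => simp only [Ex.sem, Category.assoc, reassoc_of% he, hf]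
  | tens e f he hf => simp only [Ex.sem, Sh.map, tensorHom_comp_tensorHom, he, hf]
  | whL a e he => simp [Ex.sem, Sh.map, ← id_tensorHom, tensorHom_comp_tensorHom, he]
  | whR e a he => simp [Ex.sem, Sh.map, ← tensorHom_id, tensorHom_comp_tensorHom, he]
  | al a b c => exact associator_naturality _ _ _
  | al' a b c => exact associator_inv_naturality _ _ _
  | lu a => simp [Ex.sem, Sh.map]
  | lu' a => simp [Ex.sem, Sh.map]
  | ru a => simp [Ex.sem, Sh.map]
  | ru' a => simp [Ex.sem, Sh.map]
  | br a b => exact braiding_naturality _ _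
  | mul => simp [Ex.sem, Sh.map]
  | comul => simp [Ex.sem, Sh.map]
  | pt p => simp [Ex.sem, Sh.map]
  | cov p => simp [Ex.sem, Sh.map]
  | en p => simp [Ex.sem, Sh.map]
  | gam => simp [Ex.sem, Sh.map]
  | ev => simp [Ex.sem, Sh.map]
  | sc p => simp [Ex.sem, Sh.map]
  | act i =>
    have h : HopfExt.act (E i) ≫ (φ i).hom = H ◁ (φ i).hom ≫ HopfExt.act (E' i) :=
      IsModHom.smul_hom
    simp only [Ex.sem, Sh.map, id_tensorHom, h]
  | omx i => exact D.om.naturality _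

/-- A morphism between objects with the trivial action. -/
def trivOnMap (H : S) [HopfObj H] {U V : S} (f : U ⟶ V) : trivOn H U ⟶ trivOn H V :=
  Mod.Hom.mk' (M := trivOn H U) (N := trivOn H V) f (by
    change (ε[H] ▷ U ≫ (λ_ U).hom) ≫ f = H ◁ f ≫ ε[H] ▷ V ≫ (λ_ V).hom
    rw [whisker_exchange_assoc]
    simp)

/-- Morphisms between environments. -/
def envMap {A B C F A' B' C' F' : Mod S H} (a : A ⟶ A') (b : B ⟶ B') (c : C ⟶ C') (d : F ⟶ F') :
    ∀ i, env A B C F i ⟶ env A' B' C' F' i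
  | 0 => a
  | 1 => b
  | 2 => c
  | _ + 3 => d

theorem tHom_id (X Y : Ext H) : tHom (𝟙 X) (𝟙 Y) = 𝟙 (tObj X Y) := by
  apply und_map_injective
  match X, Y with
  | .inl A, .inl B => exact id_tensorHom_id A.X B.X
  | .inl A, .inr V => exact id_tensorHom_id A.X V
  | .inr U, .inl B => exact id_tensorHom_id U B.X
  | .inr U, .inr V =>
    exact (congrArg (H ◁ ·) (id_tensorHom_id U V)).trans (whiskerLeft_id H (U ⊗ V))

theorem tHom_comp {X X' X'' Y Y' Y'' : Ext H} (f : X ⟶ X') (f' : X' ⟶ X'') (g : Y ⟶ Y')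
    (g' : Y' ⟶ Y'') : tHom f g ≫ tHom f' g' = tHom (f ≫ f') (g ≫ g') := by
  apply und_map_injective
  match X, X', X'', Y, Y', Y'', f, f', g, g' with
  | .inl _, .inl _, .inl _, .inl _, .inl _, .inl _, ⟨f⟩, ⟨f'⟩, ⟨g⟩, ⟨g'⟩ =>
    exact tensorHom_comp_tensorHom f.hom g.hom f'.hom g'.hom
  | .inl _, .inl _, .inl _, .inr _, .inr _, .inr _, ⟨f⟩, ⟨f'⟩, ⟨g⟩, ⟨g'⟩ =>
    exact tensorHom_comp_tensorHom f.hom g f'.hom g'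
  | .inr _, .inr _, .inr _, .inl _, .inl _, .inl _, ⟨f⟩, ⟨f'⟩, ⟨g⟩, ⟨g'⟩ =>
    exact tensorHom_comp_tensorHom f g.hom f' g'.hom
  | .inr _, .inr _, .inr _, .inr _, .inr _, .inr _, ⟨f⟩, ⟨f'⟩, ⟨g⟩, ⟨g'⟩ =>
    exact (whiskerLeft_comp H (f ⊗ₘ g) (f' ⊗ₘ g')).symm.trans
      (congrArg (H ◁ ·) (tensorHom_comp_tensorHom f g f' g'))

theorem tLeft_naturality {X Y : Ext H} (f : X ⟶ Y) :
    tHom (𝟙 (tUnit H)) f ≫ (tLeft Y).hom = (tLeft X).hom ≫ f := by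
  apply und_map_injective
  match X, Y, f with
  | .inl _, .inl _, ⟨f⟩ =>
    exact (congrArg (· ≫ _) (id_tensorHom (𝟙_ S) f.hom)).trans (leftUnitor_naturality f.hom)
  | .inr _, .inr _, ⟨f⟩ =>
    exact (congrArg (· ≫ _) (id_tensorHom (𝟙_ S) f)).trans (leftUnitor_naturality f)

theorem tRight_naturality {X Y : Ext H} (f : X ⟶ Y) :
    tHom f (𝟙 (tUnit H)) ≫ (tRight Y).hom = (tRight X).hom ≫ f := by
  apply und_map_injective
  match X, Y, f with
  | .inl _, .inl _, ⟨f⟩ =>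
    exact (congrArg (· ≫ _) (tensorHom_id f.hom (𝟙_ S))).trans (rightUnitor_naturality f.hom)
  | .inr _, .inr _, ⟨f⟩ =>
    exact (congrArg (· ≫ _) (tensorHom_id f (𝟙_ S))).trans (rightUnitor_naturality f)

variable (D : Data H) [IsIso 𝒮[H]] [hD : D.std.Lawful]

theorem assocIso_naturality {X X' Y Y' Z Z' : Ext H} (f : X ⟶ X') (g : Y ⟶ Y') (k : Z ⟶ Z') :
    tHom f (tHom g k) ≫ (assocIso D X' Y' Z').hom =
      (assocIso D X Y Z).hom ≫ tHom (tHom f g) k := by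
  apply und_map_injective
  match X, X', Y, Y', Z, Z', f, g, k with
  | .inl _, .inl _, .inl _, .inl _, .inl _, .inl _, ⟨f⟩, ⟨g⟩, ⟨k⟩ =>
    have h := Ex.sem_natural D.std (envMap f g k k)
      (Mor.assoc (.mx 0) (.mx 1) (.mx 2)).ex
    -- The identity on the factor `H` of a free module turns into a whiskering, as in `freeModMap`.
    simp only [Sh.map, id_tensorHom] at h
    exact h
  | .inl _, .inl _, .inl _, .inl _, .inr _, .inr _, ⟨f⟩, ⟨g⟩, ⟨k⟩ =>
    have h := Ex.sem_natural D.std (envMap f g (trivOnMap H k) (trivOnMap H k))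
      (Mor.assoc (.mx 0) (.mx 1) (.vx 2)).ex
    simp only [Sh.map, id_tensorHom] at h
    exact h
  | .inl _, .inl _, .inr _, .inr _, .inl _, .inl _, ⟨f⟩, ⟨g⟩, ⟨k⟩ =>
    have h := Ex.sem_natural D.std (envMap f (trivOnMap H g) k k)
      (Mor.assoc (.mx 0) (.vx 1) (.mx 2)).ex
    simp only [Sh.map, id_tensorHom] at h
    exact h
  | .inl _, .inl _, .inr _, .inr _, .inr _, .inr _, ⟨f⟩, ⟨g⟩, ⟨k⟩ =>
    have h := Ex.sem_natural D.std (envMap f (trivOnMap H g) (trivOnMap H k) (trivOnMap H k))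
      (Mor.assoc (.mx 0) (.vx 1) (.vx 2)).ex
    simp only [Sh.map, id_tensorHom] at h
    exact h
  | .inr _, .inr _, .inl _, .inl _, .inl _, .inl _, ⟨f⟩, ⟨g⟩, ⟨k⟩ =>
    have h := Ex.sem_natural D.std (envMap (trivOnMap H f) g k k)
      (Mor.assoc (.vx 0) (.mx 1) (.mx 2)).ex
    simp only [Sh.map, id_tensorHom] at h
    exact h
  | .inr _, .inr _, .inl _, .inl _, .inr _, .inr _, ⟨f⟩, ⟨g⟩, ⟨k⟩ =>
    have h := Ex.sem_natural D.std (envMap (trivOnMap H f) g (trivOnMap H k) (trivOnMap H k))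
      (Mor.assoc (.vx 0) (.mx 1) (.vx 2)).ex
    simp only [Sh.map, id_tensorHom] at h
    exact h
  | .inr _, .inr _, .inr _, .inr _, .inl _, .inl _, ⟨f⟩, ⟨g⟩, ⟨k⟩ =>
    have h := Ex.sem_natural D.std (envMap (trivOnMap H f) (trivOnMap H g) k k)
      (Mor.assoc (.vx 0) (.vx 1) (.mx 2)).ex
    simp only [Sh.map, id_tensorHom] at h
    exact h
  | .inr _, .inr _, .inr _, .inr _, .inr _, .inr _, ⟨f⟩, ⟨g⟩, ⟨k⟩ =>
    have h := Ex.sem_natural D.std (envMap (trivOnMap H f) (trivOnMap H g) (trivOnMap H k) (trivOnMap H k))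
      (Mor.assoc (.vx 0) (.vx 1) (.vx 2)).ex
    simp only [Sh.map, id_tensorHom] at h
    exact h

theorem braidIso_naturality {X X' Y Y' : Ext H} (f : X ⟶ X') (g : Y ⟶ Y') :
    tHom f g ≫ (braidIso D X' Y').hom = (braidIso D X Y).hom ≫ tHom g f := by
  apply und_map_injective
  match X, X', Y, Y', f, g with
  | .inl _, .inl _, .inl _, .inl _, ⟨f⟩, ⟨g⟩ =>
    have h := Ex.sem_natural D.std (envMap f g g g)
      (Mor.braid (.mx 0) (.mx 1)).ex
    simp only [Sh.map, id_tensorHom] at h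
    exact h
  | .inl _, .inl _, .inr _, .inr _, ⟨f⟩, ⟨g⟩ =>
    have h := Ex.sem_natural D.std (envMap f (trivOnMap H g) (trivOnMap H g) (trivOnMap H g))
      (Mor.braid (.mx 0) (.vx 1)).ex
    simp only [Sh.map, id_tensorHom] at h
    exact h
  | .inr _, .inr _, .inl _, .inl _, ⟨f⟩, ⟨g⟩ =>
    have h := Ex.sem_natural D.std (envMap (trivOnMap H f) g g g)
      (Mor.braid (.vx 0) (.mx 1)).ex
    simp only [Sh.map, id_tensorHom] at h
    exact h
  | .inr _, .inr _, .inr _, .inr _, ⟨f⟩, ⟨g⟩ =>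
    have h := Ex.sem_natural D.std (envMap (trivOnMap H f) (trivOnMap H g) (trivOnMap H g) (trivOnMap H g))
      (Mor.braid (.vx 0) (.vx 1)).ex
    simp only [Sh.map, id_tensorHom] at h
    exact h

end
end HopfExt

namespace HopfExt

/-! ### Assembly of the monoidal and the braided structure. -/

section

variable {S : Type u} [Category.{v} S] [MonoidalCategory S] [SymmetricCategory S]
variable {H : S} [HopfObj H]

theorem tHom_isIso_inv {X X' Y Y' : Ext H} (f : X ≅ X') (g : Y ≅ Y') :
    tHom f.hom g.hom ≫ tHom f.inv g.inv = 𝟙 _ := by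
  rw [tHom_comp, f.hom_inv_id, g.hom_inv_id, tHom_id]

/-- The tensor product of isomorphisms. -/
def tIso {X X' Y Y' : Ext H} (f : X ≅ X') (g : Y ≅ Y') : tObj X Y ≅ tObj X' Y' where
  hom := tHom f.hom g.hom
  inv := tHom f.inv g.inv
  hom_inv_id := tHom_isIso_inv f g
  inv_hom_id := tHom_isIso_inv f.symm g.symm

variable (D : Data H) [IsIso 𝒮[H]] [hD : D.std.Lawful]

theorem monoidalAxioms :
    MonoidalAxioms (extStruct (H := H) fun X Y Z => (assocIso D X Y Z).symm) where
  tensorHom_def {X₁ Y₁ X₂ Y₂} f g := by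
    change tHom f g = tHom f (𝟙 X₂) ≫ tHom (𝟙 Y₁) g
    rw [tHom_comp, Category.comp_id, Category.id_comp]
  id_tensorHom_id X Y := tHom_id X Y
  tensorHom_comp_tensorHom f₁ f₂ g₁ g₂ := tHom_comp f₁ g₁ f₂ g₂
  whiskerLeft_id X Y := tHom_id X Y
  id_whiskerRight X Y := tHom_id X Y
  associator_naturality {X₁ X₂ X₃ Y₁ Y₂ Y₃} f₁ f₂ f₃ := by
    change tHom (tHom f₁ f₂) f₃ ≫ (assocIso D Y₁ Y₂ Y₃).inv =
      (assocIso D X₁ X₂ X₃).inv ≫ tHom f₁ (tHom f₂ f₃)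
    rw [Iso.comp_inv_eq, Category.assoc, assocIso_naturality, Iso.inv_hom_id_assoc]
  leftUnitor_naturality f := tLeft_naturality f
  rightUnitor_naturality f := tRight_naturality f
  pentagon W X Y Z := by
    -- The associator of the monoidal category is inverse to `assocIso`, so the pentagon is obtained
    -- by inverting an equation of isomorphisms.
    have h : tIso (Iso.refl W) (assocIso D X Y Z) ≪≫ assocIso D W (tObj X Y) Z ≪≫
        tIso (assocIso D W X Y) (Iso.refl Z) =
        assocIso D W X (tObj Y Z) ≪≫ assocIso D (tObj W X) Y Z :=
      Iso.ext (assocIso_pentagon D W X Y Z)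
    have h := congrArg Iso.inv h
    simp only [Iso.trans_inv, Category.assoc] at h
    exact h
  triangle X Y := by
    change (assocIso D X (tUnit H) Y).inv ≫ tHom (𝟙 X) (tLeft Y).hom = tHom (tRight X).hom (𝟙 Y)
    rw [← assocIso_triangle D, Iso.inv_hom_id_assoc]

/-- The braiding. -/
@[reducible] noncomputable def braidedCategory :
    @BraidedCategory (Ext H) _ (monoidalAxioms D).toMonoidalCategory :=
  letI := (monoidalAxioms D).toMonoidalCategory
  { braiding := braidIso D
    braiding_naturality_right := fun X Y Z f => braidIso_naturality D (𝟙 X) f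
    braiding_naturality_left := fun f Z => braidIso_naturality D f (𝟙 Z)
    hexagon_forward := fun X Y Z => by
      -- Inverting the hexagon for the inverse braidings yields the forward axiom. The reverse axiom
      -- contains inverse associators, which are the maps `assocIso`, and needs no inversion.
      have h : tIso (Iso.refl Y) (braidIso D X Z).symm ≪≫ assocIso D Y X Z ≪≫
          tIso (braidIso D X Y).symm (Iso.refl Z) =
          assocIso D Y Z X ≪≫ (braidIso D X (tObj Y Z)).symm ≪≫ assocIso D X Y Z :=
        Iso.ext (braidIso_hexagon_inv D Y Z X)
      have h := congrArg Iso.inv h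
      simp only [Iso.trans_inv, Category.assoc] at h
      exact h.symm
    hexagon_reverse := fun X Y Z => (braidIso_hexagon D X Y Z).symm }

end
end HopfExt

theorem theorem2 {S : Type u} [Category.{v} S] [MonoidalCategory S] [SymmetricCategory S]
    [RigidCategory S] (H : S) [HopfObj H] [IsIso 𝒮[H]]
    (gam : 𝟙_ S ⟶ H ⊗ H) (lam : H ⟶ 𝟙_ S) (g g' : 𝟙_ S ⟶ H)
    (sig sig' : 𝟙_ S ⟶ H) (bet : 𝟙_ S ⟶ 𝟙_ S) (om : 𝟭 S ⟶ 𝟭 S)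
    (hg : HopfExt.IsInvPt g g') (hsig : HopfExt.IsInvPt sig sig') (hbet : IsIso bet)
    (hom_mon : NatTrans.IsMonoidal om) (hom_inv : om ≫ om = 𝟙 (𝟭 S))
    (gam_hopf : HopfExt.IsHopfCopairing gam) (gam_nondeg : HopfExt.Nondeg gam)
    (lam_coint : HopfExt.IsRightCointegral lam)
    (lam_g : Δ[H] ≫ H ◁ lam ≫ (ρ_ H).hom = lam ≫ g)
    (lam_norm : gam ≫ H ◁ 𝒮[H] ≫ (lam ⊗ₘ lam) ≫ (λ_ (𝟙_ S)).hom = 𝟙 (𝟙_ S))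
    (gam_symm : gam ≫ (β_ H H).hom = gam ≫ H ◁ (HopfExt.conjPt g' g ≫ 𝒮[H] ≫ 𝒮[H]))
    (gam_sig : gam = sig ≫ Δ[H] ≫ (HopfExt.lmul sig' ⊗ₘ HopfExt.rmul sig'))
    (lam_anti : 𝒮[H] ≫ lam = HopfExt.conjPt sig sig' ≫ lam)
    (lam_sig : sig ≫ lam = bet ≫ bet)
    (sig_cop : HopfExt.IsHopfIsoToCop (HopfExt.conjPt sig sig'))
    (sig_anti : sig ≫ 𝒮[H] = sig ≫ HopfExt.lmul g)
    (sig_g : sig ≫ HopfExt.lmul g = sig ≫ HopfExt.rmul g')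
    (om_gam : gam ≫ H ◁ om.app H =
      gam ≫ (HopfExt.conjPt sig sig' ⊗ₘ (𝒮[H] ≫ HopfExt.conjPt sig' sig))) :
    ∃ a : ∀ X Y Z : HopfExt.Ext H,
        HopfExt.tObj (HopfExt.tObj X Y) Z ≅ HopfExt.tObj X (HopfExt.tObj Y Z),
      (∀ X Y Z, (HopfExt.und H).map (a X Y Z).inv = HopfExt.assocMap gam lam g X Y Z) ∧
      ∃ h : HopfExt.MonoidalAxioms (HopfExt.extStruct a),
      ∃ B : @BraidedCategory (HopfExt.Ext H) _ h.toMonoidalCategory,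
        ∀ X Y : HopfExt.Ext H,
          (HopfExt.und H).map (@BraidedCategory.braiding _ _ h.toMonoidalCategory B X Y).hom =
            HopfExt.braidMap gam sig sig' bet om X Y := by
  -- The evaluation of the duality serves as the box `ev`; of the two zigzag identities only
  -- `coevaluation_evaluation'` is used, as the law `gam_ev`.
  obtain ⟨P, rfl⟩ := gam_nondeg
  let D : HopfExt.Data H :=
    { gam := P.coevaluation', ev := P.evaluation', lam := lam, g := g, gi := g', s := sig, si := sig',
      Si := inv 𝒮[H], bet := bet, beti := inv bet, om := om }
  have : D.std.Lawful :=
    { g_inv := hg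
      s_inv := hsig
      S_Si := IsIso.hom_inv_id _
      Si_S := IsIso.inv_hom_id _
      bet_beti := IsIso.hom_inv_id _
      om_monoidal := hom_mon
      om_om := hom_inv
      gam_hopf := gam_hopf
      gam_ev := P.coevaluation_evaluation'
      lam_coint := lam_coint
      lam_g := lam_g
      lam_norm := lam_norm
      gam_symm := gam_symm
      gam_s := gam_sig
      lam_S := lam_anti
      lam_s := lam_sig
      s_cop := sig_cop
      S_s := sig_anti
      s_g := sig_g
      om_gam := om_gam }
  exact ⟨fun X Y Z => (HopfExt.assocIso D X Y Z).symm, HopfExt.und_assocIso D,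
    HopfExt.monoidalAxioms D, HopfExt.braidedCategory D, HopfExt.und_braidIso D⟩
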